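/- Let $G$ be a connected (finite-dimensional) Lie group, $K$ a closed subgroup, $N=G/K$ the coset manifold with projection $\pi:G\to N$, and let $\mathfrak g=\mathfrak k\oplus\mathfrak p$ be a reductive decomposition, i.e. $\mathfrak k$ is the Lie algebra of $K$ and $\mathfrak p$ is an $\operatorname{Ad}(K)$-invariant subspace of $\mathfrak g$ complementary to $\mathfrak k$. Let $V_{\mathfrak g}=L^2([0,1],\mathfrak g)$ with its flat connection $D$, let $\Phi:V_{\mathfrak g}\to G$ be the parallel transport map, $\Phi(u)=g_u(1)$, where $g_u\in H^1([0,1],G)$ is the unique solution of $dl_g^{-1}(g')=u$, $g(0)=e$, and put $\Phi_N=\pi\circ\Phi:V_{\mathfrak g}\to N$. For $g\in H^1([0,1],G)$ write $g*\hat 0=-dr_g^{-1}(g')$; the horizontal distribution $\mathcal H$ of $\Phi_N$ is defined by $\mathcal H(g*\hat 0)=\{\operatorname{Ad}(g)Y : Y\in\mathfrak p\}\subset V_{\mathfrak g}$ for $g\in H^1([0,1],G)$ with $g(1)\in K$. Let $\varphi:M\to N$ be a smooth immersion of a finite-dimensional manifold, with transversal bundle $\mathcal W$, i.e. a smooth subbundle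 of $\varphi^*TN$ with $T_{\varphi(p)}N=d\varphi(T_pM)\oplus\mathcal W_p$ for all $p\in M$. Put $$\hat M=\{(p,u)\in M\times V_{\mathfrak g} : \varphi(p)=\Phi_N(u)\},\qquad \hat\varphi(p,u)=u,\qquad \hat{\mathcal W}_{(p,u)}=\{X\in\mathcal H(u) : (d\Phi_N)_u(X)\in\mathcal W_p\}.$$ Then $\hat M$ is a smooth embedded submanifold of $M\times V_{\mathfrak g}$, $\hat\varphi:\hat M\to V_{\mathfrak g}$ is an immersion of finite codimension with transversal bundle $\hat{\mathcal W}$, and the following two properties hold. (B) For every $(\hat p,\xi)\in\hat{\mathcal W}$ the shape operator $A_\xi:T_{\hat p}\hat M\to T_{\hat p}\hat M$ is a compact operator. Here $A_\xi$ is defined by requiring $D_Xs+d\hat\varphi(A_\xi X)\in\hat{\mathcal W}_{\hat p}$ for all $X\in T_{\hat p}\hat M$ and all local smooth sections $s$ of $\hat{\mathcal W}$ with $s(\hat p)=\xi$. (A) The end-point map $\eta:\hat{\mathcal W}\to V_{\mathfrak g}$, $(\hat p,\xi)\mapsto\hat\varphi(\hat p)+\xi$, is a Fredholm map of index $0$: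 at every point of $\hat{\mathcal W}$ its differential is a Fredholm operator with $\dim\operatorname{Ker}d\eta=\dim\operatorname{Coker}d\eta<\infty$. -/

import Mathlib

open Set MeasureTheory Manifold Topology
open scoped ContDiff

noncomputable section

/-! ### Submanifolds with transversal bundles -/

section Submanifolds

variable {E₁ : Type*} [NormedAddCommGroup E₁] [NormedSpace ℝ E₁]
  {M : Type*} [TopologicalSpace M] [ChartedSpace E₁ M]
  {E₂ : Type*} [NormedAddCommGroup E₂] [NormedSpace ℝ E₂]
  {N : Type*} [TopologicalSpace N] [ChartedSpace E₂ N] [IsManifold 𝓘(ℝ, E₂) 1 N]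

variable (E₁) in
/-- `s 0, …, s (r - 1)` is a smooth frame, over the open set `U ⊆ M`, of the family
`W p ⊆ T_{f p} N` of subspaces along `f : M → N`: the `s i` are smooth sections of `f^* TN` over
`U`, and their values at each `q ∈ U` form a basis of `W q`. -/
structure IsSmoothFrame (f : M → N) (W : ∀ p, Submodule ℝ (TangentSpace 𝓘(ℝ, E₂) (f p)))
    (U : Set M) {r : ℕ} (s : Fin r → ∀ p, TangentSpace 𝓘(ℝ, E₂) (f p)) : Prop where
  isOpen : IsOpen U
  contMDiffOn : ∀ i, ContMDiffOn 𝓘(ℝ, E₁) 𝓘(ℝ, E₂).tangent ∞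
    (fun q => (⟨f q, s i q⟩ : TangentBundle 𝓘(ℝ, E₂) N)) U
  linearIndependent : ∀ q ∈ U, LinearIndependent ℝ (fun i => s i q)
  span_eq : ∀ q ∈ U, Submodule.span ℝ (range fun i => s i q) = W q

variable (E₁) in
/-- `W` is a transversal bundle of the immersion `f : M → N` of finite codimension: a smooth
vector subbundle of finite rank of `f^* TN`, complementary to `TM`. -/
structure IsTransversalBundle (f : M → N)
    (W : ∀ p, Submodule ℝ (TangentSpace 𝓘(ℝ, E₂) (f p))) : Prop where
  isCompl : ∀ p, IsCompl (mfderiv 𝓘(ℝ, E₁) 𝓘(ℝ, E₂) f p).range (W p)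
  exists_frame : ∀ p, ∃ U : Set M, p ∈ U ∧
    ∃ (r : ℕ) (s : Fin r → ∀ q, TangentSpace 𝓘(ℝ, E₂) (f q)), IsSmoothFrame E₁ f W U s

variable {V : Type*} [NormedAddCommGroup V] [NormedSpace ℝ V]

/-- The derivative `X ↦ D_X f` at `p` of a map `f` from a manifold to a vector space `V`, for the
flat connection `D` of `V`; the tangent spaces of `V` are identified with `V`. -/
def flatDeriv (f : M → V) (p : M) : TangentSpace 𝓘(ℝ, E₁) p →L[ℝ] V :=
  mfderiv 𝓘(ℝ, E₁) 𝓘(ℝ, V) f p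

/-- `A` is the shape operator `A_ξ` at `p` of the immersion `f : M → V` into the flat space `V`
with transversal bundle `W`, where `ξ ∈ W p`. It is given by the Weingarten formula
`D_X s = - df (A_ξ X) + (a vector in W p)`, for every local smooth section `s` of `W` with
`s p = ξ` and every tangent vector `X` at `p`. -/
def IsShapeOperator (f : M → V) (W : M → Submodule ℝ V) (p : M) (ξ : V)
    (A : TangentSpace 𝓘(ℝ, E₁) p →L[ℝ] TangentSpace 𝓘(ℝ, E₁) p) : Prop :=
  ∀ (U : Set M) (s : M → V), IsOpen U → p ∈ U → ContMDiffOn 𝓘(ℝ, E₁) 𝓘(ℝ, V) ∞ s U →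
    (∀ q ∈ U, s q ∈ W q) → s p = ξ →
      ∀ X : TangentSpace 𝓘(ℝ, E₁) p, flatDeriv s p X + flatDeriv f p (A X) ∈ W p

variable (E₁) in
/-- Property (B): for all `p` and all `ξ ∈ W p` the shape operator `A_ξ` is a compact operator. -/
def HasCompactShapeOperators (f : M → V) (W : M → Submodule ℝ V) : Prop :=
  ∀ p, ∀ ξ ∈ W p, ∃ A : TangentSpace 𝓘(ℝ, E₁) p →L[ℝ] TangentSpace 𝓘(ℝ, E₁) p,
    IsShapeOperator f W p ξ A ∧ IsCompactOperator A

/-- The end-point map `W → V`, `(q, ξ) ↦ f q + ξ`, in the local trivialization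
`(q, c) ↦ (q, ∑ i, c i • s i q)` of the bundle `W` given by a frame `s`. -/
def endPointMap (f : M → V) {r : ℕ} (s : Fin r → M → V) (x : M × (Fin r → ℝ)) : V :=
  f x.1 + ∑ i, x.2 i • s i x.1

variable (E₁) in
/-- Property (A): the end-point map of `W` is a Fredholm map of index `0`, that is, its
differential at each point of the total space of `W` is a Fredholm operator whose kernel and
cokernel have the same (finite) dimension. The points of the total space over the domain `U` of a
frame are the `∑ i, c i • s i p` with `p ∈ U` and `c : Fin r → ℝ`. -/
def HasFredholmEndPointMap (f : M → V) (W : M → Submodule ℝ V) : Prop :=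
  ∀ (U : Set M) (r : ℕ) (s : Fin r → M → V), IsSmoothFrame E₁ (E₂ := V) f W U s →
    ∀ p ∈ U, ∀ c : Fin r → ℝ,
      let T : TangentSpace (𝓘(ℝ, E₁).prod 𝓘(ℝ, Fin r → ℝ)) (p, c) →L[ℝ] V :=
        mfderiv (𝓘(ℝ, E₁).prod 𝓘(ℝ, Fin r → ℝ)) 𝓘(ℝ, V) (endPointMap f s) (p, c)
      T.IsFredholm ∧ Module.finrank ℝ T.ker = Module.finrank ℝ (V ⧸ T.range)

end Submanifolds

/-! ### The parallel transport map -/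

/-- The Hilbertable space `V_𝔤 = L²([0,1], 𝔤)`. The Lie algebra `𝔤 = T_1 G` of a Lie group `G`
modelled on `E` is `E` as a vector space. -/
abbrev PathSpace (E : Type*) [NormedAddCommGroup E] : Type _ :=
  Lp E 2 (volume.restrict (Icc (0 : ℝ) 1))

section LieGroups

variable {E : Type*} [NormedAddCommGroup E] [NormedSpace ℝ E]
  {G : Type*} [TopologicalSpace G] [ChartedSpace E G] [Group G]

/-- The adjoint representation `Ad a : 𝔤 → 𝔤`, the differential at `1` of `x ↦ a x a⁻¹`. -/
def Ad (a : G) : E →L[ℝ] E :=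
  mfderiv 𝓘(ℝ, E) 𝓘(ℝ, E) (fun x : G => a * x * a⁻¹) 1

/-- The path `dl_g⁻¹ (g')` in `𝔤`, for a field `g'` of tangent vectors along a path `g` in `G`. -/
def leftLogDeriv (g : ℝ → G) (g' : ∀ t, TangentSpace 𝓘(ℝ, E) (g t)) (t : ℝ) : E :=
  mfderiv 𝓘(ℝ, E) 𝓘(ℝ, E) (fun x : G => (g t)⁻¹ * x) (g t) (g' t)

/-- The path `dr_g⁻¹ (g')` in `𝔤`, for a field `g'` of tangent vectors along a path `g` in `G`. -/
def rightLogDeriv (g : ℝ → G) (g' : ∀ t, TangentSpace 𝓘(ℝ, E) (g t)) (t : ℝ) : E :=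
  mfderiv 𝓘(ℝ, E) 𝓘(ℝ, E) (fun x : G => x * (g t)⁻¹) (g t) (g' t)

/-- `g` is a Sobolev `H¹` path `[0,1] → G` with weak derivative `g'`: `g` is continuous, for each
smooth function `f` on `G` the function `f ∘ g` is the integral of `df (g')`, and `g'` is square
integrable (when translated to `𝔤`). Only the values on `[0,1]` matter. -/
structure IsH1Path (g : ℝ → G) (g' : ∀ t, TangentSpace 𝓘(ℝ, E) (g t)) : Prop where
  continuousOn : ContinuousOn g (Icc 0 1)
  intervalIntegrable : ∀ f : G → ℝ, ContMDiff 𝓘(ℝ, E) 𝓘(ℝ, ℝ) ∞ f →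
    IntervalIntegrable (fun t => flatDeriv f (g t) (g' t)) volume 0 1
  integral_eq : ∀ f : G → ℝ, ContMDiff 𝓘(ℝ, E) 𝓘(ℝ, ℝ) ∞ f → ∀ t ∈ Icc (0 : ℝ) 1,
    f (g t) = f (g 0) + ∫ τ in (0 : ℝ)..t, flatDeriv f (g τ) (g' τ)
  memLp : MemLp (leftLogDeriv g g') 2 (volume.restrict (Icc (0 : ℝ) 1))

/-- `g` is the `H¹` solution on `[0,1]` of `dl_g⁻¹ (g') = u`, `g 0 = 1`. -/
def IsDevelopment (u : PathSpace E) (g : ℝ → G) : Prop :=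
  ∃ g' : ∀ t, TangentSpace 𝓘(ℝ, E) (g t), IsH1Path g g' ∧ g 0 = 1 ∧
    leftLogDeriv g g' =ᵐ[volume.restrict (Icc (0 : ℝ) 1)] u

variable (G) in
/-- The parallel transport map `Φ : V_𝔤 → G`, `Φ u = g_u 1`, where `g_u` is the solution
of `dl_g⁻¹ (g') = u`, `g 0 = 1`, which exists and is unique on `[0,1]`. -/
def parallelTransport (u : PathSpace E) : G :=
  Classical.epsilon (fun g : ℝ → G => IsDevelopment u g) 1

/-- The gauge action `g * u = Ad(g) u - dr_g⁻¹ (g')`. -/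
def gaugeAction (g : ℝ → G) (g' : ∀ t, TangentSpace 𝓘(ℝ, E) (g t)) (u : ℝ → E) (t : ℝ) : E :=
  Ad (g t) (u t) - rightLogDeriv g g' t

/-- The Lie algebra `𝔨 ⊆ 𝔤` of a closed subgroup `K` of `G`: the initial velocities of the
one-parameter subgroups of `G` that lie in `K`. For closed `K` these form a linear subspace, so
that taking the span adds nothing. -/
def subgroupLieAlgebra (K : Subgroup G) : Submodule ℝ (GroupLieAlgebra 𝓘(ℝ, E) G) :=
  Submodule.span ℝ {X | ∃ γ : ℝ → G, ContMDiff 𝓘(ℝ, ℝ) 𝓘(ℝ, E) ∞ γ ∧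
    (∀ s t, γ (s + t) = γ s * γ t) ∧ (∀ t, γ t ∈ K) ∧
    (mfderiv 𝓘(ℝ, ℝ) 𝓘(ℝ, E) γ 0 (1 : ℝ) : E) = X}

/-- `𝔤 = 𝔨 ⊕ 𝔭` is a reductive decomposition: `𝔭` is an `Ad(K)`-invariant complement of `𝔨`. -/
structure IsReductiveDecomposition (K : Subgroup G)
    (𝔭 : Submodule ℝ (GroupLieAlgebra 𝓘(ℝ, E) G)) : Prop where
  isCompl : IsCompl (subgroupLieAlgebra K) 𝔭
  ad_mem : ∀ k ∈ K, ∀ X ∈ 𝔭, Ad (E := E) k X ∈ 𝔭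

/-- The parallel transport map `Φ_N = π ∘ Φ : V_𝔤 → N` over `N = G/K`. -/
def parallelTransportQuotient (K : Subgroup G) (u : PathSpace E) : G ⧸ K :=
  (parallelTransport G u : G ⧸ K)

/-- The horizontal distribution `ℋ` of `Φ_N`, given by `ℋ (g * 0) = Ad(g) 𝔭` for the `H¹` paths
`g` with `g 1 ∈ K`, where `𝔭` is regarded as a space of constant paths. As `𝔭` is
`Ad(K)`-invariant, `Ad(g) 𝔭` depends only on `g * 0`, so that taking the span adds nothing. -/
def horizontal (K : Subgroup G) (𝔭 : Submodule ℝ (GroupLieAlgebra 𝓘(ℝ, E) G))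
    (u : PathSpace E) : Submodule ℝ (PathSpace E) :=
  Submodule.span ℝ {X | ∃ (g : ℝ → G) (g' : ∀ t, TangentSpace 𝓘(ℝ, E) (g t)),
    IsH1Path g g' ∧ g 1 ∈ K ∧
    gaugeAction g g' 0 =ᵐ[volume.restrict (Icc (0 : ℝ) 1)] u ∧
    ∃ Y ∈ 𝔭, X =ᵐ[volume.restrict (Icc (0 : ℝ) 1)] fun t => Ad (E := E) (g t) Y}

variable (E) in
/-- The lifted submanifold `M̂ = {(p, u) ∈ M × V_𝔤 | φ p = Φ_N u}` of `φ : M → N = G/K`. -/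
def LiftedSubmanifold {K : Subgroup G} {M : Type*} (φ : M → G ⧸ K) : Type _ :=
  {x : M × PathSpace E // φ x.1 = parallelTransportQuotient K x.2}

instance {K : Subgroup G} {M : Type*} [TopologicalSpace M] (φ : M → G ⧸ K) :
    TopologicalSpace (LiftedSubmanifold E φ) :=
  instTopologicalSpaceSubtype

variable (E) in
/-- The inclusion `M̂ ⊆ M × V_𝔤`. -/
def liftedInclusion {K : Subgroup G} {M : Type*} (φ : M → G ⧸ K)
    (x : LiftedSubmanifold E φ) : M × PathSpace E :=
  x.1

variable (E) in
/-- The lifted immersion `φ̂ : M̂ → V_𝔤`, `(p, u) ↦ u`. -/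
def liftedMap {K : Subgroup G} {M : Type*} (φ : M → G ⧸ K)
    (x : LiftedSubmanifold E φ) : PathSpace E :=
  x.1.2

/-- The lifted transversal bundle, the horizontal lift of `W`: its fibre at `(p, u)` consists of
the `X ∈ ℋ u` with `dΦ_N X ∈ W p`. -/
def liftedBundle {K : Subgroup G} (𝔭 : Submodule ℝ (GroupLieAlgebra 𝓘(ℝ, E) G))
    {E' : Type*} [NormedAddCommGroup E'] [NormedSpace ℝ E'] [ChartedSpace E' (G ⧸ K)]
    {M : Type*} (φ : M → G ⧸ K) (W : ∀ p, Submodule ℝ (TangentSpace 𝓘(ℝ, E') (φ p)))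
    (x : LiftedSubmanifold E φ) :
    Submodule ℝ (PathSpace E) :=
  horizontal K 𝔭 x.1.2 ⊓
    (W x.1.1).comap
      (mfderiv 𝓘(ℝ, PathSpace E) 𝓘(ℝ, E') (parallelTransportQuotient (G := G) K)
        x.1.2).toLinearMap

end LieGroups

end

/-! Everything rests on the identity `Φ(u + v) = Φ(Ad(g_u) v) Φ(u)` (`parallelTransport_add`), where
`g_u` is the path from `1` with left logarithmic derivative `u`. It carries every question at `u` to
the origin by the bounded operator `v ↦ Ad(g_u) v`. The operator path `Ad(g_u)` solves the linear
Volterra equation `A = 1 + ∫ A ad(u)`, so `A = (1 - T_u)⁻¹ 1` near the origin and `A` is smooth in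
`u`, with values in bounded continuous paths. At the origin `dΦ` is integration over `[0,1]`; by
translation the right logarithmic derivative of `Φ` at `u` is `v ↦ ∫ Ad(g_u) v`, and bootstrapping
this formula makes `Φ` smooth.

The horizontal space at `u` consists of the paths `Ad(g_u⁻¹ Φ(u)) Y` with `Y ∈ 𝔭`
(`horizontal_eq_map`), and `dΦ_N` maps it isomorphically onto the tangent space of `G/K`. So `Φ_N`
is a submersion with a smooth horizontal lift, `M̂` is a fibre product whose tangent vectors are the
pairs `(x, v)` with `dφ x = dΦ_N v`, and `Ŵ` is the horizontal lift of `W`. Splitting `dΦ_N v` along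
`dφ(TM) ⊕ W` and subtracting the lift of the `W`-part from `v` shows that `Ŵ` is transversal
(`isCompl_map_horizontalLift`).

(A) and (B) follow from one fact: the derivative of a local section of `Ŵ` is a norm limit of
operators of finite rank (`approximable_mder_of_horizontal`). Such a section is `s = Ad(g_u)⁻¹ z`
with `u = φ̂` and `z` valued in the finite-dimensional `𝔤`. Differentiating `z` gives an operator of
finite rank. Differentiating `Ad(g_u)⁻¹` in the direction `v` gives `-Ad(g_u)⁻¹ ∫ ad(Ad(g_u) v)`,
which factors through the formation of primitives, that is, through the embedding of `H¹` into `L²`;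
sampling by step functions approximates it (`comp_primitiveL_mem_approximable`).

The shape operator is minus the tangential part of such a derivative, hence compact. At the point `∑
c_i s_i` over `p`, the differential of the end-point map is the isomorphism `(X, c') ↦ dφ̂ X + ∑
c'_i s_i` plus `∑ c_i ds_i`, hence Fredholm of index zero (`isFredholm_of_mem_approximable`). -/

noncomputable section

/-! ### Absolutely continuous curves in vector spaces -/

section Primitives

variable {Z : Type*} [NormedAddCommGroup Z] [NormedSpace ℝ Z]
  {W : Type*} [NormedAddCommGroup W] [NormedSpace ℝ W]

/-- On `[a, b]`, the curve `z` is the integral of the integrable function `z'`. -/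
structure IsPrimitive (z z' : ℝ → Z) (a b : ℝ) : Prop where
  integrable : IntervalIntegrable z' volume a b
  eq : ∀ t ∈ Icc a b, z t = z a + ∫ τ in a..t, z' τ

theorem IsPrimitive.sub_eq {z z' : ℝ → Z} {a b s t : ℝ} (h : IsPrimitive z z' a b)
    (hs : s ∈ Icc a b) (ht : t ∈ Icc a b) : z t - z s = ∫ τ in s..t, z' τ := by
  have hsub : ∀ r ∈ Icc a b, IntervalIntegrable z' volume a r := fun r hr =>
    h.integrable.mono_set (by rw [uIcc_of_le hr.1, uIcc_of_le (hr.1.trans hr.2)]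
                              exact Icc_subset_Icc le_rfl hr.2)
  rw [h.eq s hs, h.eq t ht, add_sub_add_left_eq_sub,
    intervalIntegral.integral_interval_sub_left (hsub t ht) (hsub s hs)]

theorem IsPrimitive.mono {z z' : ℝ → Z} {a b s t : ℝ} (h : IsPrimitive z z' a b)
    (hs : s ∈ Icc a b) (ht : t ∈ Icc a b) (hst : s ≤ t) : IsPrimitive z z' s t where
  integrable := h.integrable.mono_set (by
    rw [uIcc_of_le hst, uIcc_of_le (hs.1.trans hs.2)]; exact Icc_subset_Icc hs.1 ht.2)
  eq r hr := by
    rw [← h.sub_eq hs ⟨hs.1.trans hr.1, hr.2.trans ht.2⟩]; abel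

theorem IsPrimitive.congr {z z' w w' : ℝ → Z} {a b : ℝ} (h : IsPrimitive z z' a b)
    (hz : EqOn z w (Icc a b)) (hz' : z' =ᵐ[volume.restrict (Icc a b)] w') (hab : a ≤ b) :
    IsPrimitive w w' a b := by
  have key : ∀ᵐ x, x ∈ Icc a b → z' x = w' x := (ae_restrict_iff' measurableSet_Icc).1 hz'
  refine ⟨h.integrable.congr_ae ?_, fun t ht => ?_⟩
  · refine (ae_restrict_iff' measurableSet_uIoc).2 ?_
    filter_upwards [key] with x hx hx'
    rw [uIoc_of_le hab] at hx'
    exact hx ⟨hx'.1.le, hx'.2⟩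
  · rw [← hz ht, ← hz ⟨le_rfl, hab⟩, h.eq t ht]
    congr 1
    refine intervalIntegral.integral_congr_ae ?_
    filter_upwards [key] with x hx hx'
    rw [uIoc_of_le ht.1] at hx'
    exact hx ⟨hx'.1.le, hx'.2.trans ht.2⟩

theorem IsPrimitive.continuousOn {z z' : ℝ → Z} {a b : ℝ} (h : IsPrimitive z z' a b)
    (hab : a ≤ b) : ContinuousOn z (Icc a b) := by
  have h1 : ContinuousOn (fun t => ∫ τ in a..t, z' τ) (Icc a b) := by
    have := intervalIntegral.continuousOn_primitive_interval (μ := volume) (f := z')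
      (a := a) (b := b) (by
        rw [uIcc_of_le hab]
        exact (intervalIntegrable_iff_integrableOn_Icc_of_le hab).1 h.integrable)
    rwa [uIcc_of_le hab] at this
  exact (continuousOn_const.add h1).congr (fun t ht => h.eq t ht)

omit [NormedSpace ℝ W] in
/-- A curve which is controlled by an absolutely continuous function is absolutely continuous. -/
theorem AbsolutelyContinuousOnInterval.of_dist_le {f : ℝ → W} {g : ℝ → ℝ} {a b K : ℝ}
    (hg : AbsolutelyContinuousOnInterval g a b)
    (h : ∀ s ∈ uIcc a b, ∀ t ∈ uIcc a b, dist (f s) (f t) ≤ K * dist (g s) (g t)) :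
    AbsolutelyContinuousOnInterval f a b := by
  have hg' := Filter.Tendsto.const_mul K hg
  rw [mul_zero] at hg'
  refine squeeze_zero' (Filter.Eventually.of_forall fun E => Finset.sum_nonneg fun _ _ =>
    dist_nonneg) ?_ hg'
  have : AbsolutelyContinuousOnInterval.disjWithin a b ∈
      AbsolutelyContinuousOnInterval.totalLengthFilter ⊓
        Filter.principal (AbsolutelyContinuousOnInterval.disjWithin a b) :=
    Filter.mem_inf_of_right (Filter.mem_principal_self _)
  filter_upwards [this] with E hE
  rw [Finset.mul_sum]
  refine Finset.sum_le_sum fun i hi => ?_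
  have hE' := hE.1 i hi
  exact h _ hE'.1 _ hE'.2

/-- The increments of `z` are bounded by those of the absolutely continuous function `∫ ‖z'‖`. -/
theorem IsPrimitive.absolutelyContinuous {z z' : ℝ → Z} {a b : ℝ} (h : IsPrimitive z z' a b)
    (hab : a ≤ b) : AbsolutelyContinuousOnInterval z a b := by
  have hn := h.integrable.norm
  refine AbsolutelyContinuousOnInterval.of_dist_le (K := 1)
    (hn.absolutelyContinuousOnInterval_intervalIntegral (c := a) left_mem_uIcc) ?_
  have hsub : ∀ r ∈ Icc a b, IntervalIntegrable (fun τ => ‖z' τ‖) volume a r := fun r hr =>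
    hn.mono_set (by rw [uIcc_of_le hr.1, uIcc_of_le (hr.1.trans hr.2)]
                    exact Icc_subset_Icc le_rfl hr.2)
  intro s hs t ht
  rw [uIcc_of_le hab] at hs ht
  rw [one_mul, dist_comm, dist_eq_norm, h.sub_eq hs ht, dist_comm, Real.dist_eq,
    intervalIntegral.integral_interval_sub_left (hsub t ht) (hsub s hs)]
  exact intervalIntegral.norm_integral_le_abs_integral_norm

variable [FiniteDimensional ℝ Z] [CompleteSpace W]

/-- The chain rule for absolutely continuous curves. -/
theorem IsPrimitive.comp {z z' : ℝ → Z} {a b : ℝ} (h : IsPrimitive z z' a b) (hab : a ≤ b)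
    {F : Z → W} (hF : ∀ t ∈ Icc a b, ContDiffAt ℝ 1 F (z t)) :
    IsPrimitive (fun t => F (z t)) (fun t => fderiv ℝ F (z t) (z' t)) a b := by
  have : CompleteSpace Z := FiniteDimensional.complete ℝ Z
  have hzc := h.continuousOn hab
  have hint : IntervalIntegrable (fun t => fderiv ℝ F (z t) (z' t)) volume a b := by
    rw [intervalIntegrable_iff_integrableOn_Icc_of_le hab]
    have h1 := (intervalIntegrable_iff_integrableOn_Icc_of_le hab).1 h.integrable
    have hc : ContinuousOn (fun t => fderiv ℝ F (z t)) (Icc a b) := fun t ht =>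
      (((hF t ht).fderiv_right (m := 0) (by norm_num)).continuousAt).comp_continuousWithinAt
        (hzc t ht)
    obtain ⟨C, hC⟩ := isCompact_Icc.exists_bound_of_continuousOn hc
    refine Integrable.mono' (h1.norm.const_mul C) ?_ ?_
    · exact (ContinuousLinearMap.apply ℝ W (E := Z)).flip.aestronglyMeasurable_comp₂
        (hc.aestronglyMeasurable measurableSet_Icc) h1.aestronglyMeasurable
    · refine (ae_restrict_iff' measurableSet_Icc).2 (Filter.Eventually.of_forall fun t ht => ?_)
      exact (ContinuousLinearMap.le_opNorm _ _).trans
        (mul_le_mul_of_nonneg_right (hC t ht) (norm_nonneg _))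
  refine ⟨hint, ?_⟩
  -- `F` is locally Lipschitz along `z`, hence Lipschitz on the compact image of `z`, and Lipschitz
  -- maps preserve absolute continuity.
  have hFz : AbsolutelyContinuousOnInterval (fun t => F (z t)) a b := by
    have hK : IsCompact (z '' Icc a b) := isCompact_Icc.image_of_continuousOn hzc
    obtain ⟨K, hKL⟩ := LocallyLipschitzOn.exists_lipschitzOnWith_of_compact (f := F) hK (by
      rintro _ ⟨t, ht, rfl⟩
      obtain ⟨K, s, hs, hl⟩ := (hF t ht).exists_lipschitzOnWith
      exact ⟨K, s, mem_nhdsWithin_of_mem_nhds hs, hl⟩)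
    have hz := h.absolutelyContinuous hab
    have hz' := Filter.Tendsto.const_mul (K : ℝ) hz
    rw [mul_zero] at hz'
    refine squeeze_zero' (Filter.Eventually.of_forall fun E => Finset.sum_nonneg fun _ _ =>
      dist_nonneg) ?_ hz'
    have : AbsolutelyContinuousOnInterval.disjWithin a b ∈
        AbsolutelyContinuousOnInterval.totalLengthFilter ⊓
          Filter.principal (AbsolutelyContinuousOnInterval.disjWithin a b) :=
      Filter.mem_inf_of_right (Filter.mem_principal_self _)
    filter_upwards [this] with E hE
    rw [Finset.mul_sum]
    refine Finset.sum_le_sum fun i hi => ?_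
    have hE' := hE.1 i hi
    rw [uIcc_of_le hab] at hE'
    exact hKL.dist_le_mul _ (mem_image_of_mem _ hE'.1) _ (mem_image_of_mem _ hE'.2)
  -- `F ∘ z - I` is absolutely continuous with derivative zero almost everywhere, hence constant.
  set I : ℝ → W := fun t => ∫ τ in a..t, fderiv ℝ F (z τ) (z' τ) with hI
  have hIprim : IsPrimitive I (fun t => fderiv ℝ F (z t) (z' t)) a b :=
    ⟨hint, fun t _ => by simp [hI]⟩
  have hD : AbsolutelyContinuousOnInterval (fun t => F (z t) - I t) a b :=
    hFz.sub (hIprim.absolutelyContinuous hab)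
  have hder : ∀ᵐ x, x ∈ uIcc a b → HasDerivAt (fun t => F (z t) - I t) 0 x := by
    -- The end points are excluded because `z` agrees with its primitive only on `[a, b]`, which is
    -- a neighbourhood of interior points alone.
    have ha : ∀ᵐ x : ℝ, x ≠ a := by simp [ae_iff, measure_singleton]
    have hb : ∀ᵐ x : ℝ, x ≠ b := by simp [ae_iff, measure_singleton]
    filter_upwards [h.integrable.ae_hasDerivAt_integral, hint.ae_hasDerivAt_integral, ha, hb]
      with x hx1 hx2 hxa hxb hx
    have h1 := hx1 hx a left_mem_uIcc
    have h2 := hx2 hx a left_mem_uIcc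
    rw [uIcc_of_le hab] at hx
    have hz : HasDerivAt z (z' x) x := by
      refine (h1.const_add (z a)).congr_of_eventuallyEq ?_
      filter_upwards [Icc_mem_nhds (lt_of_le_of_ne hx.1 hxa.symm) (lt_of_le_of_ne hx.2 hxb)]
        with y hy using h.eq y hy
    have h3 := ((hF x hx).differentiableAt one_ne_zero).hasFDerivAt.comp_hasDerivAt x hz
    have h4 := h3.sub h2
    rw [sub_self] at h4
    exact h4
  obtain ⟨C, hC⟩ := hD.const_of_ae_hasDerivAt_zero hder
  intro t ht
  have e1 := hC t (by rwa [uIcc_of_le hab])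
  have e2 := hC a left_mem_uIcc
  have e3 : I a = 0 := by simp [hI]
  simp only [e3, sub_zero] at e2
  rw [e2, ← e1]
  simp [hI]

omit [FiniteDimensional ℝ Z] in
/-- A curve which is locally the integral of `z'` is so globally. -/
theorem IsPrimitive.of_locally {z z' : ℝ → W} {a b : ℝ} (hab : a ≤ b)
    (h : ∀ t₀ ∈ Icc a b, ∃ U ∈ 𝓝 t₀, ∀ s ∈ U ∩ Icc a b, ∀ t ∈ U ∩ Icc a b, s ≤ t →
      IsPrimitive z z' s t) : IsPrimitive z z' a b := by
  have hint : IntegrableOn z' (Icc a b) := by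
    refine LocallyIntegrableOn.integrableOn_isCompact (fun t₀ ht₀ => ?_) isCompact_Icc
    obtain ⟨U, hU, hUt⟩ := h t₀ ht₀
    obtain ⟨ε, hε, hεU⟩ := Metric.mem_nhds_iff.1 hU
    have hs : max a (t₀ - ε / 2) ∈ U ∩ Icc a b := by
      refine ⟨hεU ?_, le_max_left _ _, max_le hab (by linarith [ht₀.2])⟩
      rw [Metric.mem_ball, Real.dist_eq, abs_lt]
      refine ⟨?_, ?_⟩
      · linarith [le_max_right a (t₀ - ε / 2)]
      · linarith [max_le (c := t₀) ht₀.1 (by linarith : t₀ - ε / 2 ≤ t₀)]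
    have ht : min b (t₀ + ε / 2) ∈ U ∩ Icc a b := by
      refine ⟨hεU ?_, le_min hab (by linarith [ht₀.1]), min_le_left _ _⟩
      rw [Metric.mem_ball, Real.dist_eq, abs_lt]
      refine ⟨?_, ?_⟩
      · linarith [le_min (c := t₀) ht₀.2 (by linarith : t₀ ≤ t₀ + ε / 2)]
      · linarith [min_le_right b (t₀ + ε / 2)]
    have hst : max a (t₀ - ε / 2) ≤ min b (t₀ + ε / 2) :=
      (max_le ht₀.1 (by linarith)).trans (le_min ht₀.2 (by linarith))
    have := (intervalIntegrable_iff_integrableOn_Icc_of_le hst).1 (hUt _ hs _ ht hst).integrable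
    refine ⟨Icc (max a (t₀ - ε / 2)) (min b (t₀ + ε / 2)), ?_, this⟩
    have : Icc (t₀ - ε / 2) (t₀ + ε / 2) ∈ 𝓝 t₀ := Icc_mem_nhds (by linarith) (by linarith)
    filter_upwards [mem_nhdsWithin_of_mem_nhds this, self_mem_nhdsWithin] with x hx hx'
    exact ⟨max_le hx'.1 hx.1, le_min hx'.2 hx.2⟩
  have hii : IntervalIntegrable z' volume a b :=
    (intervalIntegrable_iff_integrableOn_Icc_of_le hab).2 hint
  refine ⟨hii, fun t ht => ?_⟩
  set I : ℝ → W := fun t => ∫ τ in a..t, z' τ with hI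
  have hIprim : IsPrimitive I z' a b := ⟨hii, fun t _ => by simp [hI]⟩
  -- Integrability is global by compactness; it remains to see that `z - I` is locally constant on
  -- the connected interval.
  have hloc : ∀ t₀ ∈ Icc a b, ∃ U ∈ 𝓝 t₀, ∀ s ∈ U ∩ Icc a b, z s - I s = z t₀ - I t₀ := by
    intro t₀ ht₀
    obtain ⟨U, hU, hUt⟩ := h t₀ ht₀
    refine ⟨U, hU, fun s hs => ?_⟩
    have ht₀U : t₀ ∈ U ∩ Icc a b := ⟨mem_of_mem_nhds hU, ht₀⟩
    rcases le_total s t₀ with hle | hle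
    · have e1 := (hUt s hs t₀ ht₀U hle).sub_eq ⟨le_rfl, hle⟩ ⟨hle, le_rfl⟩
      have e2 := hIprim.sub_eq hs.2 ht₀
      rw [← e2] at e1
      rw [sub_eq_sub_iff_sub_eq_sub, ← neg_sub, e1, neg_sub]
    · have e1 := (hUt t₀ ht₀U s hs hle).sub_eq ⟨le_rfl, hle⟩ ⟨hle, le_rfl⟩
      have e2 := hIprim.sub_eq ht₀ hs.2
      rw [← e2] at e1
      rw [sub_eq_sub_iff_sub_eq_sub, e1]
  have hconst : ∀ x ∈ Icc a b, ∀ y ∈ Icc a b, z x - I x = z y - I y := by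
    intro x hx y hy
    have hlc : IsLocallyConstant (fun s : Icc a b => z s - I s) := by
      rw [IsLocallyConstant.iff_eventually_eq]
      intro s
      obtain ⟨U, hU, hUt⟩ := hloc s s.2
      filter_upwards [continuousAt_subtype_val.preimage_mem_nhds hU] with r hr
      exact hUt r ⟨hr, r.2⟩
    have : PreconnectedSpace (Icc a b) :=
      Subtype.preconnectedSpace isPreconnected_Icc
    exact hlc.apply_eq_of_preconnectedSpace ⟨x, hx⟩ ⟨y, hy⟩
  have e := hconst t ht a ⟨le_rfl, hab⟩
  have e3 : I a = 0 := by simp [hI]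
  rw [e3, sub_zero] at e
  rw [← e]; simp [hI]

end Primitives

/-! ### Derivatives of maps between manifolds, in terms of the model spaces -/

section ModelDerivatives

variable {E₁ H₁ M₁ E₂ H₂ M₂ E₃ H₃ M₃ : Type*}
  [NormedAddCommGroup E₁] [NormedSpace ℝ E₁] [TopologicalSpace H₁] [TopologicalSpace M₁]
  [ChartedSpace H₁ M₁]
  [NormedAddCommGroup E₂] [NormedSpace ℝ E₂] [TopologicalSpace H₂] [TopologicalSpace M₂]
  [ChartedSpace H₂ M₂]
  [NormedAddCommGroup E₃] [NormedSpace ℝ E₃] [TopologicalSpace H₃] [TopologicalSpace M₃]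
  [ChartedSpace H₃ M₃]
  (I₁ : ModelWithCorners ℝ E₁ H₁) (I₂ : ModelWithCorners ℝ E₂ H₂) (I₃ : ModelWithCorners ℝ E₃ H₃)

/-- The derivative `mfderiv`, as a map between the model spaces. -/
def mder (f : M₁ → M₂) (x : M₁) : E₁ →L[ℝ] E₂ := mfderiv I₁ I₂ f x

/-- The predicate `HasMFDerivAt`, for a map between the model spaces. -/
def HasMD (f : M₁ → M₂) (x : M₁) (f' : E₁ →L[ℝ] E₂) : Prop := HasMFDerivAt I₁ I₂ f x f'

variable {I₁ I₂ I₃} {f : M₁ → M₂} {x : M₁} {f' : E₁ →L[ℝ] E₂}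

theorem MDifferentiableAt.hasMD (h : MDifferentiableAt I₁ I₂ f x) :
    HasMD I₁ I₂ f x (mder I₁ I₂ f x) := h.hasMFDerivAt

theorem ContMDiffAt.hasMD {n : WithTop ℕ∞} (h : ContMDiffAt I₁ I₂ n f x) (hn : n ≠ 0) :
    HasMD I₁ I₂ f x (mder I₁ I₂ f x) := (h.mdifferentiableAt hn).hasMFDerivAt

theorem HasMD.mdifferentiableAt (h : HasMD I₁ I₂ f x f') : MDifferentiableAt I₁ I₂ f x :=
  HasMFDerivAt.mdifferentiableAt h

theorem HasMD.mder_eq (h : HasMD I₁ I₂ f x f') : mder I₁ I₂ f x = f' := HasMFDerivAt.mfderiv h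

theorem HasMD.comp {g : M₂ → M₃} {g' : E₂ →L[ℝ] E₃} (hg : HasMD I₂ I₃ g (f x) g')
    (hf : HasMD I₁ I₂ f x f') : HasMD I₁ I₃ (fun y => g (f y)) x (g' ∘L f') :=
  HasMFDerivAt.comp x hg hf

theorem HasMD.comp_of_eq {g : M₂ → M₃} {g' : E₂ →L[ℝ] E₃} {y : M₂} (hg : HasMD I₂ I₃ g y g')
    (hf : HasMD I₁ I₂ f x f') (h : f x = y) : HasMD I₁ I₃ (fun y => g (f y)) x (g' ∘L f') := by
  subst h; exact hg.comp hf

theorem HasMD.congr {g : M₁ → M₂} (h : HasMD I₁ I₂ f x f') (hg : g =ᶠ[𝓝 x] f) :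
    HasMD I₁ I₂ g x f' :=
  HasMFDerivAt.congr_of_eventuallyEq h hg

theorem HasMD.congr_deriv {f'' : E₁ →L[ℝ] E₂} (h : HasMD I₁ I₂ f x f') (hg : f' = f'') :
    HasMD I₁ I₂ f x f'' := hg ▸ h

theorem HasMD.prodMk {g : M₁ → M₃} {g' : E₁ →L[ℝ] E₃} (hf : HasMD I₁ I₂ f x f')
    (hg : HasMD I₁ I₃ g x g') : HasMD I₁ (I₂.prod I₃) (fun y => (f y, g y)) x (f'.prod g') :=
  HasMFDerivAt.prodMk hf hg

theorem hasMD_id : HasMD I₁ I₁ (fun y : M₁ => y) x (ContinuousLinearMap.id ℝ E₁) :=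
  hasMFDerivAt_id x

theorem hasMD_const {c : M₂} : HasMD I₁ I₂ (fun _ : M₁ => c) x 0 :=
  hasMFDerivAt_const c x

theorem hasMD_fst {p : M₁ × M₂} :
    HasMD (I₁.prod I₂) I₁ (Prod.fst : M₁ × M₂ → M₁) p (ContinuousLinearMap.fst ℝ E₁ E₂) :=
  hasMFDerivAt_fst p

theorem hasMD_snd {p : M₁ × M₂} :
    HasMD (I₁.prod I₂) I₂ (Prod.snd : M₁ × M₂ → M₂) p (ContinuousLinearMap.snd ℝ E₁ E₂) :=
  hasMFDerivAt_snd p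

theorem hasMD_iff_hasFDerivAt {f : E₁ → E₂} {x : E₁} {f' : E₁ →L[ℝ] E₂} :
    HasMD 𝓘(ℝ, E₁) 𝓘(ℝ, E₂) f x f' ↔ HasFDerivAt f f' x :=
  hasMFDerivAt_iff_hasFDerivAt

theorem HasMD.unique {f'' : E₁ →L[ℝ] E₂} (h : HasMD I₁ I₂ f x f') (h' : HasMD I₁ I₂ f x f'') :
    f' = f'' := h.mder_eq.symm.trans h'.mder_eq

theorem mder_comp {g : M₂ → M₃} (hg : MDifferentiableAt I₂ I₃ g (f x))
    (hf : MDifferentiableAt I₁ I₂ f x) :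
    mder I₁ I₃ (fun y => g (f y)) x = mder I₂ I₃ g (f x) ∘L mder I₁ I₂ f x :=
  (hg.hasMD.comp hf.hasMD).mder_eq

theorem Filter.EventuallyEq.mder_eq {g : M₁ → M₂} (h : g =ᶠ[𝓝 x] f) :
    mder I₁ I₂ g x = mder I₁ I₂ f x := h.mfderiv_eq

theorem mder_eq_fderiv {f : E₁ → E₂} {x : E₁} : mder 𝓘(ℝ, E₁) 𝓘(ℝ, E₂) f x = fderiv ℝ f x :=
  mfderiv_eq_fderiv

/-- The derivatives of a smooth family of vector valued maps at a fixed point depend smoothly on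
the parameter. -/
theorem ContMDiffAt.mder_param [IsManifold I₁ ∞ M₁] [IsManifold I₂ ∞ M₂] {f : M₁ → M₂ → E₃}
    {x₀ : M₁} {y₀ : M₂}
    (hf : ContMDiffAt (I₁.prod I₂) 𝓘(ℝ, E₃) ∞ (fun p : M₁ × M₂ => f p.1 p.2) (x₀, y₀)) :
    ContMDiffAt I₁ 𝓘(ℝ, E₂ →L[ℝ] E₃) ∞ (fun x => mder I₂ 𝓘(ℝ, E₃) (f x) y₀) x₀ := by
  have : IsManifold I₁ 1 M₁ := .of_le (n := ∞) (by simp)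
  have : IsManifold I₂ 1 M₂ := .of_le (n := ∞) (by simp)
  have h := ContMDiffAt.mfderiv (I := I₂) (J := I₁) (I' := 𝓘(ℝ, E₃)) (m := ∞) (n := ∞) f
    (fun _ => y₀) hf contMDiffAt_const (by simp)
  refine h.congr_of_eventuallyEq (Filter.Eventually.of_forall fun x => ?_)
  symm
  have hy := mem_chart_source H₂ y₀
  -- Both changes of coordinates are trivial: the base point `y₀` is fixed, and the target is a
  -- vector space.
  change inTangentCoordinates I₂ 𝓘(ℝ, E₃) (fun _ => y₀) (fun x => f x y₀)
    (fun x => mder I₂ 𝓘(ℝ, E₃) (f x) y₀) x₀ x = _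
  rw [inTangentCoordinates_eq (I := I₂) (I' := 𝓘(ℝ, E₃)) (fun _ => y₀) (fun x => f x y₀) _ hy
    (show f x y₀ ∈ (chartAt E₃ (f x₀ y₀)).source from mem_chart_source E₃ (f x y₀))]
  refine ContinuousLinearMap.ext fun v => ?_
  refine ((tangentBundleCore 𝓘(ℝ, E₃) E₃).coordChange_self (achart E₃ (f x y₀)) _
    (mem_chart_source E₃ (f x y₀)) _).trans ?_
  exact congrArg (mder I₂ 𝓘(ℝ, E₃) (f x) y₀)
    ((tangentBundleCore I₂ M₂).coordChange_self (achart H₂ y₀) _ hy v)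

end ModelDerivatives

/-! ### Calculus on Lie groups -/

section LieGroupCalculus

variable {E : Type*} [NormedAddCommGroup E] [NormedSpace ℝ E]
  {G : Type*} [TopologicalSpace G] [ChartedSpace E G] [Group G] 

/-- The differential at `1` of the left translation by `a`. -/
def leftTriv (a : G) : E →L[ℝ] E := mder 𝓘(ℝ, E) 𝓘(ℝ, E) (fun x : G => a * x) 1

/-- The differential at `1` of the right translation by `a`. -/
def rightTriv (a : G) : E →L[ℝ] E := mder 𝓘(ℝ, E) 𝓘(ℝ, E) (fun x : G => x * a) 1

variable (G) in
/-- The differential at `1` of the adjoint representation. -/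
def adL : E →L[ℝ] E →L[ℝ] E :=
  mder 𝓘(ℝ, E) 𝓘(ℝ, E →L[ℝ] E) (Ad : G → E →L[ℝ] E) 1

variable [LieGroup 𝓘(ℝ, E) ∞ G]

theorem mdiff_mul_left (a b : G) : MDifferentiableAt 𝓘(ℝ, E) 𝓘(ℝ, E) (fun x : G => a * x) b :=
  (contMDiff_mul_left (I := 𝓘(ℝ, E)) (n := ∞)).mdifferentiableAt (by simp)

theorem mdiff_mul_right (a b : G) : MDifferentiableAt 𝓘(ℝ, E) 𝓘(ℝ, E) (fun x : G => x * a) b :=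
  (contMDiff_mul_right (I := 𝓘(ℝ, E)) (n := ∞)).mdifferentiableAt (by simp)

theorem contMDiff_conj (a : G) :
    ContMDiff 𝓘(ℝ, E) 𝓘(ℝ, E) ∞ (fun x : G => a * x * a⁻¹) :=
  (contMDiff_mul_right (I := 𝓘(ℝ, E)) (n := ∞) (a := a⁻¹)).comp
    (contMDiff_mul_left (I := 𝓘(ℝ, E)) (n := ∞) (a := a))

theorem hasMD_conj (a : G) :
    HasMD 𝓘(ℝ, E) 𝓘(ℝ, E) (fun x : G => a * x * a⁻¹) 1 (Ad a) :=
  (contMDiff_conj a).contMDiffAt.hasMD (by simp)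

theorem hasMD_mul_left (a b : G) :
    HasMD 𝓘(ℝ, E) 𝓘(ℝ, E) (fun x : G => a * x) b (mder 𝓘(ℝ, E) 𝓘(ℝ, E) (fun x : G => a * x) b) :=
  (mdiff_mul_left a b).hasMD

theorem hasMD_mul_right (a b : G) :
    HasMD 𝓘(ℝ, E) 𝓘(ℝ, E) (fun x : G => x * a) b (mder 𝓘(ℝ, E) 𝓘(ℝ, E) (fun x : G => x * a) b) :=
  (mdiff_mul_right a b).hasMD

theorem hasMD_leftTriv (a : G) :
    HasMD 𝓘(ℝ, E) 𝓘(ℝ, E) (fun x : G => a * x) 1 (leftTriv a) := hasMD_mul_left a 1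

theorem hasMD_rightTriv (a : G) :
    HasMD 𝓘(ℝ, E) 𝓘(ℝ, E) (fun x : G => x * a) 1 (rightTriv a) := hasMD_mul_right a 1

theorem mder_mul_left_comp_leftTriv (a b : G) :
    mder 𝓘(ℝ, E) 𝓘(ℝ, E) (fun x : G => a * x) b ∘L leftTriv b = leftTriv (a * b) := by
  have h := (hasMD_mul_left (E := E) a b).comp_of_eq (hasMD_leftTriv b) (mul_one b)
  refine h.unique ((hasMD_leftTriv (a * b)).congr (Filter.Eventually.of_forall fun x => ?_))
  simp [mul_assoc]

theorem leftTriv_one : leftTriv (1 : G) = ContinuousLinearMap.id ℝ E :=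
  (hasMD_leftTriv (E := E) (1 : G)).unique (hasMD_id.congr (Filter.Eventually.of_forall fun x => by simp))

theorem mder_inv_mul_leftTriv (a : G) (v : E) :
    mder 𝓘(ℝ, E) 𝓘(ℝ, E) (fun x : G => a⁻¹ * x) a (leftTriv a v) = v := by
  have h := DFunLike.congr_fun (mder_mul_left_comp_leftTriv (E := E) a⁻¹ a) v
  rw [inv_mul_cancel, leftTriv_one] at h
  exact h

theorem leftTriv_mder_inv_mul (a : G) (v : E) :
    leftTriv a (mder 𝓘(ℝ, E) 𝓘(ℝ, E) (fun x : G => a⁻¹ * x) a v) = v := by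
  have h := (hasMD_leftTriv (E := E) a).comp_of_eq (hasMD_mul_left (E := E) a⁻¹ a) (inv_mul_cancel a)
  have h2 := h.unique (hasMD_id.congr (Filter.Eventually.of_forall fun x => by simp))
  exact DFunLike.congr_fun h2 v

theorem leftTriv_surjective (a : G) : Function.Surjective (leftTriv a : E →L[ℝ] E) :=
  Function.RightInverse.surjective (leftTriv_mder_inv_mul (E := E) a)

/-- Differentiate `a x b = (a b) (b⁻¹ x b)` at `x = 1`. -/
theorem mder_mul_right_comp_leftTriv (a b : G) :
    mder 𝓘(ℝ, E) 𝓘(ℝ, E) (fun x : G => x * b) a ∘L leftTriv a = leftTriv (a * b) ∘L Ad b⁻¹ := by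
  have h1 := (hasMD_mul_right (E := E) b a).comp_of_eq (hasMD_leftTriv a) (mul_one a)
  have h2 := (hasMD_leftTriv (E := E) (a * b)).comp_of_eq (hasMD_conj b⁻¹) (by simp)
  refine h1.unique (h2.congr (Filter.Eventually.of_forall fun x => ?_))
  simp [mul_assoc]

theorem rightTriv_eq (a : G) : rightTriv a = leftTriv a ∘L (Ad a⁻¹ : E →L[ℝ] E) := by
  have h := mder_mul_right_comp_leftTriv (E := E) 1 a
  rw [leftTriv_one, one_mul] at h
  exact h

theorem Ad_one : Ad (1 : G) = ContinuousLinearMap.id ℝ E :=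
  (hasMD_conj (E := E) (1 : G)).unique (hasMD_id.congr (Filter.Eventually.of_forall fun x => by simp))

theorem Ad_mul (a b : G) : Ad (a * b) = (Ad a ∘L Ad b : E →L[ℝ] E) := by
  have h := (hasMD_conj (E := E) a).comp_of_eq (hasMD_conj b) (by simp)
  refine (hasMD_conj (a * b)).unique (h.congr (Filter.Eventually.of_forall fun x => ?_))
  simp [mul_assoc]

theorem Ad_inv_comp (a : G) : (Ad a⁻¹ ∘L Ad a : E →L[ℝ] E) = ContinuousLinearMap.id ℝ E := by
  rw [← Ad_mul, inv_mul_cancel, Ad_one]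

theorem Ad_comp_inv (a : G) : (Ad a ∘L Ad a⁻¹ : E →L[ℝ] E) = ContinuousLinearMap.id ℝ E := by
  rw [← Ad_mul, mul_inv_cancel, Ad_one]

theorem mder_mul_inv_leftTriv (a : G) (v : E) :
    mder 𝓘(ℝ, E) 𝓘(ℝ, E) (fun x : G => x * a⁻¹) a (leftTriv a v) = Ad a v := by
  have h := DFunLike.congr_fun (mder_mul_right_comp_leftTriv (E := E) a a⁻¹) v
  rw [mul_inv_cancel, leftTriv_one, inv_inv] at h
  exact h

theorem hasMD_mul (a b : G) :
    HasMD (𝓘(ℝ, E).prod 𝓘(ℝ, E)) 𝓘(ℝ, E) (fun p : G × G => p.1 * p.2) (a, b)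
      (mder 𝓘(ℝ, E) 𝓘(ℝ, E) (fun x : G => x * b) a ∘L ContinuousLinearMap.fst ℝ E E +
        mder 𝓘(ℝ, E) 𝓘(ℝ, E) (fun x : G => a * x) b ∘L ContinuousLinearMap.snd ℝ E E) := by
  have hd : MDifferentiableAt (𝓘(ℝ, E).prod 𝓘(ℝ, E)) 𝓘(ℝ, E)
      (fun p : G × G => p.1 * p.2) (a, b) :=
    (contMDiff_mul 𝓘(ℝ, E) ∞).mdifferentiableAt (by simp)
  refine hd.hasMD.congr_deriv (ContinuousLinearMap.ext fun v => ?_)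
  exact mfderiv_prod_eq_add_apply hd

theorem hasMD_mul_comp {E₁ H₁ M₁ : Type*}
    [NormedAddCommGroup E₁] [NormedSpace ℝ E₁] [TopologicalSpace H₁] [TopologicalSpace M₁]
    [ChartedSpace H₁ M₁] {I₁ : ModelWithCorners ℝ E₁ H₁} {g h : M₁ → G} {x : M₁}
    {u v : E₁ →L[ℝ] E} (hg : HasMD I₁ 𝓘(ℝ, E) g x (leftTriv (g x) ∘L u))
    (hh : HasMD I₁ 𝓘(ℝ, E) h x (leftTriv (h x) ∘L v)) :
    HasMD I₁ 𝓘(ℝ, E) (fun y => g y * h y) x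
      (leftTriv (g x * h x) ∘L (Ad (h x)⁻¹ ∘L u + v)) := by
  have := (hasMD_mul (E := E) (g x) (h x)).comp_of_eq (hg.prodMk hh) rfl
  refine this.congr_deriv ?_
  rw [ContinuousLinearMap.comp_add, ← ContinuousLinearMap.comp_assoc,
    ← mder_mul_right_comp_leftTriv, ← mder_mul_left_comp_leftTriv]
  rfl

/-- In a chart `χ` at `1`, the maps `x ↦ χ (a x a⁻¹)` form a smooth family with values in a vector
space, so `ContMDiffAt.mder_param` applies; composing with the fixed operator `dχ⁻¹` returns `Ad a`.
-/
theorem contMDiff_Ad : ContMDiff 𝓘(ℝ, E) 𝓘(ℝ, E →L[ℝ] E) ∞ (Ad : G → E →L[ℝ] E) := by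
  intro a₀
  set χ := extChartAt 𝓘(ℝ, E) (1 : G)
  have hχ : ContMDiffAt 𝓘(ℝ, E) 𝓘(ℝ, E) ∞ χ (1 : G) := contMDiffAt_extChartAt
  have hχs : ContMDiffAt 𝓘(ℝ, E) 𝓘(ℝ, E) ∞ χ.symm (χ 1) :=
    (contMDiffOn_extChartAt_symm (1 : G)).contMDiffAt
      (extChartAt_target_mem_nhds (I := 𝓘(ℝ, E)) (1 : G))
  have hsmooth : ContMDiffAt (𝓘(ℝ, E).prod 𝓘(ℝ, E)) 𝓘(ℝ, E) ∞
      (fun p : G × G => χ (p.1 * p.2 * p.1⁻¹)) (a₀, 1) := by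
    have h1 : ContMDiffAt (𝓘(ℝ, E).prod 𝓘(ℝ, E)) 𝓘(ℝ, E) ∞
        (fun p : G × G => p.1 * p.2 * p.1⁻¹) (a₀, 1) :=
      ((contMDiff_fst.mul contMDiff_snd).mul contMDiff_fst.inv).contMDiffAt
    exact ContMDiffAt.comp_of_eq (g := χ) hχ h1 (by simp)
  have h := ContMDiffAt.mder_param (f := fun a x : G => χ (a * x * a⁻¹)) hsmooth
  have key : ∀ a : G, Ad a = mder 𝓘(ℝ, E) 𝓘(ℝ, E) χ.symm (χ 1) ∘L
      mder 𝓘(ℝ, E) 𝓘(ℝ, E) (fun x : G => χ (a * x * a⁻¹)) 1 := by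
    intro a
    have h1 := (hχ.hasMD (by simp)).comp_of_eq (hasMD_conj a) (by simp)
    have h2 := (hχs.hasMD (by simp)).comp_of_eq h1 (by simp)
    rw [h1.mder_eq]
    refine (hasMD_conj a).unique (h2.congr ?_)
    have : ∀ᶠ y in 𝓝 (1 : G), a * y * a⁻¹ ∈ χ.source := by
      have hc : ContinuousAt (fun y : G => a * y * a⁻¹) 1 :=
        (contMDiff_conj (E := E) a).continuous.continuousAt
      refine hc.preimage_mem_nhds ?_
      rw [mul_one, mul_inv_cancel]
      exact extChartAt_source_mem_nhds (I := 𝓘(ℝ, E)) (1 : G)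
    filter_upwards [this] with y hy
    exact (χ.left_inv hy).symm
  rw [show (Ad : G → E →L[ℝ] E) = _ from funext key]
  have hc : ContMDiff 𝓘(ℝ, E →L[ℝ] E) 𝓘(ℝ, E →L[ℝ] E) ∞ (fun T : E →L[ℝ] E =>
      mder 𝓘(ℝ, E) 𝓘(ℝ, E) χ.symm (χ 1) ∘L T) :=
    (ContDiff.clm_comp contDiff_const contDiff_id).contMDiff
  exact hc.contMDiffAt.comp a₀ h

/-- Differentiate `Ad (a x) = Ad a ∘ Ad x` at `x = 1`. Along a path with left logarithmic derivative
`u` this becomes the linear equation `A' = A ad(u)` for `A = Ad g`. -/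
theorem hasMD_Ad (a : G) (v : E) :
    mder 𝓘(ℝ, E) 𝓘(ℝ, E →L[ℝ] E) (Ad : G → E →L[ℝ] E) a (leftTriv a v) =
      Ad a ∘L adL G v := by
  have h0 : ∀ b : G, HasMD 𝓘(ℝ, E) 𝓘(ℝ, E →L[ℝ] E) (Ad : G → E →L[ℝ] E) b _ := fun b =>
    (contMDiff_Ad.contMDiffAt (x := b)).hasMD (by simp)
  have h1 := (h0 a).comp_of_eq (hasMD_leftTriv a) (mul_one a)
  have h2 : HasMD 𝓘(ℝ, E →L[ℝ] E) 𝓘(ℝ, E →L[ℝ] E) (fun T : E →L[ℝ] E => Ad a ∘L T)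
      (Ad (1 : G)) (ContinuousLinearMap.compL ℝ E E E (Ad a)) :=
    hasMD_iff_hasFDerivAt.2 (ContinuousLinearMap.compL ℝ E E E (Ad a)).hasFDerivAt
  have h3 := h2.comp (h0 1)
  have h4 := h1.unique (h3.congr (Filter.Eventually.of_forall fun x => Ad_mul a x))
  exact DFunLike.congr_fun h4 v

/-- By the chain rule the operator is the derivative at the fixed point `1` of `x ↦ f (a x)`, which
depends smoothly on the parameter `a`. -/
theorem contMDiffAt_mder_comp_leftTriv {F : Type*} [NormedAddCommGroup F] [NormedSpace ℝ F]
    {f : G → F} {a₀ : G} (hf : ContMDiffAt 𝓘(ℝ, E) 𝓘(ℝ, F) ∞ f a₀) :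
    ContMDiffAt 𝓘(ℝ, E) 𝓘(ℝ, E →L[ℝ] F) ∞
      (fun a => mder 𝓘(ℝ, E) 𝓘(ℝ, F) f a ∘L leftTriv a) a₀ := by
  have hsmooth : ContMDiffAt (𝓘(ℝ, E).prod 𝓘(ℝ, E)) 𝓘(ℝ, F) ∞
      (fun p : G × G => f (p.1 * p.2)) (a₀, 1) :=
    ContMDiffAt.comp_of_eq (g := f) hf (contMDiff_fst.mul contMDiff_snd).contMDiffAt (by simp)
  refine (ContMDiffAt.mder_param (f := fun a x : G => f (a * x)) hsmooth).congr_of_eventuallyEq ?_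
  filter_upwards [(contMDiffAt_iff_contMDiffAt_nhds (n := 1) (by simp)).1 (hf.of_le (by simp))]
    with a ha
  exact (((ha.hasMD (by simp)).comp_of_eq (hasMD_leftTriv a) (mul_one a)).mder_eq).symm

end LieGroupCalculus

/-! ### Paths of Sobolev class `H¹` -/

section WeakPaths

variable {Z : Type*} [NormedAddCommGroup Z] [NormedSpace ℝ Z] [FiniteDimensional ℝ Z]

/-- It suffices to test with the coordinate functionals of a basis. -/
theorem IsPrimitive.of_dual {z z' : ℝ → Z} {a b : ℝ}
    (h : ∀ ℓ : Z →L[ℝ] ℝ, IsPrimitive (fun t => ℓ (z t)) (fun t => ℓ (z' t)) a b) (hab : a ≤ b) :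
    IsPrimitive z z' a b := by
  have : CompleteSpace Z := FiniteDimensional.complete ℝ Z
  set B := Module.finBasis ℝ Z
  set ℓ : Fin (Module.finrank ℝ Z) → Z →L[ℝ] ℝ := fun i => (B.coord i).toContinuousLinearMap
  have hsum : ∀ x : Z, x = ∑ i, ℓ i x • B i := fun x => (B.sum_repr x).symm
  have hint : IntervalIntegrable z' volume a b := by
    have : z' = ∑ i, fun t => ℓ i (z' t) • B i := by
      funext t
      rw [Finset.sum_apply]
      exact hsum _
    rw [this]
    exact IntervalIntegrable.sum _ fun i _ => by
      have hi := (h (ℓ i)).integrable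
      exact ⟨hi.1.smul_const _, hi.2.smul_const _⟩
  refine ⟨hint, fun t ht => ?_⟩
  rw [hsum (z t), hsum (z a), hsum (∫ τ in a..t, z' τ), ← Finset.sum_add_distrib]
  refine Finset.sum_congr rfl fun i _ => ?_
  rw [← add_smul, (h (ℓ i)).eq t ht, ContinuousLinearMap.intervalIntegral_comp_comm]
  exact hint.mono_set (by rw [uIcc_of_le ht.1, uIcc_of_le hab]; exact Icc_subset_Icc le_rfl ht.2)

variable {E₁ H₁ M₁ W : Type*}
  [NormedAddCommGroup E₁] [NormedSpace ℝ E₁] [TopologicalSpace H₁] [TopologicalSpace M₁]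
  [ChartedSpace H₁ M₁] {I₁ : ModelWithCorners ℝ E₁ H₁} [IsManifold I₁ ∞ M₁]
  [NormedAddCommGroup W] [NormedSpace ℝ W] [CompleteSpace W]

/-- If a path on a manifold is absolutely continuous in the coordinates `X`, then so are smooth
functions along the path. -/
theorem IsPrimitive.local_comp {c : ℝ → M₁} {c' : ℝ → E₁} (hc : ContinuousOn c (Icc 0 1))
    {X : M₁ → Z} (hX : IsPrimitive (fun t => X (c t)) (fun t => mder I₁ 𝓘(ℝ, Z) X (c t) (c' t)) 0 1)
    {t₀ : ℝ} (ht₀ : t₀ ∈ Icc (0 : ℝ) 1) {r : Z → M₁}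
    (hr : ContMDiffAt 𝓘(ℝ, Z) I₁ ∞ r (X (c t₀))) (hXs : ContMDiffAt I₁ 𝓘(ℝ, Z) ∞ X (c t₀))
    (hrX : ∀ᶠ m in 𝓝 (c t₀), r (X m) = m) {F : M₁ → W}
    (hF : ContMDiffAt I₁ 𝓘(ℝ, W) ∞ F (c t₀)) :
    ∃ U ∈ 𝓝 t₀, ∀ s ∈ U ∩ Icc 0 1, ∀ t ∈ U ∩ Icc 0 1, s ≤ t →
      IsPrimitive (fun t => F (c t)) (fun t => mder I₁ 𝓘(ℝ, W) F (c t) (c' t)) s t := by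
  have : IsManifold I₁ 1 M₁ := .of_le (n := ∞) (by simp)
  -- Near `c t₀` one has `F = (F ∘ r) ∘ X`, so the chain rule in the vector space `Z` can be applied
  -- to `F ∘ r` along `X ∘ c`.
  have hFr : ContMDiffAt 𝓘(ℝ, Z) 𝓘(ℝ, W) ∞ (fun z => F (r z)) (X (c t₀)) :=
    ContMDiffAt.comp_of_eq (g := F) hF hr hrX.self_of_nhds
  have hFr1 : ∀ᶠ z in 𝓝 (X (c t₀)), ContMDiffAt 𝓘(ℝ, Z) 𝓘(ℝ, W) 1 (fun z => F (r z)) z :=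
    (contMDiffAt_iff_contMDiffAt_nhds (n := 1) (by simp)).1 (hFr.of_le (by simp))
  have hXs1 : ∀ᶠ m in 𝓝 (c t₀), ContMDiffAt I₁ 𝓘(ℝ, Z) 1 X m :=
    (contMDiffAt_iff_contMDiffAt_nhds (n := 1) (by simp)).1 (hXs.of_le (by simp))
  have hgood : ∀ᶠ m in 𝓝 (c t₀), ContDiffAt ℝ 1 (fun z => F (r z)) (X m) ∧ F (r (X m)) = F m ∧
      ∀ v, mder I₁ 𝓘(ℝ, W) F m v =
        fderiv ℝ (fun z => F (r z)) (X m) (mder I₁ 𝓘(ℝ, Z) X m v) := by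
    filter_upwards [hXs.continuousAt.eventually hFr1, hXs1, hrX.eventually_nhds]
      with m h1 h2 h3
    refine ⟨contMDiffAt_iff_contDiffAt.1 h1, by rw [h3.self_of_nhds], fun v => ?_⟩
    have e : F =ᶠ[𝓝 m] fun y => F (r (X y)) := h3.mono fun y hy => (congrArg F hy).symm
    have h4 := (h1.hasMD (by simp)).comp (h2.hasMD (by simp))
    rw [e.mder_eq, h4.mder_eq, mder_eq_fderiv]
    rfl
  have hct : ∀ᶠ t in 𝓝[Icc 0 1] t₀, _ := (hc t₀ ht₀).eventually hgood
  rw [eventually_nhdsWithin_iff] at hct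
  obtain ⟨ε, hε, hball⟩ := Metric.eventually_nhds_iff_ball.1 hct
  refine ⟨Metric.ball t₀ ε, Metric.ball_mem_nhds _ hε, fun s hs t ht hst => ?_⟩
  have hsub : ∀ τ ∈ Icc s t, τ ∈ Metric.ball t₀ ε ∧ τ ∈ Icc (0 : ℝ) 1 := fun τ hτ =>
    ⟨(convex_ball t₀ ε).ordConnected.out hs.1 ht.1 hτ, hs.2.1.trans hτ.1, hτ.2.trans ht.2.2⟩
  have hgood' : ∀ τ ∈ Icc s t, _ := fun τ hτ => hball τ (hsub τ hτ).1 (hsub τ hτ).2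
  have h1 := (hX.mono hs.2 ht.2 hst).comp hst (F := fun z => F (r z)) fun τ hτ => (hgood' τ hτ).1
  refine h1.congr (fun τ hτ => (hgood' τ hτ).2.1) ?_ hst
  refine (ae_restrict_iff' measurableSet_Icc).2 (Filter.Eventually.of_forall fun τ hτ => ?_)
  exact ((hgood' τ hτ).2.2 _).symm

end WeakPaths

/-! ### Logarithmic derivatives of `H¹` paths in a Lie group: inverses, products, uniqueness -/

section LieGroupPaths

variable {E : Type*} [NormedAddCommGroup E] [NormedSpace ℝ E]
  {G : Type*} [TopologicalSpace G] [ChartedSpace E G] [Group G]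

/-- `g` is an `H¹` path whose left logarithmic derivative is `u`. -/
structure IsDev (g : ℝ → G) (u : ℝ → E) : Prop where
  continuousOn : ContinuousOn g (Icc 0 1)
  isPrimitive : ∀ f : G → ℝ, ContMDiff 𝓘(ℝ, E) 𝓘(ℝ, ℝ) ∞ f →
    IsPrimitive (fun t => f (g t)) (fun t => mder 𝓘(ℝ, E) 𝓘(ℝ, ℝ) f (g t) (leftTriv (g t) (u t)))
      0 1
  memLp : MemLp u 2 (volume.restrict (Icc (0 : ℝ) 1))

theorem IsDev.congr {g h : ℝ → G} {u v : ℝ → E} (hg : IsDev g u) (hgh : EqOn g h (Icc 0 1))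
    (huv : u =ᵐ[volume.restrict (Icc (0 : ℝ) 1)] v) : IsDev h v where
  continuousOn := hg.continuousOn.congr hgh.symm
  memLp := hg.memLp.ae_eq huv
  isPrimitive f hf := by
    refine (hg.isPrimitive f hf).congr (fun t ht => congrArg f (hgh ht)) ?_ zero_le_one
    filter_upwards [huv, ae_restrict_mem measurableSet_Icc] with t ht ht'
    rw [ht, hgh ht']

variable [LieGroup 𝓘(ℝ, E) ∞ G]

theorem isH1Path_iff {g : ℝ → G} {g' : ∀ t, TangentSpace 𝓘(ℝ, E) (g t)} :
    IsH1Path g g' ↔ IsDev g (leftLogDeriv g g') := by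
  let w : ℝ → E := g'
  have key : ∀ t, leftTriv (g t) (leftLogDeriv g g' t) = w t := fun t =>
    leftTriv_mder_inv_mul (E := E) (g t) (w t)
  constructor
  · intro h
    refine ⟨h.continuousOn, fun f hf => ?_, h.memLp⟩
    simp only [key]
    exact ⟨h.intervalIntegrable f hf, h.integral_eq f hf⟩
  · intro h
    have h2 := h.isPrimitive
    simp only [key] at h2
    exact ⟨h.continuousOn, fun f hf => (h2 f hf).integrable, fun f hf => (h2 f hf).eq, h.memLp⟩

theorem leftLogDeriv_leftTriv (g : ℝ → G) (u : ℝ → E) :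
    leftLogDeriv g (fun t => leftTriv (E := E) (g t) (u t)) = u :=
  funext fun t => mder_inv_mul_leftTriv (E := E) (g t) (u t)

theorem IsDev.isH1Path {g : ℝ → G} {u : ℝ → E} (h : IsDev g u) :
    IsH1Path g (fun t => leftTriv (E := E) (g t) (u t)) := by
  refine isH1Path_iff.2 ?_
  rw [leftLogDeriv_leftTriv]
  exact h

theorem rightLogDeriv_eq (g : ℝ → G) (g' : ∀ t, TangentSpace 𝓘(ℝ, E) (g t)) (t : ℝ) :
    rightLogDeriv g g' t = Ad (g t) (leftLogDeriv g g' t) := by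
  let w : ℝ → E := g'
  have h := mder_mul_inv_leftTriv (E := E) (g t) (leftLogDeriv g g' t)
  rw [← h]
  exact congrArg (mder 𝓘(ℝ, E) 𝓘(ℝ, E) (fun x : G => x * (g t)⁻¹) (g t))
    (leftTriv_mder_inv_mul (E := E) (g t) (w t)).symm

theorem isDevelopment_iff {u : PathSpace E} {g : ℝ → G} :
    IsDevelopment u g ↔ IsDev g u ∧ g 0 = 1 := by
  constructor
  · rintro ⟨g', h1, h2, h3⟩
    exact ⟨(isH1Path_iff.1 h1).congr (fun _ _ => rfl) h3, h2⟩
  · rintro ⟨h1, h2⟩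
    refine ⟨_, h1.isH1Path, h2, ?_⟩
    rw [leftLogDeriv_leftTriv]

theorem isDev_const (a : G) : IsDev (fun _ => a) (0 : ℝ → E) where
  continuousOn := continuousOn_const
  isPrimitive f _ := ⟨by simp, by simp⟩
  memLp := MemLp.zero

/-- Differentiate `x x⁻¹ = 1` by the product rule in left-trivialized form and solve for the
derivative of the second factor. -/
theorem hasMD_inv (a : G) (v : E) :
    mder 𝓘(ℝ, E) 𝓘(ℝ, E) (fun x : G => x⁻¹) a (leftTriv a v) = leftTriv a⁻¹ (-Ad a v) := by
  have hi : HasMD 𝓘(ℝ, E) 𝓘(ℝ, E) (fun x : G => x⁻¹) a _ :=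
    ((contMDiff_inv 𝓘(ℝ, E) ∞).contMDiffAt).hasMD (by simp)
  set i := mder 𝓘(ℝ, E) 𝓘(ℝ, E) (fun x : G => x⁻¹) a
  set l := mder 𝓘(ℝ, E) 𝓘(ℝ, E) (fun x : G => a⁻¹ * x) a
  set l' := mder 𝓘(ℝ, E) 𝓘(ℝ, E) (fun x : G => a⁻¹⁻¹ * x) a⁻¹
  have h1 : leftTriv a ∘L l = ContinuousLinearMap.id ℝ E :=
    ContinuousLinearMap.ext (leftTriv_mder_inv_mul a)
  have h2 : leftTriv a⁻¹ ∘L l' = ContinuousLinearMap.id ℝ E :=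
    ContinuousLinearMap.ext (leftTriv_mder_inv_mul a⁻¹)
  have h3 := hasMD_mul_comp (g := fun x : G => x) (h := fun x : G => x⁻¹) (x := a) (u := l)
    (v := l' ∘L i) (by rw [h1]; exact hasMD_id)
    (by rw [← ContinuousLinearMap.comp_assoc, h2]; exact hi)
  have h4 := h3.unique ((hasMD_const (c := (1 : G))).congr
    (Filter.Eventually.of_forall fun x => mul_inv_cancel x))
  have h5 := DFunLike.congr_fun h4 (leftTriv a v)
  simp only [mul_inv_cancel, leftTriv_one, inv_inv] at h5
  change Ad a (l (leftTriv a v)) + l' (i (leftTriv a v)) = 0 at h5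
  have h6 : l (leftTriv a v) = v := mder_inv_mul_leftTriv a v
  rw [h6] at h5
  rw [← eq_neg_of_add_eq_zero_right h5]
  exact (leftTriv_mder_inv_mul (E := E) a⁻¹ (i (leftTriv a v))).symm

theorem contDiff_Ad_comp_continuousOn {g : ℝ → G} (hg : ContinuousOn g (Icc 0 1)) :
    ContinuousOn (fun t => (Ad (g t) : E →L[ℝ] E)) (Icc 0 1) :=
  (contMDiff_Ad (E := E) (G := G)).continuous.comp_continuousOn hg

theorem memLp_continuousOn_apply {A : ℝ → E →L[ℝ] E} (hA : ContinuousOn A (Icc 0 1)) {u : ℝ → E}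
    (hu : MemLp u 2 (volume.restrict (Icc (0 : ℝ) 1))) :
    MemLp (fun t => A t (u t)) 2 (volume.restrict (Icc (0 : ℝ) 1)) := by
  obtain ⟨C, hC⟩ := isCompact_Icc.exists_bound_of_continuousOn hA
  refine MemLp.of_le_mul (c := C) hu ?_ ?_
  · exact (ContinuousLinearMap.apply ℝ E (E := E)).flip.aestronglyMeasurable_comp₂
      (hA.aestronglyMeasurable measurableSet_Icc) hu.aestronglyMeasurable
  · refine (ae_restrict_iff' measurableSet_Icc).2 (Filter.Eventually.of_forall fun t ht => ?_)
    exact (ContinuousLinearMap.le_opNorm _ _).trans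
      (mul_le_mul_of_nonneg_right (hC t ht) (norm_nonneg _))

theorem IsDev.inv {g : ℝ → G} {u : ℝ → E} (hg : IsDev g u) :
    IsDev (fun t => (g t)⁻¹) (fun t => -Ad (g t) (u t)) where
  continuousOn := (contMDiff_inv 𝓘(ℝ, E) ∞).continuous.comp_continuousOn hg.continuousOn
  memLp := (memLp_continuousOn_apply (contDiff_Ad_comp_continuousOn hg.continuousOn) hg.memLp).neg
  isPrimitive f hf := by
    have h := hg.isPrimitive (fun x => f x⁻¹) (hf.comp (contMDiff_inv 𝓘(ℝ, E) ∞))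
    have e : ∀ t, mder 𝓘(ℝ, E) 𝓘(ℝ, ℝ) (fun x => f x⁻¹) (g t) (leftTriv (g t) (u t)) =
        mder 𝓘(ℝ, E) 𝓘(ℝ, ℝ) f (g t)⁻¹ (leftTriv (g t)⁻¹ (-Ad (g t) (u t))) := fun t => by
      rw [mder_comp (f := fun x : G => x⁻¹) ((hf.contMDiffAt).mdifferentiableAt (by simp))
        ((contMDiff_inv 𝓘(ℝ, E) ∞).contMDiffAt.mdifferentiableAt (by simp)), ← hasMD_inv]
      rfl
    simp only [e] at h
    exact h

variable [FiniteDimensional ℝ E] [T2Space G]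

/-- Globally defined smooth functions that restrict to a given chart near a point. -/
theorem exists_contMDiff_eq_extChartAt (a : G) : ∃ X : G → E, ContMDiff 𝓘(ℝ, E) 𝓘(ℝ, E) ∞ X ∧
    X =ᶠ[𝓝 a] extChartAt 𝓘(ℝ, E) a := by
  let b : SmoothBumpFunction 𝓘(ℝ, E) a := Classical.arbitrary _
  refine ⟨fun x => b x • extChartAt 𝓘(ℝ, E) a x, b.contMDiff_smul contMDiffOn_extChartAt, ?_⟩
  filter_upwards [b.eventuallyEq_one] with x hx
  rw [hx]; simp

theorem IsDev.isPrimitive_vector {W : Type*} [NormedAddCommGroup W] [NormedSpace ℝ W]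
    [FiniteDimensional ℝ W] {g : ℝ → G} {u : ℝ → E} (hg : IsDev g u) {X : G → W}
    (hX : ContMDiff 𝓘(ℝ, E) 𝓘(ℝ, W) ∞ X) :
    IsPrimitive (fun t => X (g t)) (fun t => mder 𝓘(ℝ, E) 𝓘(ℝ, W) X (g t) (leftTriv (g t) (u t)))
      0 1 := by
  refine IsPrimitive.of_dual (fun ℓ => ?_) zero_le_one
  have hℓ : ContMDiff 𝓘(ℝ, W) 𝓘(ℝ, ℝ) ∞ ℓ := ℓ.contDiff.contMDiff
  have h := hg.isPrimitive (fun x => ℓ (X x)) (hℓ.comp hX)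
  have e : ∀ t v, mder 𝓘(ℝ, E) 𝓘(ℝ, ℝ) (fun x => ℓ (X x)) (g t) v =
      ℓ (mder 𝓘(ℝ, E) 𝓘(ℝ, W) X (g t) v) := fun t v => by
    have h1 : HasMD 𝓘(ℝ, W) 𝓘(ℝ, ℝ) ℓ (X (g t)) ℓ := hasMD_iff_hasFDerivAt.2 ℓ.hasFDerivAt
    rw [(h1.comp (hX.contMDiffAt.hasMD (by simp))).mder_eq]
    rfl
  simp only [e] at h
  exact h

/-- A test function of `g h` is a smooth function on `G × G` along the path `(g, h)`. Charts at `g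
t₀` and `h t₀`, extended by bump functions to global smooth maps, give absolutely continuous
coordinates of this path, so the chain rule applies locally; the product rule identifies the
derivative. -/
theorem IsDev.mul {g h : ℝ → G} {u v : ℝ → E} (hg : IsDev g u) (hh : IsDev h v) :
    IsDev (fun t => g t * h t) (fun t => Ad (h t)⁻¹ (u t) + v t) where
  continuousOn := (contMDiff_mul 𝓘(ℝ, E) ∞).continuous.comp_continuousOn
    (hg.continuousOn.prodMk hh.continuousOn)
  memLp := (memLp_continuousOn_apply (contDiff_Ad_comp_continuousOn
    hh.inv.continuousOn) hg.memLp).add hh.memLp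
  isPrimitive f hf := by
    refine IsPrimitive.of_locally zero_le_one fun t₀ ht₀ => ?_
    obtain ⟨X, hX, hXe⟩ := exists_contMDiff_eq_extChartAt (E := E) (g t₀)
    obtain ⟨Y, hY, hYe⟩ := exists_contMDiff_eq_extChartAt (E := E) (h t₀)
    have hF : ContMDiff (𝓘(ℝ, E).prod 𝓘(ℝ, E)) 𝓘(ℝ, ℝ) ∞ (fun p : G × G => f (p.1 * p.2)) :=
      hf.comp (contMDiff_mul 𝓘(ℝ, E) ∞)
    have hXY : ContMDiff (𝓘(ℝ, E).prod 𝓘(ℝ, E)) 𝓘(ℝ, E × E) ∞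
        (fun p : G × G => (X p.1, Y p.2)) :=
      (hX.comp contMDiff_fst).prodMk_space (hY.comp contMDiff_snd)
    have hc : ContinuousOn (fun t => (g t, h t)) (Icc 0 1) :=
      hg.continuousOn.prodMk hh.continuousOn
    have hd : ∀ p : G × G, mder (𝓘(ℝ, E).prod 𝓘(ℝ, E)) 𝓘(ℝ, E × E)
        (fun p : G × G => (X p.1, Y p.2)) p =
        (mder 𝓘(ℝ, E) 𝓘(ℝ, E) X p.1).prodMap (mder 𝓘(ℝ, E) 𝓘(ℝ, E) Y p.2) := by
      intro p
      have h1 := (hX.contMDiffAt.hasMD (by simp)).comp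
        (hasMD_fst (I₁ := 𝓘(ℝ, E)) (I₂ := 𝓘(ℝ, E)) (p := p))
      have h2 := (hY.contMDiffAt.hasMD (by simp)).comp
        (hasMD_snd (I₁ := 𝓘(ℝ, E)) (I₂ := 𝓘(ℝ, E)) (p := p))
      refine HasMD.mder_eq ?_
      rw [modelWithCornersSelf_prod, ← chartedSpaceSelf_prod]
      exact h1.prodMk h2
    have hprim : IsPrimitive (fun t => (X (g t), Y (h t))) (fun t =>
        mder (𝓘(ℝ, E).prod 𝓘(ℝ, E)) 𝓘(ℝ, E × E) (fun p : G × G => (X p.1, Y p.2)) (g t, h t)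
          (leftTriv (g t) (u t), leftTriv (h t) (v t))) 0 1 := by
      have hx := hg.isPrimitive_vector hX
      have hy := hh.isPrimitive_vector hY
      simp only [hd]
      refine IsPrimitive.of_dual (fun ℓ => ?_) zero_le_one
      have e : ∀ x y, ℓ (x, y) = ℓ.comp (ContinuousLinearMap.inl ℝ E E) x +
          ℓ.comp (ContinuousLinearMap.inr ℝ E E) y := fun x y => by
        simp [← map_add]
      have hx1 := hx.comp zero_le_one (F := ℓ.comp (ContinuousLinearMap.inl ℝ E E))
        fun t _ => (ContinuousLinearMap.contDiff _).contDiffAt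
      have hy1 := hy.comp zero_le_one (F := ℓ.comp (ContinuousLinearMap.inr ℝ E E))
        fun t _ => (ContinuousLinearMap.contDiff _).contDiffAt
      simp only [ContinuousLinearMap.fderiv] at hx1 hy1
      refine ⟨?_, fun t ht => ?_⟩
      · exact (hx1.integrable.add hy1.integrable).congr_ae
          (Filter.Eventually.of_forall fun t => (e _ _).symm)
      · have hi : ∀ {w : ℝ → ℝ}, IntervalIntegrable w volume 0 1 →
            IntervalIntegrable w volume 0 t := fun hw => hw.mono_set (by
          rw [uIcc_of_le ht.1, uIcc_of_le zero_le_one]; exact Icc_subset_Icc le_rfl ht.2)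
        have e1 := hx1.eq t ht
        have e2 := hy1.eq t ht
        rw [e, e, e1, e2]
        have e3 := intervalIntegral.integral_add (hi hx1.integrable) (hi hy1.integrable)
        simp only [ContinuousLinearMap.prodMap, e]
        refine Eq.trans ?_ (congrArg (_ + ·) e3.symm)
        ring
    obtain ⟨U, hU, hUt⟩ := IsPrimitive.local_comp (I₁ := 𝓘(ℝ, E).prod 𝓘(ℝ, E)) hc hprim ht₀
      (r := Prod.map (extChartAt 𝓘(ℝ, E) (g t₀)).symm (extChartAt 𝓘(ℝ, E) (h t₀)).symm)
      (by
        have e1 := hXe.self_of_nhds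
        have e2 := hYe.self_of_nhds
        simp only [e1, e2]
        rw [modelWithCornersSelf_prod, ← chartedSpaceSelf_prod]
        exact ContMDiffAt.prodMap' ((contMDiffOn_extChartAt_symm (g t₀)).contMDiffAt
            (extChartAt_target_mem_nhds (I := 𝓘(ℝ, E)) (g t₀)))
          ((contMDiffOn_extChartAt_symm (h t₀)).contMDiffAt
            (extChartAt_target_mem_nhds (I := 𝓘(ℝ, E)) (h t₀))))
      hXY.contMDiffAt
      (by
        rw [nhds_prod_eq]
        filter_upwards [(hXe.and (extChartAt_source_mem_nhds (I := 𝓘(ℝ, E)) (g t₀))).prod_mk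
          (hYe.and (extChartAt_source_mem_nhds (I := 𝓘(ℝ, E)) (h t₀)))] with p hp
        obtain ⟨⟨h1, h2⟩, h3, h4⟩ := hp
        refine Prod.ext ?_ ?_
        · simp only [Prod.map, h1]; exact (extChartAt 𝓘(ℝ, E) (g t₀)).left_inv h2
        · simp only [Prod.map, h3]; exact (extChartAt 𝓘(ℝ, E) (h t₀)).left_inv h4)
      hF.contMDiffAt
    refine ⟨U, hU, fun s hs t ht hst => (hUt s hs t ht hst).congr (fun _ _ => rfl)
      (Filter.Eventually.of_forall fun τ => ?_) hst⟩
    have h1 := mder_comp (I₁ := 𝓘(ℝ, E).prod 𝓘(ℝ, E)) (I₂ := 𝓘(ℝ, E)) (I₃ := 𝓘(ℝ, ℝ)) (g := f)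
      (f := fun p : G × G => p.1 * p.2) (x := (g τ, h τ))
      (hf.contMDiffAt.mdifferentiableAt (by simp)) (hasMD_mul (g τ) (h τ)).mdifferentiableAt
    have h2 := DFunLike.congr_fun (mder_mul_right_comp_leftTriv (E := E) (g τ) (h τ)) (u τ)
    have h3 := DFunLike.congr_fun (mder_mul_left_comp_leftTriv (E := E) (g τ) (h τ)) (v τ)
    simp only [h1, (hasMD_mul (E := E) (g τ) (h τ)).mder_eq]
    rw [map_add, ← h3]
    rw [show leftTriv (g τ * h τ) (Ad (h τ)⁻¹ (u τ)) = _ from h2.symm]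
    rfl

theorem exists_contMDiff_separating {a b : G} (hab : a ≠ b) :
    ∃ f : G → ℝ, ContMDiff 𝓘(ℝ, E) 𝓘(ℝ, ℝ) ∞ f ∧ f a ≠ f b := by
  have hs : ({b}ᶜ : Set G) ∈ 𝓝 a := isOpen_compl_singleton.mem_nhds hab
  obtain ⟨f, hf⟩ := (SmoothBumpFunction.nhds_basis_support (I := 𝓘(ℝ, E)) hs).ex_mem
  refine ⟨f, f.contMDiff, ?_⟩
  rw [f.eq_one]
  have : b ∉ Function.support f := fun hb => hf (subset_tsupport _ hb) rfl
  rw [Function.notMem_support.1 this]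
  exact one_ne_zero

/-- An `H¹` path is determined by its starting point and its left logarithmic derivative. -/
theorem IsDev.unique {g h : ℝ → G} {u v : ℝ → E} (hg : IsDev g u) (hh : IsDev h v)
    (huv : u =ᵐ[volume.restrict (Icc (0 : ℝ) 1)] v) (h0 : g 0 = h 0) : EqOn g h (Icc 0 1) := by
  -- The path `g h⁻¹` has logarithmic derivative `Ad(h) (u - v) = 0`, so every smooth function is
  -- constant along it; smooth functions separate points.
  have hk := hg.mul hh.inv
  have hk' := hk.congr (v := 0) (fun _ _ => rfl) (by
    filter_upwards [huv] with t ht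
    simp [ht])
  intro t ht
  by_contra hne
  obtain ⟨f, hf, hfne⟩ := exists_contMDiff_separating (E := E) (G := G)
    (a := g t * (h t)⁻¹) (b := 1) (fun h' => hne (mul_inv_eq_one.1 h'))
  have := (hk'.isPrimitive f hf).eq t ht
  simp [h0] at this
  exact hfne this

end LieGroupPaths

/-! ### Operators on spaces of paths -/

open scoped BoundedContinuousFunction

section PathOperators

variable {F : Type*} [NormedAddCommGroup F] [NormedSpace ℝ F]

instance : IsProbabilityMeasure (volume.restrict (Icc (0 : ℝ) 1)) := ⟨by simp⟩

theorem integrable_pathSpace (v : PathSpace F) :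
    Integrable v (volume.restrict (Icc (0 : ℝ) 1)) :=
  (Lp.memLp v).integrable (by norm_num)

/-- Hölder's inequality against the constant `1`. It makes primitives of `L²` paths Hölder
continuous with exponent `1/2`, the source of all compactness below. -/
theorem norm_setIntegral_le_sqrt_mul_norm (v : PathSpace F) (s : Set ℝ) :
    ‖∫ t in s, v t ∂(volume.restrict (Icc (0 : ℝ) 1))‖ ≤
      √((volume.restrict (Icc (0 : ℝ) 1)).real s) * ‖v‖ := by
  set μ := volume.restrict (Icc (0 : ℝ) 1)
  have h1 : eLpNorm v 1 (μ.restrict s) ≤ eLpNorm v 2 μ * μ s ^ (1 / 2 : ℝ) := by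
    have := eLpNorm_le_eLpNorm_mul_rpow_measure_univ (μ := μ.restrict s) (p := 1) (q := 2)
      (f := v) (by norm_num) (Lp.aestronglyMeasurable v).restrict
    refine this.trans ?_
    norm_num
    gcongr
    exact Measure.restrict_le_self
  have h2 : eLpNorm v 2 μ * μ s ^ (1 / 2 : ℝ) ≠ ⊤ :=
    ENNReal.mul_ne_top (Lp.eLpNorm_ne_top v) (by finiteness)
  calc ‖∫ t in s, v t ∂μ‖ ≤ (eLpNorm v 1 (μ.restrict s)).toReal := by
        rw [← toReal_enorm]
        refine ENNReal.toReal_mono (ne_top_of_le_ne_top h2 h1) ?_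
        rw [eLpNorm_one_eq_lintegral_enorm]
        exact enorm_integral_le_lintegral_enorm _
    _ ≤ (eLpNorm v 2 μ * μ s ^ (1 / 2 : ℝ)).toReal := ENNReal.toReal_mono h2 h1
    _ = √(μ.real s) * ‖v‖ := by
        rw [ENNReal.toReal_mul, mul_comm, ← ENNReal.toReal_rpow, Real.sqrt_eq_rpow, Lp.norm_def]
        rfl

theorem intervalIntegrable_pathSpace (v : PathSpace F) (a b : ℝ) :
    IntervalIntegrable v (volume.restrict (Icc (0 : ℝ) 1)) a b :=
  ⟨(integrable_pathSpace v).integrableOn, (integrable_pathSpace v).integrableOn⟩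

theorem norm_intervalIntegral_pathSpace_le (v : PathSpace F) (a b : ℝ) :
    ‖∫ t in a..b, v t ∂(volume.restrict (Icc (0 : ℝ) 1))‖ ≤ √|b - a| * ‖v‖ := by
  rw [intervalIntegral.norm_intervalIntegral_eq]
  refine (norm_setIntegral_le_sqrt_mul_norm v _).trans ?_
  gcongr
  rw [Measure.real, ← ENNReal.toReal_ofReal (abs_nonneg (b - a))]
  refine ENNReal.toReal_mono (by simp) ?_
  refine (Measure.restrict_apply_le _ _).trans ?_
  simp [uIoc, Real.volume_Ioc, max_sub_min_eq_abs]

theorem norm_intervalIntegral_pathSpace_le_one (v : PathSpace F) (a b : ℝ) :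
    ‖∫ t in a..b, v t ∂(volume.restrict (Icc (0 : ℝ) 1))‖ ≤ ‖v‖ := by
  rw [intervalIntegral.norm_intervalIntegral_eq]
  refine (norm_setIntegral_le_sqrt_mul_norm v _).trans ?_
  refine mul_le_of_le_one_left (norm_nonneg _) (Real.sqrt_le_one.2 ?_)
  exact measureReal_le_one

/-- The primitive `t ↦ ∫ τ in 0..t, v τ`, extended to be constant outside of `[0,1]`. -/
def primitiveL : PathSpace F →L[ℝ] (ℝ →ᵇ F) :=
  LinearMap.mkContinuous
    { toFun := fun v => BoundedContinuousFunction.ofNormedAddCommGroup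
        (fun t => ∫ τ in (0 : ℝ)..t, v τ ∂(volume.restrict (Icc (0 : ℝ) 1)))
        (intervalIntegral.continuous_primitive (intervalIntegrable_pathSpace v) 0) ‖v‖
        (fun t => norm_intervalIntegral_pathSpace_le_one v 0 t)
      map_add' := fun v w => by
        ext t
        simp only [BoundedContinuousFunction.coe_ofNormedAddCommGroup,
          BoundedContinuousFunction.coe_add, Pi.add_apply]
        rw [← intervalIntegral.integral_add (intervalIntegrable_pathSpace v 0 t)
          (intervalIntegrable_pathSpace w 0 t)]
        exact intervalIntegral.integral_congr_ae
          ((Lp.coeFn_add v w).mono fun τ hτ _ => by simpa using hτ)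
      map_smul' := fun c v => by
        ext t
        simp only [BoundedContinuousFunction.coe_ofNormedAddCommGroup, RingHom.id_apply,
          BoundedContinuousFunction.coe_smul]
        rw [← intervalIntegral.integral_smul]
        exact intervalIntegral.integral_congr_ae
          ((Lp.coeFn_smul c v).mono fun τ hτ _ => by simpa using hτ) }
    1 fun v => by
      rw [one_mul]
      exact BoundedContinuousFunction.norm_ofNormedAddCommGroup_le _ (norm_nonneg _)
        (fun t => norm_intervalIntegral_pathSpace_le_one v 0 t)

theorem primitiveL_apply (v : PathSpace F) (t : ℝ) :
    primitiveL v t = ∫ τ in (0 : ℝ)..t, v τ ∂(volume.restrict (Icc (0 : ℝ) 1)) := rfl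

theorem primitiveL_apply_of_mem (v : PathSpace F) {t : ℝ} (ht : t ∈ Icc (0 : ℝ) 1) :
    primitiveL v t = ∫ τ in (0 : ℝ)..t, v τ := by
  rw [primitiveL_apply, intervalIntegral.integral_of_le ht.1, intervalIntegral.integral_of_le ht.1,
    Measure.restrict_restrict measurableSet_Ioc,
    inter_eq_left.2 (Ioc_subset_Icc_self.trans (Icc_subset_Icc_right ht.2))]

@[simp]
theorem primitiveL_zero_right (v : PathSpace F) : primitiveL v 0 = 0 := by
  simp [primitiveL_apply]

theorem primitiveL_sub_apply (v : PathSpace F) (s t : ℝ) :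
    primitiveL v t - primitiveL v s =
      ∫ τ in s..t, v τ ∂(volume.restrict (Icc (0 : ℝ) 1)) :=
  intervalIntegral.integral_interval_sub_left (intervalIntegrable_pathSpace v _ _)
    (intervalIntegrable_pathSpace v _ _)

theorem norm_primitiveL_sub_le (v : PathSpace F) (s t : ℝ) :
    ‖primitiveL v t - primitiveL v s‖ ≤ √|t - s| * ‖v‖ := by
  rw [primitiveL_sub_apply]
  exact norm_intervalIntegral_pathSpace_le v s t

theorem intervalIntegrable_zero_one (v : PathSpace F) : IntervalIntegrable v volume 0 1 := by
  rw [intervalIntegrable_iff_integrableOn_Icc_of_le zero_le_one]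
  exact integrable_pathSpace v

theorem isPrimitive_const_add_primitiveL (x : F) (v : PathSpace F) :
    IsPrimitive (fun t => x + primitiveL v t) v 0 1 :=
  ⟨intervalIntegrable_zero_one v, fun t ht => by
    rw [primitiveL_zero_right, add_zero, primitiveL_apply_of_mem v ht]⟩

/-- Clamping of a path at the end points of `[0,1]`. -/
def clampPath {X : Type*} (f : ℝ → X) (t : ℝ) : X := f (projIcc (0 : ℝ) 1 zero_le_one t)

theorem clampPath_of_mem {X : Type*} (f : ℝ → X) {t : ℝ} (ht : t ∈ Icc (0 : ℝ) 1) :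
    clampPath f t = f t := by
  rw [clampPath, projIcc_of_mem _ ht]

/-- The measure is carried by `[0,1]`, so primitives are constant on either side of it. -/
theorem primitiveL_projIcc (v : PathSpace F) (t : ℝ) :
    primitiveL v (projIcc (0 : ℝ) 1 zero_le_one t) = primitiveL v t := by
  symm
  rw [← sub_eq_zero, primitiveL_sub_apply, intervalIntegral, sub_eq_zero]
  have h0 : ∀ s : Set ℝ, (∀ x ∈ s, x ∉ Ioo (0 : ℝ) 1) →
      ∫ τ in s, v τ ∂(volume.restrict (Icc (0 : ℝ) 1)) = 0 := fun s hs => by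
    refine setIntegral_measure_zero _ ?_
    rw [← restrict_Ioo_eq_restrict_Icc]
    rw [Measure.restrict_apply' measurableSet_Ioo]
    convert measure_empty (μ := volume (α := ℝ)) using 2
    ext x
    exact ⟨fun h => (hs x h.1 h.2).elim, fun h => h.elim⟩
  rw [h0, h0]
  all_goals
    rintro x ⟨h1, h2⟩ ⟨h3, h4⟩
    rw [coe_projIcc] at *
    simp only [le_max_iff, max_lt_iff, min_lt_iff, le_min_iff] at *
    grind

/-- A path that is continuous on `[0,1]`, clamped to a bounded continuous function. -/
def clampBCF (f : ℝ → F) (hf : ContinuousOn f (Icc 0 1)) : ℝ →ᵇ F :=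
  (BoundedContinuousFunction.mkOfCompact ⟨(Icc (0 : ℝ) 1).domRestrict f, hf.domRestrict⟩).compContinuous
    ⟨projIcc (0 : ℝ) 1 zero_le_one, continuous_projIcc⟩

variable (F) in
/-- The integral over `[0,1]`. -/
def integralL : PathSpace F →L[ℝ] F :=
  (BoundedContinuousFunction.evalCLM ℝ (1 : ℝ)).comp primitiveL

theorem integralL_apply (v : PathSpace F) : integralL F v = primitiveL v 1 := rfl

variable (F) in
/-- Constant paths. -/
def constPath : F →L[ℝ] PathSpace F := Lp.constL 2 (volume.restrict (Icc (0 : ℝ) 1)) ℝ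

theorem coeFn_constPath (x : F) :
    constPath F x =ᵐ[volume.restrict (Icc (0 : ℝ) 1)] fun _ => x :=
  Lp.coeFn_const _ _ _

theorem integralL_constPath [CompleteSpace F] (x : F) : integralL F (constPath F x) = x := by
  rw [integralL_apply, primitiveL_apply_of_mem _ (right_mem_Icc.2 zero_le_one)]
  rw [intervalIntegral.integral_of_le zero_le_one, ← integral_Icc_eq_integral_Ioc,
    integral_congr_ae (coeFn_constPath x)]
  simp

variable {X Y Z : Type*} [NormedAddCommGroup X] [NormedSpace ℝ X] [NormedAddCommGroup Y]
  [NormedSpace ℝ Y] [NormedAddCommGroup Z] [NormedSpace ℝ Z]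

/-- The pointwise application of a bilinear map to a continuous path and to a path in `L²`. -/
def pairL (β : X →L[ℝ] Y →L[ℝ] Z) : (ℝ →ᵇ X) →L[ℝ] PathSpace Y →L[ℝ] PathSpace Z :=
  (β.holderL (volume.restrict (Icc (0 : ℝ) 1)) ⊤ 2 2).comp
    (BoundedContinuousFunction.toLp ⊤ (volume.restrict (Icc (0 : ℝ) 1)) ℝ)

theorem coeFn_pairL (β : X →L[ℝ] Y →L[ℝ] Z) (A : ℝ →ᵇ X) (v : PathSpace Y) :
    pairL β A v =ᵐ[volume.restrict (Icc (0 : ℝ) 1)] fun t => β (A t) (v t) := by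
  have h1 := β.coeFn_holder (r := 2)
    (BoundedContinuousFunction.toLp ⊤ (volume.restrict (Icc (0 : ℝ) 1)) ℝ A) v
  have h2 := BoundedContinuousFunction.coeFn_toLp ⊤ (volume.restrict (Icc (0 : ℝ) 1)) ℝ A
  filter_upwards [h1, h2] with t h1 h2
  rw [← h2]
  exact h1

/-- Pointwise application of operators. -/
def mulOp : (ℝ →ᵇ (X →L[ℝ] Y)) →L[ℝ] PathSpace X →L[ℝ] PathSpace Y :=
  pairL (ContinuousLinearMap.id ℝ (X →L[ℝ] Y))

theorem coeFn_mulOp (A : ℝ →ᵇ (X →L[ℝ] Y)) (v : PathSpace X) :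
    mulOp A v =ᵐ[volume.restrict (Icc (0 : ℝ) 1)] fun t => A t (v t) :=
  coeFn_pairL _ A v

theorem mulOp_mul (A B : ℝ →ᵇ (X →L[ℝ] X)) (v : PathSpace X) :
    mulOp (A * B) v = mulOp A (mulOp B v) := by
  refine Lp.ext ?_
  filter_upwards [coeFn_mulOp (A * B) v, coeFn_mulOp A (mulOp B v), coeFn_mulOp B v]
    with t h1 h2 h3
  rw [h1, h2, h3]
  rfl

theorem mulOp_one (v : PathSpace X) : mulOp (1 : ℝ →ᵇ (X →L[ℝ] X)) v = v := by
  refine Lp.ext ?_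
  filter_upwards [coeFn_mulOp (1 : ℝ →ᵇ (X →L[ℝ] X)) v] with t h1
  rw [h1]
  rfl

/-- Turns an integral equation on `[0,1]` into an identity between bounded continuous functions on
the line. -/
theorem primitiveL_eq_of_isPrimitive {z : ℝ → F} {z' : ℝ → F} {v : PathSpace F}
    (hz : IsPrimitive z z' 0 1) (hv : v =ᵐ[volume.restrict (Icc (0 : ℝ) 1)] z') (t : ℝ) :
    clampPath z t = z 0 + primitiveL v t := by
  rw [← primitiveL_projIcc]
  set s := projIcc (0 : ℝ) 1 zero_le_one t
  rw [primitiveL_apply_of_mem v s.2]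
  change z s = _
  rw [hz.eq s s.2]
  congr 1
  refine intervalIntegral.integral_congr_ae ?_
  rw [Filter.EventuallyEq, ae_restrict_iff' measurableSet_Icc] at hv
  filter_upwards [hv] with τ h hτ
  rw [uIoc_of_le s.2.1] at hτ
  exact (h ⟨hτ.1.le, hτ.2.trans s.2.2⟩).symm

end PathOperators

set_option maxSynthPendingDepth 3

/-! ### Existence of developments -/

open scoped BoundedContinuousFunction

section SmallSolutions

variable {E : Type*} [NormedAddCommGroup E] [NormedSpace ℝ E] [CompleteSpace E]

/-- The equation `x' = F x u` with small `u` of class `L²` has a solution, which to first order is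
`x₀ + F x₀ ∫ u`. -/
theorem exists_solution_of_lipschitzWith {F : E → E →L[ℝ] E} {K : NNReal} (hF : LipschitzWith K F)
    (x₀ : E) : ∃ C ≥ 0, ∃ δ > 0, ∀ u : PathSpace E, ‖u‖ < δ → ∃ x : ℝ →ᵇ E,
      x = BoundedContinuousFunction.const ℝ x₀ + primitiveL (mulOp (x.comp F hF) u) ∧
      ‖x - BoundedContinuousFunction.const ℝ x₀‖ ≤ C * ‖u‖ ∧
      ‖x - BoundedContinuousFunction.const ℝ x₀ -
        primitiveL (mulOp (BoundedContinuousFunction.const ℝ (F x₀)) u)‖ ≤ C * ‖u‖ ^ 2 := by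
  set c₀ : ℝ →ᵇ E := BoundedContinuousFunction.const ℝ x₀
  set m : ℝ := ‖(primitiveL : PathSpace E →L[ℝ] ℝ →ᵇ E)‖ *
    ‖(mulOp : (ℝ →ᵇ (E →L[ℝ] E)) →L[ℝ] PathSpace E →L[ℝ] PathSpace E)‖
  have hm : 0 ≤ m := by positivity
  have hbd : ∀ (A : ℝ →ᵇ (E →L[ℝ] E)) (u : PathSpace E),
      ‖primitiveL (mulOp A u)‖ ≤ m * ‖A‖ * ‖u‖ := fun A u => by
    calc _ ≤ ‖(primitiveL : PathSpace E →L[ℝ] ℝ →ᵇ E)‖ * ‖mulOp A u‖ :=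
          ContinuousLinearMap.le_opNorm _ _
      _ ≤ ‖(primitiveL : PathSpace E →L[ℝ] ℝ →ᵇ E)‖ * (‖(mulOp :
          (ℝ →ᵇ (E →L[ℝ] E)) →L[ℝ] PathSpace E →L[ℝ] PathSpace E)‖ * ‖A‖ * ‖u‖) := by
          gcongr; exact ContinuousLinearMap.le_opNorm₂ _ _ _
      _ = m * ‖A‖ * ‖u‖ := by ring
  have hlip : ∀ x y : ℝ →ᵇ E, ‖x.comp F hF - y.comp F hF‖ ≤ K * ‖x - y‖ := fun x y => by
    rw [← dist_eq_norm, ← dist_eq_norm]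
    exact (BoundedContinuousFunction.lipschitz_comp hF).dist_le_mul x y
  have hc₀ : c₀.comp F hF = BoundedContinuousFunction.const ℝ (F x₀) := rfl
  have hdiff : ∀ (x y : ℝ →ᵇ E) (u : PathSpace E),
      ‖primitiveL (mulOp (x.comp F hF) u) - primitiveL (mulOp (y.comp F hF) u)‖ ≤
        m * K * ‖u‖ * ‖x - y‖ := fun x y u => by
    have : primitiveL (mulOp (x.comp F hF) u) - primitiveL (mulOp (y.comp F hF) u) =
        primitiveL (mulOp (x.comp F hF - y.comp F hF) u) := by simp
    rw [this]
    refine (hbd _ _).trans ?_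
    calc m * ‖x.comp F hF - y.comp F hF‖ * ‖u‖ ≤ m * (K * ‖x - y‖) * ‖u‖ := by
          gcongr; exact hlip x y
      _ = _ := by ring
  -- For `‖u‖ < 1 / (2 (m K + 1))` the Picard operator contracts by `1/2`. Then `‖x - x₀‖ ≤ ‖x - x₀‖
  -- / 2 + m ‖F x₀‖ ‖u‖`, whence the factor `2`; the error of the linear term has the further factor
  -- `m K ‖u‖`, and `1 + m K` serves both estimates.
  refine ⟨2 * m * ‖F x₀‖ * (1 + m * K), by positivity, 1 / (2 * (m * K + 1)), by positivity,
    fun u hu => ?_⟩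
  have hsmall : m * K * ‖u‖ ≤ 1 / 2 := by
    rw [lt_div_iff₀ (by positivity)] at hu
    nlinarith [norm_nonneg u]
  have hcontr : ContractingWith (1 / 2)
      (fun x : ℝ →ᵇ E => c₀ + primitiveL (mulOp (x.comp F hF) u)) := by
    refine ⟨by norm_num, LipschitzWith.of_dist_le_mul fun x y => ?_⟩
    rw [dist_eq_norm, dist_eq_norm, add_sub_add_left_eq_sub]
    refine (hdiff x y u).trans ?_
    have := mul_le_mul_of_nonneg_right hsmall (norm_nonneg (x - y))
    simpa using this
  set x := hcontr.fixedPoint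
  have hx : c₀ + primitiveL (mulOp (x.comp F hF) u) = x := hcontr.fixedPoint_isFixedPt
  have hx1 : x - c₀ = primitiveL (mulOp (x.comp F hF) u) := by
    rw [sub_eq_iff_eq_add', hx]
  have h2 : ‖x - c₀ - primitiveL (mulOp (BoundedContinuousFunction.const ℝ (F x₀)) u)‖ ≤
      m * K * ‖u‖ * ‖x - c₀‖ := by
    conv_lhs => rw [hx1, ← hc₀]
    exact hdiff x c₀ u
  have h3 : ‖primitiveL (mulOp (BoundedContinuousFunction.const ℝ (F x₀)) u)‖ ≤
      m * ‖F x₀‖ * ‖u‖ := by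
    refine (hbd _ _).trans ?_
    gcongr
    exact BoundedContinuousFunction.norm_const_le _
  have h4 : ‖x - c₀‖ ≤ 2 * m * ‖F x₀‖ * ‖u‖ := by
    have h5 : ‖x - c₀‖ ≤ m * K * ‖u‖ * ‖x - c₀‖ + m * ‖F x₀‖ * ‖u‖ :=
      (norm_le_norm_sub_add _ _).trans (add_le_add h2 h3)
    nlinarith [norm_nonneg (x - c₀)]
  have hp : 0 ≤ 2 * m * ‖F x₀‖ * ‖u‖ := by positivity
  refine ⟨x, hx.symm, h4.trans ?_, h2.trans ?_⟩
  · have : 0 ≤ m * K := by positivity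
    nlinarith
  · calc m * K * ‖u‖ * ‖x - c₀‖ ≤ m * K * ‖u‖ * (2 * m * ‖F x₀‖ * ‖u‖) := by gcongr
      _ = (2 * m * ‖F x₀‖) * (m * K) * ‖u‖ ^ 2 := by ring
      _ ≤ 2 * m * ‖F x₀‖ * (1 + m * K) * ‖u‖ ^ 2 := by gcongr; linarith

end SmallSolutions

/-! ### Local developments in a chart, and global ones by subdivision of the unit interval -/

section Existence

variable {E : Type*} [NormedAddCommGroup E] [NormedSpace ℝ E]
  {G : Type*} [TopologicalSpace G] [ChartedSpace E G] [Group G] [LieGroup 𝓘(ℝ, E) ∞ G]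
  [FiniteDimensional ℝ E]

variable (G) in
-- In a chart at `1` the equation reads `x' = F x u`, where `F` is Lipschitz near the base point and
-- is extended to a globally Lipschitz map. A small `u` keeps the solution where the extension
-- agrees with `F`. The expansion of the end point with quadratic error is recorded because it gives
-- the derivative of `Φ` at the origin.
theorem exists_isDev_of_norm_lt : ∃ C ≥ 0, ∃ δ > 0, ∀ u : PathSpace E, ‖u‖ < δ →
    ∃ g : ℝ → G, IsDev g u ∧ g 0 = 1 ∧ ∃ y ∈ (extChartAt 𝓘(ℝ, E) (1 : G)).target,
      g 1 = (extChartAt 𝓘(ℝ, E) (1 : G)).symm y ∧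
      ‖y - extChartAt 𝓘(ℝ, E) (1 : G) 1‖ ≤ C * ‖u‖ ∧
      ‖y - extChartAt 𝓘(ℝ, E) (1 : G) 1 -
        mder 𝓘(ℝ, E) 𝓘(ℝ, E) (extChartAt 𝓘(ℝ, E) (1 : G)) 1 (integralL E u)‖ ≤
        C * ‖u‖ ^ 2 := by
  have : CompleteSpace E := FiniteDimensional.complete ℝ E
  set χ := extChartAt 𝓘(ℝ, E) (1 : G)
  have hχ : ContMDiffAt 𝓘(ℝ, E) 𝓘(ℝ, E) ∞ χ (1 : G) := contMDiffAt_extChartAt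
  have htar : χ.target ∈ 𝓝 (χ 1) := extChartAt_target_mem_nhds (I := 𝓘(ℝ, E)) (1 : G)
  have hχs : ContMDiffAt 𝓘(ℝ, E) 𝓘(ℝ, E) ∞ χ.symm (χ 1) :=
    (contMDiffOn_extChartAt_symm (1 : G)).contMDiffAt htar
  have h1 : χ.symm (χ 1) = 1 := extChartAt_to_inv (I := 𝓘(ℝ, E)) (1 : G)
  set F : E → E →L[ℝ] E := fun x => mder 𝓘(ℝ, E) 𝓘(ℝ, E) χ (χ.symm x) ∘L leftTriv (χ.symm x)
  have hFs : ContDiffAt ℝ 1 F (χ 1) := by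
    refine (contMDiffAt_iff_contDiffAt.1 ?_ : ContDiffAt ℝ ∞ F (χ 1)).of_le (by simp)
    exact ContMDiffAt.comp_of_eq (f := χ.symm) (contMDiffAt_mder_comp_leftTriv hχ) hχs h1
  obtain ⟨K, s, hs, hK⟩ := hFs.exists_lipschitzOnWith
  obtain ⟨F', hF', hFF'⟩ := hK.extend_finite_dimension
  obtain ⟨r, hr, hball⟩ := Metric.mem_nhds_iff.1 (Filter.inter_mem hs htar)
  obtain ⟨C, hC, δ, hδ, hsol⟩ := exists_solution_of_lipschitzWith hF' (χ 1)
  -- The bound `r / (C + 1)` keeps the solution in the ball of radius `r` about `χ 1`, inside both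
  -- the Lipschitz set and the target of the chart.
  refine ⟨C, hC, min δ (r / (C + 1)), by positivity, fun u hu => ?_⟩
  obtain ⟨x, hx, hx1, hx2⟩ := hsol u (hu.trans_le (min_le_left _ _))
  have hxt : ∀ t, ‖x t - χ 1‖ ≤ C * ‖u‖ := fun t => ((x - _).norm_coe_le_norm t).trans hx1
  have hmem : ∀ t, x t ∈ s ∩ χ.target := fun t => hball (by
    rw [mem_ball_iff_norm]
    refine (hxt t).trans_lt ?_
    have := hu.trans_le (min_le_right _ _)
    rw [lt_div_iff₀ (by positivity)] at this
    nlinarith [norm_nonneg u])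
  have hFx : ∀ t, F' (x t) = F (x t) := fun t => (hFF' (hmem t).1).symm
  have hxt' : ∀ t, x t = χ 1 + primitiveL (mulOp (x.comp F' hF') u) t := fun t =>
    DFunLike.congr_fun hx t
  have hx0 : x 0 = χ 1 := by rw [hxt', primitiveL_zero_right, add_zero]
  have hprim : IsPrimitive x (fun t => F (x t) (u t)) 0 1 := by
    refine (isPrimitive_const_add_primitiveL (χ 1) (mulOp (x.comp F' hF') u)).congr
      (fun t _ => (hxt' t).symm) ?_ zero_le_one
    filter_upwards [coeFn_mulOp (x.comp F' hF') u] with t ht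
    rw [ht, ← hFx]
    rfl
  refine ⟨fun t => χ.symm (x t), ⟨?_, fun f hf => ?_, Lp.memLp u⟩, ?_, x 1, (hmem 1).2, rfl, hxt 1,
    ?_⟩
  · exact (continuousOn_extChartAt_symm (1 : G)).comp x.continuous.continuousOn
      fun t _ => (hmem t).2
  · have hsm : ∀ t, ContMDiffAt 𝓘(ℝ, E) 𝓘(ℝ, ℝ) ∞ (fun y => f (χ.symm y)) (x t) := fun t =>
      hf.contMDiffAt.comp _ ((contMDiffOn_extChartAt_symm (1 : G)).contMDiffAt
        (extChartAt_target_mem_nhds' (hmem t).2))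
    refine (hprim.comp zero_le_one (F := fun y => f (χ.symm y)) fun t _ =>
      (contMDiffAt_iff_contDiffAt.1 (hsm t)).of_le (by simp)).congr (fun _ _ => rfl)
      (Filter.Eventually.of_forall fun t => ?_) zero_le_one
    have hsrc : χ.symm (x t) ∈ χ.source := χ.map_target (hmem t).2
    have hχt : HasMD 𝓘(ℝ, E) 𝓘(ℝ, E) χ (χ.symm (x t)) _ :=
      (contMDiffAt_extChartAt' (by rwa [extChartAt_source] at hsrc) : ContMDiffAt 𝓘(ℝ, E) 𝓘(ℝ, E) ∞ χ _).hasMD (by simp)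
    have h3 := ((hsm t).hasMD (by simp)).comp_of_eq hχt (χ.right_inv (hmem t).2)
    have h4 : f =ᶠ[𝓝 (χ.symm (x t))] fun y => f (χ.symm (χ y)) := by
      filter_upwards [extChartAt_source_mem_nhds' hsrc] with y hy
      exact congrArg f (χ.left_inv hy).symm
    simp only [← mder_eq_fderiv]
    rw [h4.mder_eq, h3.mder_eq]
    rfl
  · simp only [hx0, h1]
  · have h5 : F' (χ 1) = mder 𝓘(ℝ, E) 𝓘(ℝ, E) χ 1 := by
      rw [← hx0, hFx, hx0]
      simp only [F, h1, leftTriv_one]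
      rfl
    have h6 : primitiveL (mulOp (BoundedContinuousFunction.const ℝ (F' (χ 1))) u) 1 =
        mder 𝓘(ℝ, E) 𝓘(ℝ, E) χ 1 (integralL E u) := by
      rw [← h5, integralL_apply, primitiveL_apply, primitiveL_apply,
        ← ContinuousLinearMap.intervalIntegral_comp_comm _ (intervalIntegrable_pathSpace u 0 1)]
      exact intervalIntegral.integral_congr_ae ((coeFn_mulOp _ u).mono fun t ht _ => ht)
    rw [← h6]
    exact ((x - _ - _ : ℝ →ᵇ E).norm_coe_le_norm 1).trans hx2

variable [T2Space G]

theorem IsDev.eqOn_const {g : ℝ → G} {u : ℝ → E} (hg : IsDev g u) {s : ℝ} (hs : s ≤ 1)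
    (hu : ∀ t < s, u t = 0) : ∀ t ∈ Icc 0 s, g t = g 0 := by
  intro t ht
  by_contra hne
  obtain ⟨f, hf, hfne⟩ := exists_contMDiff_separating (E := E) hne
  refine hfne ?_
  rw [(hg.isPrimitive f hf).eq t ⟨ht.1, ht.2.trans hs⟩, add_eq_left]
  rw [intervalIntegral.integral_of_le ht.1, integral_Ioc_eq_integral_Ioo]
  refine setIntegral_eq_zero_of_forall_eq_zero fun τ hτ => ?_
  rw [hu τ (hτ.2.trans_le ht.2), map_zero, map_zero]

variable (G) in
-- By absolute continuity of the integral, `u` has small norm on every interval of some length `h`.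
-- The solutions for these pieces exist by the local result and are multiplied together one after
-- the other.
theorem exists_isDev (u : PathSpace E) : ∃ g : ℝ → G, IsDev g u ∧ g 0 = 1 := by
  obtain ⟨C, -, δ, hδ, hsol⟩ := exists_isDev_of_norm_lt (E := E) G
  obtain ⟨h, hh, hsmall⟩ := (Lp.memLp u).eLpNorm_indicator_le (by norm_num) (by norm_num)
    (half_pos hδ)
  have key : ∀ k : ℕ, ∃ g : ℝ → G, IsDev g ((Iio (k * h)).indicator u) ∧ g 0 = 1 := by
    intro k
    induction k with
    | zero =>
      refine ⟨fun _ => 1, (isDev_const 1).congr (fun _ _ => rfl) ?_, rfl⟩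
      filter_upwards [ae_restrict_mem measurableSet_Icc] with t ht
      rw [indicator_of_notMem]
      · rfl
      · simpa using ht.1
    | succ k ih =>
      obtain ⟨g₁, hg₁, hg₁0⟩ := ih
      -- Once the truncation time exceeds `1`, it no longer affects `u` on `[0,1]`.
      by_cases hk : 1 < k * h
      · refine ⟨g₁, hg₁.congr (fun _ _ => rfl) ?_, hg₁0⟩
        filter_upwards [ae_restrict_mem measurableSet_Icc] with t ht
        rw [indicator_of_mem, indicator_of_mem]
        · simp only [mem_Iio, Nat.cast_add, Nat.cast_one]; nlinarith [ht.2]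
        · exact ht.2.trans_lt hk
      set S := Ico (k * h) ((k + 1) * h)
      have hS : MemLp (S.indicator u) 2 (volume.restrict (Icc (0 : ℝ) 1)) :=
        (Lp.memLp u).indicator measurableSet_Ico
      have hn : ‖hS.toLp‖ < δ := by
        rw [Lp.norm_toLp]
        refine lt_of_le_of_lt (ENNReal.toReal_le_of_le_ofReal (half_pos hδ).le
          (hsmall S measurableSet_Ico ?_)) (half_lt_self hδ)
        refine (Measure.restrict_apply_le _ _).trans ?_
        rw [Real.volume_Ico]
        exact le_of_eq (by ring_nf)
      obtain ⟨g₂, hg₂, hg₂0, -⟩ := hsol _ hn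
      have hg₂' := hg₂.congr (fun _ _ => rfl) hS.coeFn_toLp
      -- `g₂` stays at `1` up to time `k h`, so in the logarithmic derivative `Ad(g₂⁻¹) u₁ + u₂` of
      -- the product the conjugation is trivial where `u₁` lives.
      have hconst := hg₂'.eqOn_const (not_lt.1 hk) fun t ht =>
        indicator_of_notMem (fun h' => ht.not_ge h'.1) _
      refine ⟨_, (hg₁.mul hg₂').congr (fun _ _ => rfl) ?_, by simp [hg₁0, hg₂0]⟩
      filter_upwards [ae_restrict_mem measurableSet_Icc] with t ht
      push_cast
      rcases lt_or_ge t (k * h) with h1 | h1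
      · rw [hconst t ⟨ht.1, h1.le⟩, hg₂0, inv_one, Ad_one, indicator_of_mem (s := Iio (k * h)) h1,
          indicator_of_notMem (s := S) fun h' => h1.not_ge h'.1, indicator_of_mem, add_zero]
        · rfl
        · simp only [mem_Iio]; nlinarith
      · rw [indicator_of_notMem (s := Iio (k * h)) (by simpa using h1), map_zero, zero_add]
        by_cases h2 : t < (k + 1) * h
        · rw [indicator_of_mem (s := S) ⟨h1, h2⟩, indicator_of_mem (s := Iio _) h2]
        · rw [indicator_of_notMem (s := S) fun h' => h2 h'.2,
            indicator_of_notMem (s := Iio _) h2]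
  obtain ⟨k, hk⟩ := exists_nat_gt (1 / h)
  obtain ⟨g, hg, hg0⟩ := key k
  refine ⟨g, hg.congr (fun _ _ => rfl) ?_, hg0⟩
  filter_upwards [ae_restrict_mem measurableSet_Icc] with t ht
  rw [indicator_of_mem]
  rw [div_lt_iff₀ hh] at hk
  exact ht.2.trans_lt hk

end Existence

/-! ### Smoothness of the parallel transport map -/

open scoped BoundedContinuousFunction

/-- Near `0` the operator `1 - T u` is invertible, so the equation forces `a u = (1 - T u)⁻¹ b`, and
inversion is smooth. No regularity of `a` is needed beforehand. -/
theorem contDiffAt_of_eq_add_apply {V B : Type*} [NormedAddCommGroup V] [NormedSpace ℝ V]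
    [NormedAddCommGroup B] [NormedSpace ℝ B] [CompleteSpace B] (T : V →L[ℝ] B →L[ℝ] B)
    {a : V → B} {b : B} (ha : ∀ u, a u = b + T u (a u)) : ContDiffAt ℝ ∞ a 0 := by
  have h1 : ContDiffAt ℝ ∞ (fun u => Ring.inverse (1 - T u) b) 0 := by
    have h2 : ContDiffAt ℝ ∞ (Ring.inverse : (B →L[ℝ] B) → _) (1 - T 0) := by
      rw [map_zero, sub_zero]
      exact contDiffAt_ringInverse ℝ 1
    exact (ContDiffAt.comp (0 : V) h2 (contDiffAt_const.sub T.contDiff.contDiffAt)).clm_apply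
      contDiffAt_const
  refine h1.congr_of_eventuallyEq ?_
  have hcont : Filter.Tendsto (fun u => 1 - T u) (𝓝 0) (𝓝 (1 - T 0)) :=
    (continuous_const.sub T.continuous).continuousAt
  have hunits : ∀ᶠ u in 𝓝 0, IsUnit (1 - T u) := by
    refine hcont.eventually (Units.isOpen.mem_nhds ?_)
    rw [map_zero, sub_zero]
    exact isUnit_one
  filter_upwards [hunits] with u hu
  have h3 : (1 - T u) (a u) = b := by
    change a u - T u (a u) = b
    exact sub_eq_of_eq_add (ha u)
  rw [← h3]
  change _ = (Ring.inverse (1 - T u) * (1 - T u)) (a u)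
  rw [Ring.inverse_mul_cancel _ hu]
  rfl

section Transport

variable {E : Type*} [NormedAddCommGroup E] [NormedSpace ℝ E]
  {G : Type*} [TopologicalSpace G] [ChartedSpace E G] [Group G]

variable (G) in
/-- The path in `G` that starts at `1` and has left logarithmic derivative `u`. -/
def development (u : PathSpace E) : ℝ → G := Classical.epsilon fun g => IsDevelopment u g

theorem development_one (u : PathSpace E) : development G u 1 = parallelTransport G u := rfl

/-- The bilinear map `(A, u) ↦ A (ad u)`. -/
def pairAd (G : Type*) [TopologicalSpace G] [ChartedSpace E G] [Group G] :
    (ℝ →ᵇ (E →L[ℝ] E)) →L[ℝ] PathSpace E →L[ℝ] PathSpace (E →L[ℝ] E) :=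
  pairL ((ContinuousLinearMap.compL ℝ E E E).flip.comp (adL G)).flip

theorem coeFn_pairAd (A : ℝ →ᵇ (E →L[ℝ] E)) (u : PathSpace E) :
    pairAd G A u =ᵐ[volume.restrict (Icc (0 : ℝ) 1)] fun t => A t ∘L adL G (u t) :=
  coeFn_pairL _ A u

variable (G) in
/-- The Volterra operators `A ↦ ∫ A (ad u)`. -/
def volterraAd : PathSpace E →L[ℝ] (ℝ →ᵇ (E →L[ℝ] E)) →L[ℝ] (ℝ →ᵇ (E →L[ℝ] E)) :=
  (ContinuousLinearMap.compL ℝ (ℝ →ᵇ (E →L[ℝ] E)) _ _ primitiveL).comp (pairAd G).flip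

variable [LieGroup 𝓘(ℝ, E) ∞ G] [FiniteDimensional ℝ E] [T2Space G]

theorem isDev_development (u : PathSpace E) : IsDev (development G u) u ∧ development G u 0 = 1 := by
  obtain ⟨g, hg⟩ := exists_isDev G u
  exact isDevelopment_iff.1 (Classical.epsilon_spec (p := fun g : ℝ → G => IsDevelopment u g)
    ⟨g, isDevelopment_iff.2 hg⟩)

theorem development_zero_right (u : PathSpace E) : development G u 0 = 1 := (isDev_development u).2

theorem IsDev.eqOn_development {g : ℝ → G} {u : PathSpace E} {w : ℝ → E} (hg : IsDev g w)
    (hw : w =ᵐ[volume.restrict (Icc (0 : ℝ) 1)] u) (h0 : g 0 = 1) :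
    EqOn g (development G u) (Icc 0 1) :=
  hg.unique (isDev_development u).1 hw (h0.trans (development_zero_right u).symm)

theorem continuousOn_Ad_development (u : PathSpace E) :
    ContinuousOn (fun t => (Ad (development G u t) : E →L[ℝ] E)) (Icc 0 1) :=
  contDiff_Ad_comp_continuousOn (isDev_development u).1.continuousOn

theorem continuousOn_Ad_inv_development (u : PathSpace E) :
    ContinuousOn (fun t => (Ad (development G u t)⁻¹ : E →L[ℝ] E)) (Icc 0 1) :=
  contDiff_Ad_comp_continuousOn (isDev_development u).1.inv.continuousOn

variable (G) in
/-- The path `Ad g_u` of operators. -/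
def adTransport (u : PathSpace E) : ℝ →ᵇ (E →L[ℝ] E) := clampBCF _ (continuousOn_Ad_development (G := G) u)

variable (G) in
/-- The path `Ad g_u⁻¹` of operators. -/
def adTransportInv (u : PathSpace E) : ℝ →ᵇ (E →L[ℝ] E) :=
  clampBCF _ (continuousOn_Ad_inv_development (G := G) u)

theorem adTransport_apply (u : PathSpace E) {t : ℝ} (ht : t ∈ Icc (0 : ℝ) 1) :
    adTransport G u t = Ad (development G u t) :=
  clampPath_of_mem (fun t => (Ad (development G u t) : E →L[ℝ] E)) ht

theorem adTransportInv_apply (u : PathSpace E) {t : ℝ} (ht : t ∈ Icc (0 : ℝ) 1) :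
    adTransportInv G u t = Ad (development G u t)⁻¹ :=
  clampPath_of_mem (fun t => (Ad (development G u t)⁻¹ : E →L[ℝ] E)) ht

theorem adTransport_one (u : PathSpace E) : adTransport G u 1 = Ad (parallelTransport G u) :=
  adTransport_apply u (right_mem_Icc.2 zero_le_one)

theorem adTransport_mul_inv (u : PathSpace E) : adTransport G u * adTransportInv G u = 1 := by
  ext1 t
  exact Ad_comp_inv (development G u _)

theorem adTransportInv_mul (u : PathSpace E) : adTransportInv G u * adTransport G u = 1 := by
  ext1 t
  exact Ad_inv_comp (development G u _)

theorem ringInverse_adTransport (u : PathSpace E) :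
    Ring.inverse (adTransport G u) = adTransportInv G u :=
  Ring.inverse_unit (⟨adTransport G u, adTransportInv G u, adTransport_mul_inv u,
    adTransportInv_mul u⟩ : (ℝ →ᵇ (E →L[ℝ] E))ˣ)

theorem isUnit_adTransport (u : PathSpace E) : IsUnit (adTransport G u) :=
  ⟨⟨adTransport G u, adTransportInv G u, adTransport_mul_inv u, adTransportInv_mul u⟩, rfl⟩

/-- The differential equation for `Ad g_u`. -/
theorem adTransport_eq (u : PathSpace E) :
    adTransport G u = 1 + volterraAd G u (adTransport G u) := by
  have h := (isDev_development (G := G) u).1.isPrimitive_vector contMDiff_Ad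
  simp only [hasMD_Ad] at h
  have h2 := primitiveL_eq_of_isPrimitive (v := pairAd G (adTransport G u) u) h (by
    filter_upwards [coeFn_pairAd (G := G) (adTransport G u) u, ae_restrict_mem measurableSet_Icc]
      with t ht ht'
    rw [ht, adTransport_apply u ht'])
  ext1 t
  refine (h2 t).trans ?_
  rw [development_zero_right, Ad_one]
  rfl

theorem coeFn_mulOp_adTransport (u v : PathSpace E) :
    mulOp (adTransport G u) v =ᵐ[volume.restrict (Icc (0 : ℝ) 1)]
      fun t => Ad (development G u t) (v t) := by
  filter_upwards [coeFn_mulOp (adTransport G u) v, ae_restrict_mem measurableSet_Icc]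
    with t ht ht'
  rw [ht, adTransport_apply u ht']

/-- With `w = Ad(g_u) v`, the product `g_w g_u` has logarithmic derivative `Ad(g_u)⁻¹ w + u = u +
v`, and developments are unique. This reduces the study of `Φ` and `Ad(g_u)` near `u` to the origin.
-/
theorem development_add (u v : PathSpace E) {t : ℝ} (ht : t ∈ Icc (0 : ℝ) 1) :
    development G (u + v) t =
      development G (mulOp (adTransport G u) v) t * development G u t := by
  symm
  refine ((isDev_development (mulOp (adTransport G u) v)).1.mul
    (isDev_development u).1).eqOn_development ?_ (by simp [development_zero_right]) ht
  filter_upwards [coeFn_mulOp_adTransport (G := G) u v, Lp.coeFn_add u v] with t h1 h2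
  rw [h1, h2, Pi.add_apply, add_comm]
  congr 1
  exact DFunLike.congr_fun (Ad_inv_comp (E := E) (development G u t)) (v t)

theorem parallelTransport_add (u v : PathSpace E) : parallelTransport G (u + v) =
    parallelTransport G (mulOp (adTransport G u) v) * parallelTransport G u :=
  development_add u v (right_mem_Icc.2 zero_le_one)

theorem adTransport_add (u v : PathSpace E) : adTransport G (u + v) =
    adTransport G (mulOp (adTransport G u) v) * adTransport G u := by
  ext1 t
  change Ad (development G (u + v) (projIcc (0 : ℝ) 1 zero_le_one t)) = _
  rw [development_add u v (projIcc (0 : ℝ) 1 zero_le_one t).2, Ad_mul]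
  rfl

theorem development_zero {t : ℝ} (ht : t ∈ Icc (0 : ℝ) 1) :
    development G (0 : PathSpace E) t = 1 :=
  ((isDev_const (E := E) (1 : G)).eqOn_development (Lp.coeFn_zero E 2 _).symm rfl ht).symm

theorem parallelTransport_zero : parallelTransport G (0 : PathSpace E) = 1 :=
  development_zero (right_mem_Icc.2 zero_le_one)

theorem adTransport_zero : adTransport G (0 : PathSpace E) = 1 := by
  ext1 t
  change Ad (development G 0 (projIcc (0 : ℝ) 1 zero_le_one t)) = _
  rw [development_zero (projIcc (0 : ℝ) 1 zero_le_one t).2, Ad_one]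
  rfl

theorem contDiffAt_adTransport_zero : ContDiffAt ℝ ∞ (adTransport G : PathSpace E → _) 0 :=
  have : CompleteSpace E := FiniteDimensional.complete ℝ E
  contDiffAt_of_eq_add_apply (B := ℝ →ᵇ (E →L[ℝ] E)) (volterraAd G) (b := 1)
    fun u => adTransport_eq u

theorem adTransport_eq_mul (u₀ u : PathSpace E) : adTransport G u =
    adTransport G (mulOp (adTransport G u₀) (u - u₀)) * adTransport G u₀ := by
  rw [← adTransport_add, add_sub_cancel]

theorem contDiff_adTransport : ContDiff ℝ ∞ (adTransport G : PathSpace E → _) := by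
  refine contDiff_iff_contDiffAt.2 fun u₀ => ?_
  have h1 : ContDiffAt ℝ ∞ (fun u : PathSpace E =>
      adTransport G (mulOp (adTransport G u₀) (u - u₀))) u₀ := by
    refine ContDiffAt.comp u₀ (g := adTransport G) ?_
      ((mulOp (adTransport G u₀)).contDiff.contDiffAt.comp u₀ (contDiffAt_id.sub contDiffAt_const))
    simp only [sub_self, map_zero]
    exact contDiffAt_adTransport_zero
  have h2 := ContDiffAt.mul (𝔸 := ℝ →ᵇ (E →L[ℝ] E)) h1 (contDiffAt_const (c := adTransport G u₀))
  rwa [← show adTransport G = _ from funext (adTransport_eq_mul (G := G) u₀)] at h2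

theorem contDiff_adTransportInv : ContDiff ℝ ∞ (adTransportInv G : PathSpace E → _) := by
  have : CompleteSpace E := FiniteDimensional.complete ℝ E
  rw [← show (fun u : PathSpace E => Ring.inverse (adTransport G u)) = adTransportInv G from
    funext ringInverse_adTransport]
  refine contDiff_iff_contDiffAt.2 fun u => ?_
  refine ContDiffAt.comp u (g := Ring.inverse) ?_ contDiff_adTransport.contDiffAt
  exact contDiffAt_ringInverse ℝ (isUnit_adTransport u).unit

/-- Differentiate the Volterra equation at `0`: the term that contains the unknown derivative is
multiplied by `T_0 = 0`. -/
theorem hasFDerivAt_adTransport_zero :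
    HasFDerivAt (adTransport G : PathSpace E → _) ((volterraAd G).flip 1) 0 := by
  have h1 : HasFDerivAt (adTransport G : PathSpace E → _) _ 0 :=
    (contDiff_adTransport.differentiable (by simp)).differentiableAt.hasFDerivAt
  have h2 := ((volterraAd (E := E) G).hasFDerivAt.clm_apply h1).const_add 1
  have h3 : (fun u => 1 + volterraAd G u (adTransport G u)) = (adTransport G : PathSpace E → _) :=
    funext fun u => (adTransport_eq u).symm
  rw [h3, adTransport_zero, map_zero, ContinuousLinearMap.zero_comp, zero_add] at h2
  exact h2

theorem hasFDerivAt_adTransport (u : PathSpace E) :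
    HasFDerivAt (adTransport G : PathSpace E → _)
      (((ContinuousLinearMap.mul ℝ (ℝ →ᵇ (E →L[ℝ] E))).flip (adTransport G u)).comp
        (((volterraAd G).flip 1).comp (mulOp (adTransport G u)))) u := by
  have h0 : HasFDerivAt (fun v : PathSpace E => mulOp (adTransport G u) (v - u))
      (mulOp (adTransport G u)) u :=
    (mulOp (adTransport G u)).hasFDerivAt.comp u ((hasFDerivAt_id u).sub_const u)
  have h1 := HasFDerivAt.comp u (g := (adTransport G : PathSpace E → _))
    (by simpa using hasFDerivAt_adTransport_zero (G := G)) h0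
  have h2 := ((ContinuousLinearMap.mul ℝ (ℝ →ᵇ (E →L[ℝ] E))).flip
    (adTransport G u)).hasFDerivAt.comp u h1
  refine h2.congr_of_eventuallyEq (Filter.Eventually.of_forall fun v => ?_)
  exact adTransport_eq_mul u v

/-- From `d(A⁻¹) = -A⁻¹ dA A⁻¹`, where `dA` has `A` as its right factor and this cancels `A⁻¹`. What
remains is a multiplication operator after a primitive, the form on which compactness rests. -/
theorem hasFDerivAt_adTransportInv (u : PathSpace E) :
    HasFDerivAt (adTransportInv G : PathSpace E → _)
      (-((ContinuousLinearMap.mul ℝ (ℝ →ᵇ (E →L[ℝ] E))) (adTransportInv G u)).comp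
        (((volterraAd G).flip 1).comp (mulOp (adTransport G u)))) u := by
  have : CompleteSpace E := FiniteDimensional.complete ℝ E
  have h1 := (hasFDerivAt_ringInverse (𝕜 := ℝ) (isUnit_adTransport (G := G) u).unit).comp u
    (hasFDerivAt_adTransport u)
  have h2 : (Ring.inverse ∘ adTransport G : PathSpace E → _) = adTransportInv G :=
    funext ringInverse_adTransport
  rw [h2] at h1
  refine h1.congr_fderiv ?_
  have h3 : (↑(isUnit_adTransport (G := G) u).unit⁻¹ : ℝ →ᵇ (E →L[ℝ] E)) = adTransportInv G u := by
    rw [← Ring.inverse_unit, IsUnit.unit_spec, ringInverse_adTransport]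
  ext1 v
  simp only [h3]
  change -(adTransportInv G u * (_ * adTransport G u) * adTransportInv G u) =
    -(adTransportInv G u * _)
  rw [mul_assoc, mul_assoc, adTransport_mul_inv, mul_one]

/-- The quadratic error bound of the local existence theorem is Fréchet differentiability at `0` in
the chart, with derivative `dχ ∘ ∫`; composing with the inverse chart removes `dχ`. -/
theorem hasMD_parallelTransport_zero : HasMD 𝓘(ℝ, PathSpace E) 𝓘(ℝ, E)
    (parallelTransport G : PathSpace E → G) 0 (integralL E) := by
  obtain ⟨C, hC, δ, hδ, hsol⟩ := exists_isDev_of_norm_lt (E := E) G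
  set χ := extChartAt 𝓘(ℝ, E) (1 : G)
  have hχ : HasMD 𝓘(ℝ, E) 𝓘(ℝ, E) χ (1 : G) _ := contMDiffAt_extChartAt.hasMD (n := ∞) (by simp)
  have htar : χ.target ∈ 𝓝 (χ 1) := extChartAt_target_mem_nhds (I := 𝓘(ℝ, E)) (1 : G)
  have hχs : ContMDiffAt 𝓘(ℝ, E) 𝓘(ℝ, E) ∞ χ.symm (χ 1) :=
    (contMDiffOn_extChartAt_symm (1 : G)).contMDiffAt htar
  have h1 : χ.symm (χ 1) = 1 := extChartAt_to_inv (I := 𝓘(ℝ, E)) (1 : G)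
  choose! g hg hg0 y hyt hgy hy1 hy2 using hsol
  have hΦ : ∀ u : PathSpace E, ‖u‖ < δ → parallelTransport G u = χ.symm (y u) := fun u hu => by
    rw [← hgy u hu]
    exact ((hg u hu).eqOn_development (Filter.EventuallyEq.refl _ _) (hg0 u hu)
      (right_mem_Icc.2 zero_le_one)).symm
  have hy0 : y 0 = χ 1 := by
    have := hy1 0 (by simpa using hδ)
    rwa [norm_zero, mul_zero, norm_le_zero_iff, sub_eq_zero] at this
  have hyd : HasFDerivAt y (mder 𝓘(ℝ, E) 𝓘(ℝ, E) χ 1 ∘L integralL E) 0 := by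
    refine HasFDerivAt.of_isLittleO ?_
    refine Asymptotics.IsBigO.trans_isLittleO (g := fun u : PathSpace E => ‖u‖ ^ 2) ?_ ?_
    · refine Asymptotics.IsBigO.of_bound C ?_
      filter_upwards [Metric.ball_mem_nhds (0 : PathSpace E) hδ] with u hu
      rw [mem_ball_zero_iff] at hu
      have := hy2 u hu
      rw [hy0, sub_zero]
      simpa using this
    · have := Asymptotics.isLittleO_norm_pow_id (E' := PathSpace E) one_lt_two
      simpa using this
  have h2 : HasMD 𝓘(ℝ, E) 𝓘(ℝ, E) χ.symm (y 0) _ := hy0 ▸ hχs.hasMD (by simp)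
  have h3 := h2.comp (hasMD_iff_hasFDerivAt.2 hyd)
  have h4 : parallelTransport G =ᶠ[𝓝 (0 : PathSpace E)] fun u => χ.symm (y u) := by
    filter_upwards [Metric.ball_mem_nhds (0 : PathSpace E) hδ] with u hu
    exact hΦ u (mem_ball_zero_iff.1 hu)
  refine (h3.congr h4).congr_deriv ?_
  have h5 := (h2.comp_of_eq hχ hy0.symm).unique (hasMD_id.congr (by
    filter_upwards [extChartAt_source_mem_nhds (I := 𝓘(ℝ, E)) (1 : G)] with z hz
    exact χ.left_inv hz))
  rw [← ContinuousLinearMap.comp_assoc, h5, ContinuousLinearMap.id_comp]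

variable (G) in
/-- The right logarithmic derivative of the parallel transport map. -/
def transportForm (u : PathSpace E) : PathSpace E →L[ℝ] E :=
  (integralL E).comp (mulOp (adTransport G u))

/-- Differentiate `Φ(v) = Φ(Ad(g_u) (v - u)) Φ(u)` at `v = u`. -/
theorem hasMD_parallelTransport_right (u : PathSpace E) : HasMD 𝓘(ℝ, PathSpace E) 𝓘(ℝ, E)
    (parallelTransport G : PathSpace E → G) u
      (rightTriv (parallelTransport G u) ∘L transportForm G u) := by
  have h0 : HasMD 𝓘(ℝ, PathSpace E) 𝓘(ℝ, PathSpace E)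
      (fun v : PathSpace E => mulOp (adTransport G u) (v - u)) u (mulOp (adTransport G u)) :=
    hasMD_iff_hasFDerivAt.2
      ((mulOp (adTransport G u)).hasFDerivAt.comp u ((hasFDerivAt_id u).sub_const u))
  have h1 := (hasMD_parallelTransport_zero (G := G)).comp_of_eq h0 (by simp)
  have h2 := (hasMD_rightTriv (E := E) (parallelTransport G u)).comp_of_eq h1
    (by simp [parallelTransport_zero])
  refine (h2.congr (Filter.Eventually.of_forall fun v => ?_))
  change _ = parallelTransport G _ * parallelTransport G u
  rw [← parallelTransport_add, add_sub_cancel]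

theorem contDiff_transportForm : ContDiff ℝ ∞ (transportForm G : PathSpace E → _) :=
  have h : ContDiff ℝ ∞ fun u : PathSpace E => mulOp (adTransport G u) :=
    (mulOp (X := E) (Y := E)).contDiff.comp contDiff_adTransport
  contDiff_const.clm_comp h

/-- In a chart the derivative of `Φ` is `R(Φ u) ∘ transportForm u` with `R` and `transportForm`
smooth. Hence if `Φ` is `C^n`, so is its derivative, and `Φ` is `C^(n+1)`. -/
theorem contMDiff_parallelTransport :
    ContMDiff 𝓘(ℝ, PathSpace E) 𝓘(ℝ, E) ∞ (parallelTransport G : PathSpace E → G) := by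
  have hcont : Continuous (parallelTransport G : PathSpace E → G) :=
    continuous_iff_continuousAt.2 fun u =>
      (hasMD_parallelTransport_right u).mdifferentiableAt.continuousAt
  suffices h : ∀ n : ℕ, ContMDiff 𝓘(ℝ, PathSpace E) 𝓘(ℝ, E) n
      (parallelTransport G : PathSpace E → G) from contMDiff_infty.2 h
  intro n
  induction n with
  | zero => exact contMDiff_zero_iff.2 hcont
  | succ n ih =>
    intro u₀
    set χ := extChartAt 𝓘(ℝ, E) (parallelTransport G u₀)
    set R : G → E →L[ℝ] E := fun a => mder 𝓘(ℝ, E) 𝓘(ℝ, E) χ a ∘L rightTriv a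
    have hR : ContMDiffAt 𝓘(ℝ, E) 𝓘(ℝ, E →L[ℝ] E) ∞ R (parallelTransport G u₀) := by
      have hχ : ContMDiffAt 𝓘(ℝ, E) 𝓘(ℝ, E) ∞ χ (parallelTransport G u₀) := contMDiffAt_extChartAt
      have h1 := (contMDiffAt_mder_comp_leftTriv hχ).clm_comp
        ((contMDiff_Ad (E := E)).comp (contMDiff_inv 𝓘(ℝ, E) ∞)).contMDiffAt
      refine h1.congr_of_eventuallyEq (Filter.Eventually.of_forall fun a => ?_)
      simp only [R, rightTriv_eq]
      rfl
    have hsrc : ∀ᶠ u in 𝓝 u₀, parallelTransport G u ∈ χ.source :=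
      hcont.continuousAt.eventually (extChartAt_source_mem_nhds (I := 𝓘(ℝ, E)) _)
    have hd : ContDiffAt ℝ (n + 1) (fun u => χ (parallelTransport G u)) u₀ := by
      rw [contDiffAt_succ_iff_hasFDerivAt]
      refine ⟨fun u => R (parallelTransport G u) ∘L transportForm G u, ⟨_, hsrc, fun u hu => ?_⟩, ?_⟩
      · rw [← hasMD_iff_hasFDerivAt]
        have hχu : HasMD 𝓘(ℝ, E) 𝓘(ℝ, E) χ (parallelTransport G u) _ :=
          (contMDiffAt_extChartAt' (n := ∞) (by
            have : parallelTransport G u ∈ χ.source := hu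
            rwa [extChartAt_source] at this)).hasMD (by simp)
        exact hχu.comp (hasMD_parallelTransport_right u)
      · have h1 : ContMDiffAt 𝓘(ℝ, PathSpace E) 𝓘(ℝ, E →L[ℝ] E) n
            (fun u => R (parallelTransport G u)) u₀ :=
          (hR.of_le (by exact_mod_cast le_top)).comp u₀ (ih u₀)
        exact (contMDiffAt_iff_contDiffAt.1 h1).clm_comp
          ((contDiff_transportForm (E := E) (G := G)).contDiffAt.of_le (by exact_mod_cast le_top))
    have hχs : ContMDiffAt 𝓘(ℝ, E) 𝓘(ℝ, E) ∞ χ.symm (χ (parallelTransport G u₀)) :=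
      (contMDiffOn_extChartAt_symm _).contMDiffAt (extChartAt_target_mem_nhds (I := 𝓘(ℝ, E)) _)
    have h2 : ContMDiffAt 𝓘(ℝ, PathSpace E) 𝓘(ℝ, E) (n + 1)
        (fun u => χ.symm (χ (parallelTransport G u))) u₀ :=
      ContMDiffAt.comp (g := χ.symm) u₀ (hχs.of_le (by exact_mod_cast le_top)) hd.contMDiffAt
    refine h2.congr_of_eventuallyEq ?_
    filter_upwards [hsrc] with u hu
    exact (χ.left_inv hu).symm

variable (G) in
/-- The left logarithmic derivative of the parallel transport map. -/
def transportFormLeft (u : PathSpace E) : PathSpace E →L[ℝ] E :=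
  Ad (parallelTransport G u)⁻¹ ∘L transportForm G u

theorem hasMD_parallelTransport (u : PathSpace E) : HasMD 𝓘(ℝ, PathSpace E) 𝓘(ℝ, E)
    (parallelTransport G : PathSpace E → G) u
      (leftTriv (parallelTransport G u) ∘L transportFormLeft G u) := by
  refine (hasMD_parallelTransport_right u).congr_deriv ?_
  rw [rightTriv_eq]
  rfl

end Transport

/-! ### Submersions and one-parameter subgroups -/

section Submersions

variable {E : Type*} [NormedAddCommGroup E] [NormedSpace ℝ E]
  {M : Type*} [TopologicalSpace M] [ChartedSpace E M]
  {E' : Type*} [NormedAddCommGroup E'] [NormedSpace ℝ E']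
  {N : Type*} [TopologicalSpace N] [ChartedSpace E' N]

/-- A submersion has smooth local sections. -/
theorem Manifold.IsSubmersion.exists_section {f : M → N}
    (hf : IsSubmersion 𝓘(ℝ, E) 𝓘(ℝ, E') ∞ f) (x : M) :
    ∃ σ : N → M, ContMDiffAt 𝓘(ℝ, E') 𝓘(ℝ, E) ∞ σ (f x) ∧ σ (f x) = x ∧
      ∀ᶠ y in 𝓝 (f x), f (σ y) = y := by
  obtain ⟨F, _, _, h⟩ := hf
  replace h := h x
  set a := h.domChart
  set b := h.codChart
  set e := h.equiv
  have hxa : x ∈ a.source := h.mem_domChart_source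
  have hxb : f x ∈ b.source := h.mem_codChart_source
  have hw : ∀ z ∈ a.target, b (f (a.symm z)) = (e z).1 := fun z hz => by
    have hz' : z ∈ (a.extend 𝓘(ℝ, E)).target := by simpa using hz
    simpa using h.writtenInCharts hz'
  set τ : N → E := fun y => e.symm (b y, (e (a x)).2)
  have hτx : τ (f x) = a x := by
    have h1 := hw (a x) (a.map_source hxa)
    rw [a.left_inv hxa] at h1
    simp only [τ, h1, Prod.mk.eta, ContinuousLinearEquiv.symm_apply_apply]
  have hτ : ContMDiffAt 𝓘(ℝ, E') 𝓘(ℝ, E) ∞ τ (f x) := by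
    have h1 : ContMDiffAt 𝓘(ℝ, E') 𝓘(ℝ, E') ∞ b (f x) :=
      contMDiffAt_of_mem_maximalAtlas h.codChart_mem_maximalAtlas hxb
    have h2 : ContDiff ℝ ∞ fun z : E' => e.symm (z, (e (a x)).2) :=
      e.symm.contDiff.comp (contDiff_id.prodMk contDiff_const)
    exact h2.contMDiff.contMDiffAt.comp (f x) h1
  have ha : ContMDiffAt 𝓘(ℝ, E) 𝓘(ℝ, E) ∞ a.symm (τ (f x)) := by
    rw [hτx]
    exact contMDiffAt_symm_of_mem_maximalAtlas h.domChart_mem_maximalAtlas (a.map_source hxa)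
  refine ⟨fun y => a.symm (τ y), ha.comp (f x) hτ, by simp only [hτx, a.left_inv hxa], ?_⟩
  have h1 : ∀ᶠ y in 𝓝 (f x), τ y ∈ a.target :=
    hτ.continuousAt.eventually (by rw [hτx]; exact a.open_target.mem_nhds (a.map_source hxa))
  filter_upwards [h1, b.open_source.mem_nhds hxb] with y hy hyb
  have h2 := hw (τ y) hy
  simp only [τ, ContinuousLinearEquiv.apply_symm_apply] at h2
  exact b.injOn (h.source_subset_preimage_source (a.map_target hy)) hyb h2

variable [IsManifold 𝓘(ℝ, E) ∞ M] [IsManifold 𝓘(ℝ, E') ∞ N]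

theorem Manifold.IsSubmersion.mder_surjective {f : M → N}
    (hf : IsSubmersion 𝓘(ℝ, E) 𝓘(ℝ, E') ∞ f) (x : M) :
    Function.Surjective (mder 𝓘(ℝ, E) 𝓘(ℝ, E') f x) := by
  obtain ⟨σ, hσ, hσx, hfσ⟩ := hf.exists_section x
  have h1 := (hf.contMDiff.contMDiffAt.hasMD (by simp)).comp_of_eq (hσ.hasMD (by simp)) hσx
  have h2 := h1.unique (hasMD_id.congr hfσ)
  exact fun v => ⟨_, DFunLike.congr_fun h2 v⟩

end Submersions

/-! ### One-parameter subgroups as developments of constant paths -/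

section OneParameter

variable {E : Type*} [NormedAddCommGroup E] [NormedSpace ℝ E] [FiniteDimensional ℝ E]
  {G : Type*} [TopologicalSpace G] [ChartedSpace E G] [Group G] [LieGroup 𝓘(ℝ, E) ∞ G] [T2Space G]

variable (G) in
/-- Existence of one-parameter subgroups. -/
theorem exists_oneParameter (X : E) : ∃ γ : ℝ → G, ContMDiff 𝓘(ℝ, ℝ) 𝓘(ℝ, E) ∞ γ ∧
    (∀ s t, γ (s + t) = γ s * γ t) ∧ ∀ t, HasMD 𝓘(ℝ, ℝ) 𝓘(ℝ, E) γ t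
      ((1 : ℝ →L[ℝ] ℝ).smulRight (leftTriv (γ t) X)) := by
  have : CompleteSpace E := FiniteDimensional.complete ℝ E
  have : LieGroup 𝓘(ℝ, E) (minSmoothness ℝ 3) G := by
    rw [minSmoothness_of_isRCLikeNormedField]
    exact LieGroup.of_le (n := ∞) ENat.LEInfty.out
  have : IsManifold 𝓘(ℝ, E) 1 G := .of_le (n := ∞) (by simp)
  set v : ∀ a : G, TangentSpace 𝓘(ℝ, E) a := mulInvariantVectorField (I := 𝓘(ℝ, E)) (G := G) X
  have hv : ContMDiff 𝓘(ℝ, E) 𝓘(ℝ, E).tangent 1 (fun a => (⟨a, v a⟩ : TangentBundle 𝓘(ℝ, E) G)) := by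
    refine (contMDiff_mulInvariantVectorField (I := 𝓘(ℝ, E)) (G := G) X).of_le ?_
    rw [minSmoothness_of_isRCLikeNormedField]
    exact one_le_two
  have htrans : ∀ (a : G) (γ : ℝ → G) (t : ℝ), HasMD 𝓘(ℝ, ℝ) 𝓘(ℝ, E) γ t
      ((1 : ℝ →L[ℝ] ℝ).smulRight (leftTriv (γ t) X)) → HasMD 𝓘(ℝ, ℝ) 𝓘(ℝ, E) (fun s => a * γ s) t
      ((1 : ℝ →L[ℝ] ℝ).smulRight (leftTriv (a * γ t) X)) := fun a γ t h => by
    refine ((hasMD_mul_left (E := E) a (γ t)).comp h).congr_deriv ?_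
    ext
    simpa using DFunLike.congr_fun (mder_mul_left_comp_leftTriv (E := E) a (γ t)) X
  obtain ⟨γ₀, hγ₀, hγ₀'⟩ := exists_isMIntegralCurveAt_of_contMDiffAt_boundaryless (t₀ := 0)
    (x₀ := (1 : G)) hv.contMDiffAt
  obtain ⟨ε, hε, hball⟩ := Metric.eventually_nhds_iff_ball.1 hγ₀'
  rw [Real.ball_zero_eq_Ioo] at hball
  -- Left translates of one local integral curve of an invariant field are integral curves, so the
  -- time of existence is uniform and the curve extends to the whole line.
  have hloc : ∀ a : G, ∃ γ : ℝ → G, γ 0 = a ∧ IsMIntegralCurveOn γ v (Ioo (-ε) ε) := fun a =>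
    ⟨fun s => a * γ₀ s, by simp [hγ₀], fun t ht =>
      HasMFDerivAt.hasMFDerivWithinAt (htrans a γ₀ t (hball t ht))⟩
  obtain ⟨γ, hγ0, hγ⟩ := exists_isMIntegralCurve_of_isMIntegralCurveOn hv hε hloc 1
  have hγ' : ∀ t, HasMD 𝓘(ℝ, ℝ) 𝓘(ℝ, E) γ t
      ((1 : ℝ →L[ℝ] ℝ).smulRight (leftTriv (γ t) X)) := hγ
  have hadd : ∀ s t, γ (s + t) = γ s * γ t := fun s t => by
    have h1 : IsMIntegralCurve (fun t => γ s * γ t) v := fun t => htrans (γ s) γ t (hγ' t)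
    have h2 := isMIntegralCurve_Ioo_eq_of_contMDiff_boundaryless (t₀ := 0) hv (hγ.comp_add s) h1
      (by simp [hγ0])
    rw [add_comm]
    exact congrFun h2 t
  have hcont : Continuous γ := continuous_iff_continuousAt.2 fun t =>
    (hγ' t).mdifferentiableAt.continuousAt
  -- Smoothness of `γ` is inherited from `Φ`: the path `τ ↦ γ (t τ)` is the development of the
  -- constant path `t X`.
  have hΦ : ∀ t, γ t = parallelTransport G (constPath E (t • X)) := fun t => by
    have hdev : IsDev (fun τ => γ (t * τ)) fun _ => t • X := by
      refine ⟨(hcont.comp (continuous_const.mul continuous_id)).continuousOn, fun f hf => ?_,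
        memLp_const _⟩
      have hcd : Continuous fun τ => (mder 𝓘(ℝ, E) 𝓘(ℝ, ℝ) f (γ (t * τ)))
          (leftTriv (γ (t * τ)) (t • X)) := by
        have h1 : Continuous fun a : G => mder 𝓘(ℝ, E) 𝓘(ℝ, ℝ) f a ∘L leftTriv a :=
          continuous_iff_continuousAt.2 fun a =>
            (contMDiffAt_mder_comp_leftTriv (E := E) hf.contMDiffAt).continuousAt
        exact (h1.comp (hcont.comp (continuous_const.mul continuous_id))).clm_apply continuous_const
      refine ⟨hcd.intervalIntegrable 0 1, fun s hs => ?_⟩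
      have hderiv : ∀ τ : ℝ, HasDerivAt (fun τ => f (γ (t * τ))) ((mder 𝓘(ℝ, E) 𝓘(ℝ, ℝ) f (γ (t * τ)))
          (leftTriv (γ (t * τ)) (t • X))) τ := fun τ => by
        have h1 := (hf.contMDiffAt.hasMD (by simp)).comp (hγ' (t * τ))
        have h2 := (hasMD_iff_hasFDerivAt.1 h1).comp_hasDerivAt τ ((hasDerivAt_id τ).const_mul t)
        refine h2.congr_deriv ?_
        simp
      rw [intervalIntegral.integral_eq_sub_of_hasDerivAt (fun τ _ => hderiv τ)
        (hcd.intervalIntegrable 0 s)]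
      ring
    have h : γ (t * 1) = parallelTransport G (constPath E (t • X)) :=
      hdev.eqOn_development (coeFn_constPath (t • X)).symm (by simp [hγ0])
        (right_mem_Icc.2 zero_le_one)
    rwa [mul_one] at h
  refine ⟨γ, ?_, hadd, hγ'⟩
  rw [show γ = _ from funext hΦ]
  have h1 : ContDiff ℝ ∞ fun t : ℝ => constPath E (t • X) :=
    (constPath E).contDiff.comp (contDiff_id.smul contDiff_const)
  exact contMDiff_parallelTransport.comp h1.contMDiff

end OneParameter

/-! ### Coset manifolds -/

section Quotients

variable {E : Type*} [NormedAddCommGroup E] [NormedSpace ℝ E]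
  {G : Type*} [TopologicalSpace G] [ChartedSpace E G] [Group G] 
  {K : Subgroup G}
  {E' : Type*} [NormedAddCommGroup E'] [NormedSpace ℝ E'] [ChartedSpace E' (G ⧸ K)]

variable (E E' K) in
/-- The differential of the projection `G → G/K` in the left trivialization of `TG`. -/
def projL (a : G) : E →L[ℝ] E' :=
  mder 𝓘(ℝ, E) 𝓘(ℝ, E') (fun x : G => (x : G ⧸ K)) a ∘L leftTriv a

variable [LieGroup 𝓘(ℝ, E) ∞ G] [IsManifold 𝓘(ℝ, E') ∞ (G ⧸ K)]

/-- If `σ` is a local section of the submersion `G → G/K`, the translation is `y ↦ π(a σ(y))` near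
the given point. Only the submersion property characterizes the smooth structure here. -/
theorem contMDiff_smul_quotient (hπ : IsSubmersion 𝓘(ℝ, E) 𝓘(ℝ, E') ∞ (fun a : G => (a : G ⧸ K)))
    (a : G) : ContMDiff 𝓘(ℝ, E') 𝓘(ℝ, E') ∞ (fun x : G ⧸ K => a • x) := by
  intro x
  obtain ⟨b, rfl⟩ := QuotientGroup.mk_surjective x
  obtain ⟨σ, hσ, hσx, hσ'⟩ := hπ.exists_section b
  have h1 : ContMDiffAt 𝓘(ℝ, E') 𝓘(ℝ, E') ∞ (fun y => ((a * σ y : G) : G ⧸ K)) (b : G ⧸ K) :=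
    hπ.contMDiff.contMDiffAt.comp _
      ((contMDiff_mul_left (I := 𝓘(ℝ, E)) (n := ∞) (a := a)).contMDiffAt.comp _ hσ)
  refine h1.congr_of_eventuallyEq ?_
  filter_upwards [hσ'] with y hy
  conv_lhs => rw [← hy]
  rfl

variable (hπ : IsSubmersion 𝓘(ℝ, E) 𝓘(ℝ, E') ∞ (fun a : G => (a : G ⧸ K)))

include hπ

theorem hasMD_proj (a : G) : HasMD 𝓘(ℝ, E) 𝓘(ℝ, E') (fun x : G => (x : G ⧸ K)) a
    (mder 𝓘(ℝ, E) 𝓘(ℝ, E') (fun x : G => (x : G ⧸ K)) a) :=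
  hπ.contMDiff.contMDiffAt.hasMD (by simp)

theorem projL_eq (a : G) : projL E K E' a =
    mder 𝓘(ℝ, E') 𝓘(ℝ, E') (fun x : G ⧸ K => a • x) ((1 : G) : G ⧸ K) ∘L projL E K E' 1 := by
  have h1 := (hasMD_proj hπ a).comp_of_eq (hasMD_leftTriv a) (mul_one a)
  have h2 := ((contMDiff_smul_quotient hπ a).contMDiffAt.hasMD (by simp)).comp (hasMD_proj hπ 1)
  have h3 := h1.unique h2
  rw [projL, h3, projL, leftTriv_one, ContinuousLinearMap.comp_id]

theorem projL_surjective (a : G) : Function.Surjective (projL E K E' a) :=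
  (hπ.mder_surjective a).comp (leftTriv_surjective a)

/-- Since `π(a x) = a π(x)`, the two differentials differ by that of a translation of `G/K`, which
is invertible. -/
theorem ker_projL (a : G) : (projL E K E' a).ker = (projL E K E' 1).ker := by
  have h1 := (contMDiff_smul_quotient hπ a).contMDiffAt.hasMD (x := ((1 : G) : G ⧸ K)) (by simp)
  have h2 := ((contMDiff_smul_quotient hπ a⁻¹).contMDiffAt.hasMD (by simp)).comp h1
  have h3 := h2.unique (hasMD_id.congr (Filter.Eventually.of_forall fun x => inv_smul_smul a x))
  ext v
  rw [LinearMap.mem_ker, LinearMap.mem_ker, projL_eq hπ a]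
  constructor
  · intro h
    have := DFunLike.congr_fun h3 (projL E K E' 1 v)
    change _ = projL E K E' 1 v at this
    change projL E K E' 1 v = 0
    rw [← this]
    exact (congrArg _ h).trans (ContinuousLinearMap.map_zero _)
  · intro h
    exact (congrArg _ h).trans (ContinuousLinearMap.map_zero _)

variable [FiniteDimensional ℝ E] [T2Space G]

/-- If `X` is in the kernel and `γ` is its one-parameter subgroup, then `π ∘ γ` has zero derivative
at all times, because the kernel is the same at every point in the left trivialization; so `π ∘ γ`
is constant and `γ` lies in `K`. Conversely `π ∘ γ` is constant for `γ` in `K`. -/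
theorem ker_projL_one : (projL E K E' (1 : G)).ker = (subgroupLieAlgebra (E := E) K : Submodule ℝ E) := by
  apply le_antisymm
  · intro X hX
    obtain ⟨γ, hγ, hadd, hγ'⟩ := exists_oneParameter (E := E) G X
    have hγ0 : γ 0 = 1 := by
      have := hadd 0 0
      rwa [add_zero, left_eq_mul] at this
    have hmem : (X : GroupLieAlgebra 𝓘(ℝ, E) G) ∈ {X : GroupLieAlgebra 𝓘(ℝ, E) G | ∃ γ : ℝ → G,
        ContMDiff 𝓘(ℝ, ℝ) 𝓘(ℝ, E) ∞ γ ∧ (∀ s t, γ (s + t) = γ s * γ t) ∧ (∀ t, γ t ∈ K) ∧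
        (mfderiv 𝓘(ℝ, ℝ) 𝓘(ℝ, E) γ 0 (1 : ℝ) : E) = X} → X ∈ subgroupLieAlgebra (E := E) K :=
      fun h => Submodule.subset_span (R := ℝ) (M := GroupLieAlgebra 𝓘(ℝ, E) G) h
    refine hmem ?_
    refine ⟨γ, hγ, hadd, fun t => ?_, ?_⟩
    · have hd : ∀ t, HasMD 𝓘(ℝ, ℝ) 𝓘(ℝ, E') (fun s => (γ s : G ⧸ K)) t 0 := fun t => by
        refine ((hasMD_proj hπ (γ t)).comp (hγ' t)).congr_deriv ?_
        ext
        have h1 : X ∈ (projL E K E' (γ t)).ker := by rw [ker_projL hπ]; exact hX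
        have h2 : mder 𝓘(ℝ, E) 𝓘(ℝ, E') (fun x : G => (x : G ⧸ K)) (γ t) (leftTriv (γ t) X) = 0 := h1
        simpa using h2
      have hconst : IsLocallyConstant fun s => (γ s : G ⧸ K) := by
        rw [IsLocallyConstant.iff_eventually_eq]
        intro t
        set χ := extChartAt 𝓘(ℝ, E') (γ t : G ⧸ K)
        have hev : ∀ᶠ s in 𝓝 t, (γ s : G ⧸ K) ∈ χ.source :=
          (hd t).mdifferentiableAt.continuousAt.eventually
            (extChartAt_source_mem_nhds (I := 𝓘(ℝ, E')) _)
        obtain ⟨ε, hε, hball⟩ := Metric.eventually_nhds_iff_ball.1 hev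
        have hdχ : ∀ s ∈ Metric.ball t ε, HasFDerivAt (fun s => χ (γ s : G ⧸ K)) (0 : ℝ →L[ℝ] E') s := by
          intro s hs
          rw [← hasMD_iff_hasFDerivAt]
          have h1 : HasMD 𝓘(ℝ, E') 𝓘(ℝ, E') χ (γ s : G ⧸ K) _ :=
            (contMDiffAt_extChartAt' (n := ∞) (by
              have : (γ s : G ⧸ K) ∈ χ.source := hball s hs
              rwa [extChartAt_source] at this)).hasMD (by simp)
          exact (HasMD.comp (f := fun s => (γ s : G ⧸ K)) h1 (hd s)).congr_deriv
            (ContinuousLinearMap.comp_zero _)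
        filter_upwards [Metric.ball_mem_nhds t hε] with s hs
        refine χ.injOn (hball s hs) (hball t (Metric.mem_ball_self hε)) ?_
        exact (convex_ball t ε).is_const_of_fderivWithin_eq_zero (𝕜 := ℝ)
          (fun s hs => (hdχ s hs).differentiableAt.differentiableWithinAt)
          (fun s hs => ((hdχ s hs).hasFDerivWithinAt.fderivWithin
            (Metric.isOpen_ball.uniqueDiffWithinAt hs))) hs (Metric.mem_ball_self hε)
      have h1 := hconst.apply_eq_of_isPreconnected isPreconnected_univ (mem_univ t) (mem_univ 0)
      simp only [hγ0] at h1
      have h2 := QuotientGroup.eq.1 h1.symm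
      simpa using h2
    · have h1 := (hγ' 0).mder_eq
      rw [hγ0, leftTriv_one] at h1
      change mder 𝓘(ℝ, ℝ) 𝓘(ℝ, E) γ 0 1 = X
      rw [h1]
      simp
  · refine Submodule.span_le.2 ?_
    rintro X ⟨γ, hγ, hadd, hK, hX⟩
    have hγ0 : γ 0 = 1 := by
      have := hadd 0 0
      rwa [add_zero, left_eq_mul] at this
    have h1 := (hasMD_proj hπ 1).comp_of_eq (hγ.contMDiffAt.hasMD (by simp)) hγ0
    have h2 := h1.unique ((hasMD_const (c := ((1 : G) : G ⧸ K))).congr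
      (Filter.Eventually.of_forall fun t => QuotientGroup.eq.2 (by simpa using hK t)))
    have h3 := DFunLike.congr_fun h2 (1 : ℝ)
    change projL E K E' 1 (X : E) = 0
    rw [← hX, projL, leftTriv_one, ContinuousLinearMap.comp_id]
    exact h3

end Quotients

/-! ### The horizontal distribution -/

section Horizontal

open scoped BoundedContinuousFunction

variable {E : Type*} [NormedAddCommGroup E] [NormedSpace ℝ E] [FiniteDimensional ℝ E]
  {G : Type*} [TopologicalSpace G] [ChartedSpace E G] [Group G] [LieGroup 𝓘(ℝ, E) ∞ G] [T2Space G]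

variable (G) in
/-- The horizontal vector `t ↦ Ad (g_u t)⁻¹ Z`. -/
def horizontalR (u : PathSpace E) : E →L[ℝ] PathSpace E := mulOp (adTransportInv G u) ∘L constPath E

variable (G) in
/-- The horizontal vector `t ↦ Ad ((g_u t)⁻¹ Φ u) Y`. -/
def horizontalL (u : PathSpace E) : E →L[ℝ] PathSpace E :=
  horizontalR G u ∘L Ad (parallelTransport G u)

theorem transportForm_horizontalR (u : PathSpace E) (Z : E) :
    transportForm G u (horizontalR G u Z) = Z := by
  have : CompleteSpace E := FiniteDimensional.complete ℝ E
  change integralL E (mulOp (adTransport G u) (mulOp (adTransportInv G u) (constPath E Z))) = Z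
  rw [← mulOp_mul, adTransport_mul_inv, mulOp_one, integralL_constPath]

theorem transportFormLeft_horizontalL (u : PathSpace E) (Y : E) :
    transportFormLeft G u (horizontalL G u Y) = Y := by
  change Ad (parallelTransport G u)⁻¹ (transportForm G u (horizontalR G u _)) = Y
  rw [transportForm_horizontalR]
  exact DFunLike.congr_fun (Ad_inv_comp (parallelTransport G u)) Y

theorem horizontalL_eq (u : PathSpace E) :
    horizontalL G u = horizontalR G u ∘L adTransport G u 1 := by
  rw [adTransport_one]; rfl

theorem contDiff_horizontalR : ContDiff ℝ ∞ (horizontalR G : PathSpace E → _) := by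
  have h : ContDiff ℝ ∞ fun u : PathSpace E => mulOp (adTransportInv G u) :=
    (mulOp (X := E) (Y := E)).contDiff.comp contDiff_adTransportInv
  exact h.clm_comp contDiff_const

theorem contDiff_horizontalL : ContDiff ℝ ∞ (horizontalL G : PathSpace E → _) := by
  rw [show (horizontalL G : PathSpace E → _) = _ from funext horizontalL_eq]
  have h1 : ContDiff ℝ ∞ fun u : PathSpace E => adTransport G u 1 :=
    (BoundedContinuousFunction.evalCLM ℝ (1 : ℝ)).contDiff.comp contDiff_adTransport
  exact contDiff_horizontalR.clm_comp h1

theorem coeFn_horizontalL (u : PathSpace E) (Y : E) :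
    horizontalL G u Y =ᵐ[volume.restrict (Icc (0 : ℝ) 1)] fun t =>
      Ad ((development G u t)⁻¹ * parallelTransport G u) Y := by
  filter_upwards [coeFn_mulOp (adTransportInv G u) (constPath E (Ad (parallelTransport G u) Y)),
    coeFn_constPath (Ad (parallelTransport G u) Y), ae_restrict_mem measurableSet_Icc]
    with t h1 h2 ht
  refine h1.trans ?_
  rw [h2, adTransportInv_apply u ht, Ad_mul]
  rfl

theorem IsDev.const_mul {g : ℝ → G} {u : ℝ → E} (hg : IsDev g u) (a : G) :
    IsDev (fun t => a * g t) u :=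
  ((isDev_const a).mul hg).congr (fun _ _ => rfl) (Filter.Eventually.of_forall fun t => by simp)

theorem IsDev.mul_const {g : ℝ → G} {u : ℝ → E} (hg : IsDev g u) (a : G) :
    IsDev (fun t => g t * a) (fun t => Ad a⁻¹ (u t)) :=
  (hg.mul (isDev_const a)).congr (fun _ _ => rfl) (Filter.Eventually.of_forall fun t => by simp)

/-- If `g * 0 = u`, then `g(0) g⁻¹` starts at `1` and has logarithmic derivative `u`. So `g = g_u⁻¹
g(0)` with `g(0) = Φ(u) g(1)`, and `Ad(g(1))` is absorbed by `𝔭` as `g(1) ∈ K`. For the converse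
take `g = g_u⁻¹ Φ(u)`, which ends at `1`. -/
theorem horizontal_eq_map (K : Subgroup G) (𝔭 : Submodule ℝ E)
    (h𝔭 : ∀ k ∈ K, ∀ X ∈ 𝔭, Ad (E := E) k X ∈ 𝔭) (u : PathSpace E) :
    horizontal K (𝔭 : Submodule ℝ (GroupLieAlgebra 𝓘(ℝ, E) G)) u =
      𝔭.map (horizontalL G u).toLinearMap := by
  apply le_antisymm
  · refine Submodule.span_le.2 ?_
    rintro X ⟨g, g', hg, hgK, hu, Y, hY, hX⟩
    have hdev := isH1Path_iff.1 hg
    have hu' : (fun t => -Ad (g t) (leftLogDeriv g g' t)) =ᵐ[volume.restrict (Icc (0 : ℝ) 1)] u := by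
      refine Filter.EventuallyEq.trans (Filter.Eventually.of_forall fun t => ?_) hu
      change -Ad (g t) (leftLogDeriv g g' t) = Ad (g t) 0 - rightLogDeriv g g' t
      rw [rightLogDeriv_eq, map_zero, zero_sub]
    have h1 := (hdev.inv.const_mul (g 0)).eqOn_development hu' (by simp)
    have hgt : ∀ t ∈ Icc (0 : ℝ) 1, g t = (development G u t)⁻¹ * g 0 := fun t ht => by
      rw [← h1 ht]; group
    have hg0 : g 0 = parallelTransport G u * g 1 := by
      rw [hgt 1 (right_mem_Icc.2 zero_le_one), development_one]; group
    refine ⟨Ad (g 1) Y, h𝔭 _ hgK _ hY, Lp.ext ?_⟩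
    filter_upwards [coeFn_horizontalL (G := G) u (Ad (g 1) Y), hX, ae_restrict_mem measurableSet_Icc]
      with t h1 h2 ht
    refine h1.trans ?_
    rw [h2, hgt t ht]
    conv_rhs => rw [hg0, ← mul_assoc, Ad_mul]
    rfl
  · rintro _ ⟨Y, hY, rfl⟩
    have h1 := ((isDev_development (G := G) u).1.inv).mul_const (parallelTransport G u)
    have h2 := h1.isH1Path
    refine Submodule.subset_span ⟨_, _, h2, ?_, ?_, Y, hY, coeFn_horizontalL u Y⟩
    · rw [development_one, inv_mul_cancel]
      exact one_mem K
    · refine Filter.Eventually.of_forall fun t => ?_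
      set a := development G u t
      set b := parallelTransport G u
      set p : ℝ → G := fun t => (development G u t)⁻¹ * parallelTransport G u
      set w : ℝ → E := fun t => Ad (parallelTransport G u)⁻¹ (-Ad (development G u t) (u t))
      have h3 : rightLogDeriv p (fun t => leftTriv (E := E) (p t) (w t)) t = Ad (p t) (w t) :=
        (rightLogDeriv_eq (E := E) p _ t).trans
          (congrArg (Ad (p t)) (congrFun (leftLogDeriv_leftTriv p w) t))
      refine (congrArg (fun z => Ad (E := E) (p t) 0 - z) h3).trans ?_
      have h4 : Ad (a⁻¹ * b) ∘L (Ad b⁻¹ ∘L Ad a) = ContinuousLinearMap.id ℝ E := by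
        rw [← Ad_mul, ← Ad_mul, ← Ad_one (E := E) (G := G)]
        congr 1
        group
      change Ad (a⁻¹ * b) 0 - Ad (a⁻¹ * b) (Ad b⁻¹ (-Ad a (u t))) = u t
      rw [map_zero, zero_sub, map_neg, map_neg, neg_neg]
      exact DFunLike.congr_fun h4 (u t)

end Horizontal

/-! ### Immersions and submanifolds -/

section Submanifolds

variable {B H X : Type*} [NormedAddCommGroup B] [NormedSpace ℝ B] [TopologicalSpace H]
  {I : ModelWithCorners ℝ B H} [TopologicalSpace X] [ChartedSpace H X]

/-- The inverse function theorem on a boundaryless manifold. -/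
theorem exists_openPartialHomeomorph_eqOn [CompleteSpace B] [I.Boundaryless] [IsManifold I ∞ X]
    {B' : Type*} [NormedAddCommGroup B'] [NormedSpace ℝ B'] {f : X → B'} {U : Set X} {x : X}
    (hU : IsOpen U) (hx : x ∈ U) (hf : ContMDiffOn I 𝓘(ℝ, B') ∞ f U)
    {J : B ≃L[ℝ] B'} (hJ : mder I 𝓘(ℝ, B') f x = J) :
    ∃ ψ : OpenPartialHomeomorph X B', x ∈ ψ.source ∧ ψ.source ⊆ U ∧ EqOn ψ f ψ.source ∧
      ContMDiffOn I 𝓘(ℝ, B') ∞ ψ ψ.source ∧ ContMDiffOn 𝓘(ℝ, B') I ∞ ψ.symm ψ.target := by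
  have : IsManifold I 1 X := .of_le (n := ∞) (by simp)
  set κ : OpenPartialHomeomorph X B :=
    (chartAt H x).trans I.toHomeomorph.toOpenPartialHomeomorph
  have hκx : x ∈ κ.source := by simp [κ]
  have hκ : ContMDiffOn I 𝓘(ℝ, B) ∞ κ κ.source := by
    have h1 := contMDiffOn_extChartAt (I := I) (n := ∞) (x := x)
    refine (h1.mono (by simp [κ])).congr fun y _ => rfl
  have hκ' : ContMDiffOn 𝓘(ℝ, B) I ∞ κ.symm κ.target := by
    have h1 := contMDiffOn_extChartAt_symm (I := I) (n := ∞) x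
    refine (h1.mono ?_).congr fun y _ => rfl
    intro y hy
    simpa [κ, extChartAt_target, I.range_eq_univ] using hy
  set g : B → B' := fun y => f (κ.symm y)
  set O : Set B := κ.target ∩ κ.symm ⁻¹' U
  have hO : IsOpen O := κ.symm.isOpen_inter_preimage hU
  have hg : ContDiffOn ℝ ∞ g O :=
    (hf.comp (hκ'.mono inter_subset_left) fun y hy => hy.2).contDiffOn
  have hxO : κ x ∈ O := ⟨κ.map_source hκx, by simpa [κ.left_inv hκx] using hx⟩
  have hf1 : HasMD I 𝓘(ℝ, B') f x J :=
    hJ ▸ (hf.contMDiffAt (hU.mem_nhds hx)).hasMD (by simp)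
  have hκ1 := (hκ.contMDiffAt (κ.open_source.mem_nhds hκx)).hasMD (by simp)
  have hκ2 := (hκ'.contMDiffAt (κ.open_target.mem_nhds (κ.map_source hκx))).hasMD (by simp)
  set a := mder I 𝓘(ℝ, B) κ x
  set b := mder 𝓘(ℝ, B) I κ.symm (κ x)
  have hab : a ∘L b = ContinuousLinearMap.id ℝ B := by
    refine (hκ1.comp_of_eq hκ2 (κ.left_inv hκx)).unique (hasMD_id.congr ?_)
    filter_upwards [κ.open_target.mem_nhds (κ.map_source hκx)] with y hy using κ.right_inv hy
  have hba : b ∘L a = ContinuousLinearMap.id ℝ B := by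
    refine (hκ2.comp hκ1).unique (hasMD_id.congr ?_)
    filter_upwards [κ.open_source.mem_nhds hκx] with y hy using κ.left_inv hy
  set b' : B ≃L[ℝ] B := .equivOfInverse b a (DFunLike.congr_fun hab) (DFunLike.congr_fun hba)
  have hg1 : HasFDerivAt g ((b'.trans J : B ≃L[ℝ] B') : B →L[ℝ] B') (κ x) :=
    hasMD_iff_hasFDerivAt.1 ((hf1.comp_of_eq hκ2 (κ.left_inv hκx)).congr_deriv rfl)
  have hgx := hg.contDiffAt (hO.mem_nhds hxO)
  set Ψ := hgx.toOpenPartialHomeomorph g hg1 (by simp)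
  have hΨ : ∀ y, Ψ y = g y := fun y => rfl
  -- Restricting to the open set where the derivative is invertible makes the inverse smooth on its
  -- whole domain and not only at one point.
  set S : Set B := O ∩ fderiv ℝ g ⁻¹' range ((↑) : (B ≃L[ℝ] B') → B →L[ℝ] B')
  have hS : IsOpen S := (hg.continuousOn_fderiv_of_isOpen hO (by simp)).isOpen_inter_preimage hO
    ContinuousLinearEquiv.isOpen
  have hxS : κ x ∈ S := ⟨hxO, _, hg1.fderiv.symm⟩
  set Ψ' := Ψ.restrOpen S hS
  have hxΨ : κ x ∈ Ψ'.source := ⟨hgx.mem_toOpenPartialHomeomorph_source hg1 (by simp), hxS⟩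
  have hΨ's : Ψ'.source ⊆ S := by
    intro y hy
    exact (show y ∈ Ψ.source ∩ S from hy).2
  refine ⟨κ.trans Ψ', ?_, ?_, ?_, ?_, ?_⟩
  · simpa using ⟨hκx, hxΨ⟩
  · intro y hy
    have hy' : y ∈ κ.source ∧ κ y ∈ Ψ'.source := by simpa using hy
    simpa [κ.left_inv hy'.1] using (hΨ's hy'.2).1.2
  · intro y hy
    have hy' : y ∈ κ.source ∧ κ y ∈ Ψ'.source := by simpa using hy
    change f (κ.symm (κ y)) = f y
    rw [κ.left_inv hy'.1]
  · have h1 : ContMDiffOn 𝓘(ℝ, B) 𝓘(ℝ, B') ∞ Ψ' Ψ'.source :=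
      (hg.mono fun y hy => (hΨ's hy).1).contMDiffOn
    rw [κ.trans_source]
    exact h1.comp (hκ.mono inter_subset_left) fun y hy => hy.2
  · have h1 : ContMDiffOn 𝓘(ℝ, B') 𝓘(ℝ, B) ∞ Ψ'.symm Ψ'.target := by
      intro z hz
      have hz' := hΨ's (Ψ'.map_target hz)
      obtain ⟨e, he⟩ := hz'.2
      have hd : HasFDerivAt Ψ' (e : B →L[ℝ] B') (Ψ'.symm z) := by
        rw [he]
        exact ((hg.contDiffAt (hO.mem_nhds hz'.1)).differentiableAt (by simp)).hasFDerivAt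
      exact (Ψ'.contDiffAt_symm hz hd
        (hg.contDiffAt (hO.mem_nhds hz'.1))).contMDiffAt.contMDiffWithinAt
    have h2 : (κ.trans Ψ').target = Ψ'.target ∩ Ψ'.symm ⁻¹' κ.target := κ.trans_target _
    rw [h2]
    exact hκ'.comp (h1.mono inter_subset_left) fun y hy => hy.2

theorem OpenPartialHomeomorph.trans_toHomeomorph_symm_mem_maximalAtlas [I.Boundaryless]
    [IsManifold I ∞ X] {ψ : OpenPartialHomeomorph X B}
    (h : ContMDiffOn I 𝓘(ℝ, B) ∞ ψ ψ.source) (h' : ContMDiffOn 𝓘(ℝ, B) I ∞ ψ.symm ψ.target) :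
    ψ.trans I.toHomeomorph.symm.toOpenPartialHomeomorph ∈ IsManifold.maximalAtlas I ∞ X := by
  have hI : ContMDiff 𝓘(ℝ, B) I ∞ I.symm := by
    have := I.contMDiffOn_symm (n := ∞)
    rwa [I.range_eq_univ, contMDiffOn_univ] at this
  refine OpenPartialHomeomorph.mem_maximalAtlas_of_contMDiffOn _ ?_ ?_
  · have hs : (ψ.trans I.toHomeomorph.symm.toOpenPartialHomeomorph).source = ψ.source := by simp
    rw [hs]
    exact hI.comp_contMDiffOn h
  · have hs : (ψ.trans I.toHomeomorph.symm.toOpenPartialHomeomorph).target = I ⁻¹' ψ.target := by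
      ext; simp
    rw [hs]
    exact h'.comp I.contMDiff.contMDiffOn fun y hy => hy

/-- A smooth map whose differential is a split injection is an immersion. -/
theorem isImmersionAtOfComplement_of_equiv [CompleteSpace B] {X : Type*} [TopologicalSpace X]
    [ChartedSpace B X] [IsManifold 𝓘(ℝ, B) ∞ X] {C V : Type*} [NormedAddCommGroup C]
    [NormedSpace ℝ C] [CompleteSpace C] [NormedAddCommGroup V] [NormedSpace ℝ V] {f : X → V}
    (hf : ContMDiff 𝓘(ℝ, B) 𝓘(ℝ, V) ∞ f) {x : X} (S : (B × C) ≃L[ℝ] V)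
    (hS : ∀ b, S (b, 0) = mder 𝓘(ℝ, B) 𝓘(ℝ, V) f x b) :
    IsImmersionAtOfComplement C 𝓘(ℝ, B) 𝓘(ℝ, V) ∞ f x := by
  -- `D` supplies the missing directions: `(y, c) ↦ f y + D c` has the invertible differential `S`
  -- at `(x, 0)`, and its local inverse straightens the image of `f` to the slice `c = 0`.
  set D : C →L[ℝ] V := (S : (B × C) →L[ℝ] V) ∘L ContinuousLinearMap.inr ℝ B C
  set g : X × C → V := fun y => f y.1 + D y.2
  have hg : ContMDiff (𝓘(ℝ, B).prod 𝓘(ℝ, C)) 𝓘(ℝ, V) ∞ g :=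
    (hf.comp contMDiff_fst).add (D.contDiff.contMDiff.comp contMDiff_snd)
  have hJ : mder (𝓘(ℝ, B).prod 𝓘(ℝ, C)) 𝓘(ℝ, V) g (x, 0) = (S : (B × C) →L[ℝ] V) := by
    have h1 : HasMD (𝓘(ℝ, B).prod 𝓘(ℝ, C)) 𝓘(ℝ, V) (fun y : X × C => f y.1) (x, 0) _ :=
      HasMD.comp (I₂ := 𝓘(ℝ, B)) (f := Prod.fst) (x := (x, (0 : C)))
        (hf.contMDiffAt.hasMD (by simp)) hasMD_fst
    have h2 : HasMD (𝓘(ℝ, B).prod 𝓘(ℝ, C)) 𝓘(ℝ, V) (fun y : X × C => D y.2) (x, 0) _ :=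
      HasMD.comp (I₂ := 𝓘(ℝ, C)) (f := Prod.snd) (x := (x, (0 : C)))
        (hasMD_iff_hasFDerivAt.2 D.hasFDerivAt) hasMD_snd
    have h3 : HasMD (𝓘(ℝ, B).prod 𝓘(ℝ, C)) 𝓘(ℝ, V) g (x, 0) _ := HasMFDerivAt.add h1 h2
    refine h3.mder_eq.trans (ContinuousLinearMap.ext fun v => ?_)
    change mder 𝓘(ℝ, B) 𝓘(ℝ, V) f x v.1 + S (0, v.2) = S v
    rw [← hS, ← map_add]
    have h4 : ∀ w : B × C, (w.1, (0 : C)) + ((0 : B), w.2) = w := fun w => by simp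
    exact congrArg S (h4 v)
  obtain ⟨ψ, hxψ, -, hψg, hψ, hψ'⟩ := exists_openPartialHomeomorph_eqOn
    (I := 𝓘(ℝ, B).prod 𝓘(ℝ, C)) isOpen_univ (mem_univ (x, (0 : C))) hg.contMDiffOn hJ
  set κ := chartAt B x
  have hκ : ContMDiffOn 𝓘(ℝ, B) 𝓘(ℝ, B) ∞ κ κ.source := contMDiffOn_chart
  have hκ' : ContMDiffOn 𝓘(ℝ, B) 𝓘(ℝ, B) ∞ κ.symm κ.target := contMDiffOn_chart_symm
  set W : Set X := {y | (y, (0 : C)) ∈ ψ.source}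
  have hW : IsOpen W := ψ.open_source.preimage (by fun_prop)
  set e : OpenPartialHomeomorph (X × C) V :=
    (κ.prod (OpenPartialHomeomorph.refl C)).trans S.toHomeomorph.toOpenPartialHomeomorph
  have hes : e.source = κ.source ×ˢ univ := by simp [e]
  have het : e.target = (fun v => (S.symm v).1) ⁻¹' κ.target := by ext; simp [e]
  have he : ContMDiffOn (𝓘(ℝ, B).prod 𝓘(ℝ, C)) 𝓘(ℝ, V) ∞ e e.source := by
    rw [hes]
    have h1 : ContMDiffOn (𝓘(ℝ, B).prod 𝓘(ℝ, C)) 𝓘(ℝ, B × C) ∞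
        (fun y : X × C => (κ y.1, y.2)) (κ.source ×ˢ univ) :=
      (hκ.comp contMDiffOn_fst fun y hy => hy.1).prodMk_space contMDiffOn_snd
    exact S.contDiff.contMDiff.comp_contMDiffOn h1
  have he' : ContMDiffOn 𝓘(ℝ, V) (𝓘(ℝ, B).prod 𝓘(ℝ, C)) ∞ e.symm e.target := by
    rw [het]
    have h1 : ContMDiff 𝓘(ℝ, V) 𝓘(ℝ, B) ∞ fun v => (S.symm v).1 :=
      (contDiff_fst.comp S.symm.contDiff).contMDiff
    have h2 : ContMDiff 𝓘(ℝ, V) 𝓘(ℝ, C) ∞ fun v => (S.symm v).2 :=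
      (contDiff_snd.comp S.symm.contDiff).contMDiff
    exact (hκ'.comp h1.contMDiffOn fun y hy => hy).prodMk h2.contMDiffOn
  refine .mk_of_continuousAt hf.continuous.continuousAt S (κ.restr W) (ψ.symm.trans e) ?_ ?_ ?_ ?_ ?_
  · rw [κ.restr_source, hW.interior_eq]
    exact ⟨mem_chart_source B x, hxψ⟩
  · have h1 : f x = ψ (x, 0) := by rw [hψg hxψ]; simp [g]
    rw [h1]
    refine ⟨ψ.map_source hxψ, ?_⟩
    change ψ.symm (ψ (x, 0)) ∈ e.source
    rw [ψ.left_inv hxψ, hes]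
    exact ⟨mem_chart_source B x, mem_univ _⟩
  · exact restr_mem_maximalAtlas _ (IsManifold.chart_mem_maximalAtlas x) hW
  · refine OpenPartialHomeomorph.mem_maximalAtlas_of_contMDiffOn _ ?_ ?_
    · exact he.comp (hψ'.mono inter_subset_left) fun y hy => hy.2
    · exact hψ.comp (he'.mono inter_subset_left) fun y hy => hy.2
  · intro z hz
    have hz1 : z ∈ (κ.restr W).target := by simpa using hz
    have hz2 := (κ.restr W).map_target hz1
    rw [κ.restr_source, hW.interior_eq] at hz2
    have hz3 : (κ.symm z, (0 : C)) ∈ ψ.source := hz2.2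
    change e (ψ.symm (f (κ.symm z))) = S (z, 0)
    have h1 : f (κ.symm z) = ψ (κ.symm z, 0) := by rw [hψg hz3]; simp [g]
    rw [h1, ψ.left_inv hz3]
    change S (κ (κ.symm z), 0) = S (z, 0)
    rw [κ.right_inv hz1.1]

/-- In the charts of the immersion the map is `y ↦ (y, 0)`; project back to the first factor. -/
theorem Manifold.IsImmersion.exists_retraction {E M E' N : Type*} [NormedAddCommGroup E]
    [NormedSpace ℝ E] [TopologicalSpace M] [ChartedSpace E M] [NormedAddCommGroup E']
    [NormedSpace ℝ E'] [TopologicalSpace N] [ChartedSpace E' N] {f : M → N}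
    (hf : IsImmersion 𝓘(ℝ, E) 𝓘(ℝ, E') ∞ f) (x : M) :
    ∃ r : N → M, ContMDiffAt 𝓘(ℝ, E') 𝓘(ℝ, E) ∞ r (f x) ∧ ∀ᶠ y in 𝓝 x, r (f y) = y := by
  obtain ⟨F, _, _, h⟩ := hf
  replace h := h x
  set a := h.domChart
  set b := h.codChart
  set e := h.equiv
  have hxa : x ∈ a.source := h.mem_domChart_source
  have hxb : f x ∈ b.source := h.mem_codChart_source
  have hw : ∀ y ∈ a.source, (e.symm (b (f y))).1 = a y := fun y hy => by
    have hz' : a y ∈ (a.extend 𝓘(ℝ, E)).target := by simpa using a.map_source hy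
    have h1 := h.writtenInCharts hz'
    have h2 : b (f (a.symm (a y))) = e (a y, 0) := by simpa using h1
    rw [a.left_inv hy] at h2
    rw [h2, ContinuousLinearEquiv.symm_apply_apply]
  have hτ : ContMDiffAt 𝓘(ℝ, E') 𝓘(ℝ, E) ∞ (fun y => (e.symm (b y)).1) (f x) := by
    have h1 : ContMDiffAt 𝓘(ℝ, E') 𝓘(ℝ, E') ∞ b (f x) :=
      contMDiffAt_of_mem_maximalAtlas h.codChart_mem_maximalAtlas hxb
    have h2 : ContDiff ℝ ∞ fun z : E' => (e.symm z).1 := contDiff_fst.comp e.symm.contDiff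
    exact h2.contMDiff.contMDiffAt.comp (f x) h1
  have ha : ContMDiffAt 𝓘(ℝ, E) 𝓘(ℝ, E) ∞ a.symm ((e.symm (b (f x))).1) := by
    rw [hw x hxa]
    exact contMDiffAt_symm_of_mem_maximalAtlas h.domChart_mem_maximalAtlas (a.map_source hxa)
  refine ⟨fun y => a.symm (e.symm (b y)).1, ha.comp (f x) hτ, ?_⟩
  filter_upwards [a.open_source.mem_nhds hxa] with y hy
  rw [hw y hy, a.left_inv hy]

theorem Manifold.IsImmersion.mder_injective {E M E' N : Type*} [NormedAddCommGroup E]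
    [NormedSpace ℝ E] [TopologicalSpace M] [ChartedSpace E M] [NormedAddCommGroup E']
    [NormedSpace ℝ E'] [TopologicalSpace N] [ChartedSpace E' N] [IsManifold 𝓘(ℝ, E) ∞ M]
    [IsManifold 𝓘(ℝ, E') ∞ N] {f : M → N}
    (hf : IsImmersion 𝓘(ℝ, E) 𝓘(ℝ, E') ∞ f) (x : M) :
    Function.Injective (mder 𝓘(ℝ, E) 𝓘(ℝ, E') f x) := by
  obtain ⟨r, hr, hrf⟩ := hf.exists_retraction x
  have h2 := ((hr.hasMD (by simp)).comp (hf.contMDiff.contMDiffAt.hasMD (by simp))).unique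
    (hasMD_id.congr hrf)
  exact Function.LeftInverse.injective (g := mder 𝓘(ℝ, E') 𝓘(ℝ, E) r (f x)) fun v => DFunLike.congr_fun h2 v

/-- A slice chart induces a chart of the subspace. -/
theorem exists_sliceChart {T D : Type*} [TopologicalSpace T] [NormedAddCommGroup D]
    [NormedSpace ℝ D] {ι : T → X} (hι : IsEmbedding ι) [Nonempty T] {T₀ : B →L[ℝ] D}
    {P : B →L[ℝ] T₀.ker} (hP : ∀ z : T₀.ker, P z = z) {ψ : OpenPartialHomeomorph X B}
    (hψ : ∀ x ∈ ψ.source, x ∈ range ι ↔ T₀ (ψ x) = 0) :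
    ∃ c : OpenPartialHomeomorph T T₀.ker, c.source = ι ⁻¹' ψ.source ∧
      c.target = {z : T₀.ker | (z : B) ∈ ψ.target} ∧ (∀ t, c t = P (ψ (ι t))) ∧
      (∀ t ∈ c.source, (c t : B) = ψ (ι t)) ∧ ∀ z ∈ c.target, ι (c.symm z) = ψ.symm z := by
  have hc : ∀ t ∈ ι ⁻¹' ψ.source, (P (ψ (ι t)) : B) = ψ (ι t) := fun t ht => by
    have h0 : T₀ (ψ (ι t)) = 0 := (hψ _ ht).1 (mem_range_self t)
    exact congrArg Subtype.val (hP ⟨ψ (ι t), h0⟩)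
  have hinv : ∀ z : T₀.ker, (z : B) ∈ ψ.target → ι (Function.invFun ι (ψ.symm z)) = ψ.symm z :=
    fun z hz => Function.invFun_eq ((hψ _ (ψ.map_target hz)).2 (by rw [ψ.right_inv hz]; exact z.2))
  refine ⟨{ toFun := fun t => P (ψ (ι t))
            invFun := fun z => Function.invFun ι (ψ.symm z)
            source := ι ⁻¹' ψ.source
            target := {z : T₀.ker | (z : B) ∈ ψ.target}
            map_source' := fun t ht => by
              change (P (ψ (ι t)) : B) ∈ ψ.target
              rw [hc t ht]; exact ψ.map_source ht
            map_target' := fun z hz => by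
              change ι _ ∈ ψ.source
              rw [hinv z hz]; exact ψ.map_target hz
            left_inv' := fun t ht => hι.injective (by
              rw [hinv _ (by rw [hc t ht]; exact ψ.map_source ht), hc t ht, ψ.left_inv ht])
            right_inv' := fun z hz => by rw [hinv z hz, ψ.right_inv hz, hP]
            open_source := ψ.open_source.preimage hι.continuous
            open_target := ψ.open_target.preimage continuous_subtype_val
            continuousOn_toFun := P.continuous.comp_continuousOn
              (ψ.continuousOn.comp hι.continuous.continuousOn fun t ht => ht)
            continuousOn_invFun := by
              rw [hι.continuousOn_iff]
              exact (ψ.continuousOn_symm.comp continuous_subtype_val.continuousOn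
                fun z hz => hz).congr fun z hz => hinv z hz },
    rfl, rfl, fun _ => rfl, hc, hinv⟩

/-- A subspace that is locally the zero set of a submersion, whose differentials are all equivalent
to `T₀`, is an embedded submanifold. -/
theorem exists_isSmoothEmbedding_of_zeroSet [CompleteSpace B] [I.Boundaryless] [IsManifold I ∞ X]
    {T D : Type*} [TopologicalSpace T] [NormedAddCommGroup D] [NormedSpace ℝ D] {ι : T → X}
    (hι : IsEmbedding ι) (T₀ : B →L[ℝ] D) (R : D →L[ℝ] B) (hR : ∀ d, T₀ (R d) = d)
    (h : T → X → D) (O : T → Set X) (hO : ∀ p, IsOpen (O p)) (hpO : ∀ p, ι p ∈ O p)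
    (hh : ∀ p, ContMDiffOn I 𝓘(ℝ, D) ∞ (h p) (O p))
    (hz : ∀ p, ∀ x ∈ O p, x ∈ range ι ↔ h p x = 0) (J : T → B ≃L[ℝ] B)
    (hJ : ∀ p, mder I 𝓘(ℝ, D) (h p) (ι p) = T₀ ∘L (J p : B →L[ℝ] B)) :
    ∃ (_ : ChartedSpace T₀.ker T) (_ : IsManifold 𝓘(ℝ, T₀.ker) ∞ T),
      IsSmoothEmbedding 𝓘(ℝ, T₀.ker) I ∞ ι ∧
      (∀ p, Function.Injective (mder 𝓘(ℝ, T₀.ker) I ι p)) ∧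
      ∀ p, (mder 𝓘(ℝ, T₀.ker) I ι p).range = (mder I 𝓘(ℝ, D) (h p) (ι p)).ker := by
  have : IsManifold I 1 X := .of_le (n := ∞) (by simp)
  -- The projection onto the kernel of `T₀` along the range of its right inverse `R`.
  set P : B →L[ℝ] T₀.ker := (ContinuousLinearMap.id ℝ B - R ∘L T₀).codRestrict T₀.ker
    (fun b => by simp [hR])
  have hP : ∀ z : T₀.ker, P z = z := fun z => by
    ext; simp [P, show T₀ z = 0 from z.2]
  have hψ : ∀ p, ∃ ψ : OpenPartialHomeomorph X B, ι p ∈ ψ.source ∧ ψ.source ⊆ O p ∧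
      (∀ x ∈ ψ.source, T₀ (ψ x) = h p x) ∧
      ContMDiffOn I 𝓘(ℝ, B) ∞ ψ ψ.source ∧ ContMDiffOn 𝓘(ℝ, B) I ∞ ψ.symm ψ.target := fun p => by
    obtain ⟨K, hK⟩ : ∃ K : B ≃L[ℝ] B,
        (K : B →L[ℝ] B) = mder I 𝓘(ℝ, B) (fun x => extChartAt I (ι p) x) (ι p) :=
      isInvertible_mfderiv_extChartAt (I := I) (mem_extChartAt_source (I := I) (ι p))
    let κ : X → B := fun x => extChartAt I (ι p) x
    have hκ : ContMDiffOn I 𝓘(ℝ, B) ∞ κ (chartAt H (ι p)).source := contMDiffOn_extChartAt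
    have hpc := mem_chart_source H (ι p)
    have hκ1 : HasMD I 𝓘(ℝ, B) κ (ι p) (K : B →L[ℝ] B) := by
      have h1 := (hκ.contMDiffAt ((chartAt H (ι p)).open_source.mem_nhds hpc)).hasMD (by simp)
      exact h1.congr_deriv hK.symm
    have hh1 : HasMD I 𝓘(ℝ, D) (h p) (ι p) (T₀ ∘L (J p : B →L[ℝ] B)) :=
      (((hh p).contMDiffAt ((hO p).mem_nhds (hpO p))).hasMD (by simp)).congr_deriv (hJ p)
    set L : B →L[ℝ] B := (J p : B →L[ℝ] B) ∘L (K.symm : B →L[ℝ] B)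
    set A : B →L[ℝ] B := (ContinuousLinearMap.id ℝ B - R ∘L T₀) ∘L L
    -- Since `T₀ (1 - R T₀) = 0`, the new coordinates satisfy `T₀ f = h p`, and at `ι p` their
    -- derivative is `(1 - R T₀) J + R T₀ J = J`, which is invertible. Thus all slices are modelled
    -- on the one space `ker T₀`.
    set f : X → B := fun x => A (κ x) + R (h p x)
    set U := (chartAt H (ι p)).source ∩ O p
    have hU : IsOpen U := (chartAt H (ι p)).open_source.inter (hO p)
    have hf : ContMDiffOn I 𝓘(ℝ, B) ∞ f U :=
      (A.contDiff.contMDiff.comp_contMDiffOn (hκ.mono inter_subset_left)).add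
        (R.contDiff.contMDiff.comp_contMDiffOn ((hh p).mono inter_subset_right))
    have hf1 : mder I 𝓘(ℝ, B) f (ι p) = (J p : B →L[ℝ] B) := by
      have h3 : HasMD I 𝓘(ℝ, B) f (ι p) _ := HasMFDerivAt.add
        ((hasMD_iff_hasFDerivAt.2 A.hasFDerivAt).comp hκ1)
        ((hasMD_iff_hasFDerivAt.2 R.hasFDerivAt).comp hh1)
      refine h3.mder_eq.trans (ContinuousLinearMap.ext fun v => ?_)
      change A (K v) + R (T₀ (J p v)) = J p v
      have h4 : K.symm (K v) = (v : B) := K.symm_apply_apply v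
      simp [A, L, h4]
    obtain ⟨ψ, h1, h2, h3, h4, h5⟩ := exists_openPartialHomeomorph_eqOn hU ⟨hpc, hpO p⟩ hf hf1
    refine ⟨ψ, h1, h2.trans inter_subset_right, fun x hx => ?_, h4, h5⟩
    rw [h3 hx]
    simp [f, A, hR]
  choose ψ hψp hψO hψh hψs hψs' using hψ
  have hψz : ∀ p, ∀ x ∈ (ψ p).source, x ∈ range ι ↔ T₀ (ψ p x) = 0 := fun p x hx => by
    rw [hψh p x hx, hz p x (hψO p hx)]
  have := fun p : T => have : Nonempty T := ⟨p⟩; exists_sliceChart hι hP (hψz p)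
  choose c hcs hct hc hcψ hcψ' using this
  let _cs : ChartedSpace T₀.ker T :=
    { atlas := range c
      chartAt := c
      mem_chart_source := fun p => by rw [hcs]; exact hψp p
      chart_mem_atlas := fun p => mem_range_self p }
  have hmf : IsManifold 𝓘(ℝ, T₀.ker) ∞ T := by
    refine isManifold_of_contDiffOn _ _ _ ?_
    rintro _ _ ⟨p, rfl⟩ ⟨q, rfl⟩
    have h1 : ContDiffOn ℝ ∞ (fun z : T₀.ker => P (ψ q ((ψ p).symm z)))
        ((c p).symm.trans (c q)).source := by
      refine P.contDiff.comp_contDiffOn (ContMDiffOn.contDiffOn ?_)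
      refine (hψs q).comp ((hψs' p).comp T₀.ker.subtypeL.contDiff.contMDiff.contMDiffOn
        (s := ((c p).symm.trans (c q)).source) ?_) ?_
      · intro z hz
        have hz1 : z ∈ (c p).target := hz.1
        rw [hct] at hz1
        exact hz1
      · intro z hz
        have hz1 : z ∈ (c p).target := hz.1
        have hz2 : (c p).symm z ∈ (c q).source := hz.2
        rw [hcs, mem_preimage, hcψ' p z hz1] at hz2
        exact hz2
    have h2 : 𝓘(ℝ, T₀.ker).symm ⁻¹' ((c p).symm.trans (c q)).source ∩ range 𝓘(ℝ, T₀.ker)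
        = ((c p).symm.trans (c q)).source := by simp
    rw [h2]
    refine h1.congr fun z hz => ?_
    have hz1 : z ∈ (c p).target := hz.1
    change c q ((c p).symm z) = _
    rw [hc, hcψ' p z hz1]
  have him : IsImmersionOfComplement D 𝓘(ℝ, T₀.ker) I ∞ ι := fun p => by
    set e : (T₀.ker × D) ≃L[ℝ] B := .equivOfInverse (T₀.ker.subtypeL.coprod R) (P.prod T₀)
      (fun z => by
        ext1
        · apply Subtype.ext
          simp [P, hR, show T₀ z.1 = 0 from z.1.2]
        · simp [hR, show T₀ z.1 = 0 from z.1.2])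
      (fun b => by simp [P])
    refine .mk_of_continuousAt hι.continuous.continuousAt e (c p)
      ((ψ p).trans I.toHomeomorph.symm.toOpenPartialHomeomorph) ?_ ?_ ?_ ?_ ?_
    · rw [hcs]; exact hψp p
    · simpa using hψp p
    · exact IsManifold.subset_maximalAtlas (mem_range_self p)
    · exact OpenPartialHomeomorph.trans_toHomeomorph_symm_mem_maximalAtlas (hψs p) (hψs' p)
    · intro z hz
      have hz1 : z ∈ (c p).target := by simpa using hz
      have hz2 : (z : B) ∈ (ψ p).target := by
        have := hz1; rw [hct] at this; exact this
      change I (I.toHomeomorph.symm (ψ p (ι ((c p).symm z)))) = e (z, 0)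
      rw [hcψ' p z hz1, (ψ p).right_inv hz2]
      have h1 : I (I.toHomeomorph.symm (z : B)) = z := I.toHomeomorph.apply_symm_apply _
      rw [h1]
      simp [e]
  have hcs' : ∀ p, ContMDiffAt 𝓘(ℝ, T₀.ker) 𝓘(ℝ, T₀.ker) ∞ (c p).symm (c p p) := fun p =>
    contMDiffAt_symm_of_mem_maximalAtlas (IsManifold.subset_maximalAtlas (mem_range_self p))
      ((c p).map_source (by rw [hcs]; exact hψp p))
  refine ⟨_cs, hmf, ⟨him.isImmersion, hι⟩, fun p => ?_, fun p => ?_⟩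
  -- The coordinates `P ∘ ψ` followed by the inverse slice chart form a smooth left inverse of `ι`
  -- near `ι p`.
  · have hk : ContMDiffAt I 𝓘(ℝ, T₀.ker) ∞ (fun x => (c p).symm (P (ψ p x))) (ι p) := by
      have h1 : ContMDiffAt I 𝓘(ℝ, T₀.ker) ∞ (fun x => P (ψ p x)) (ι p) :=
        (P.contDiff (n := ∞)).contMDiff.contMDiffAt.comp _
          ((hψs p).contMDiffAt ((ψ p).open_source.mem_nhds (hψp p)))
      refine ContMDiffAt.comp (ι p) (g := (c p).symm) ?_ h1
      rw [← hc]
      exact hcs' p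
    have h1 := ((hk.hasMD (by simp)).comp ((him.contMDiff p).hasMD (by simp))).unique
      (hasMD_id.congr (by
        filter_upwards [(c p).open_source.mem_nhds (by rw [hcs]; exact hψp p : p ∈ (c p).source)]
          with t ht
        rw [← hc, (c p).left_inv ht]))
    exact Function.LeftInverse.injective fun v => DFunLike.congr_fun h1 v
  have hι1 := (him.contMDiff p).hasMD (by simp)
  have hs := (ψ p).open_source.mem_nhds (hψp p)
  have hψ1 := ((hψs p).contMDiffAt hs).hasMD (by simp)
  have hψ2 := ((hψs' p).contMDiffAt ((ψ p).open_target.mem_nhds ((ψ p).map_source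
    (hψp p)))).hasMD (by simp)
  have hh1 : mder I 𝓘(ℝ, D) (h p) (ι p) = T₀ ∘L mder I 𝓘(ℝ, B) (ψ p) (ι p) := by
    refine (((hasMD_iff_hasFDerivAt.2 T₀.hasFDerivAt).comp hψ1).congr ?_).mder_eq
    filter_upwards [hs] with x hx using (hψh p x hx).symm
  have hinv : ∀ b, mder 𝓘(ℝ, B) I (ψ p).symm (ψ p (ι p)) (mder I 𝓘(ℝ, B) (ψ p) (ι p) b) = b := by
    have h1 := (hψ2.comp hψ1).unique (hasMD_id.congr ((ψ p).eventually_left_inverse (hψp p)))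
    exact DFunLike.congr_fun h1
  have hpt : (c p p : B) ∈ (ψ p).target := by
    rw [hcψ p p (by rw [hcs]; exact hψp p)]
    exact (ψ p).map_source (hψp p)
  have hcp : p ∈ (c p).source := by rw [hcs]; exact hψp p
  refine le_antisymm ?_ fun b hb => ?_
  · rintro _ ⟨v, rfl⟩
    have h1 : (mder I 𝓘(ℝ, D) (h p) (ι p)) ∘L (mder 𝓘(ℝ, T₀.ker) I ι p) = 0 := by
      refine ((((hh p).contMDiffAt ((hO p).mem_nhds (hpO p))).hasMD (by simp)).comp hι1).unique
        (hasMD_const (c := (0 : D)) |>.congr ?_)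
      filter_upwards [hι.continuous.continuousAt.preimage_mem_nhds ((hO p).mem_nhds (hpO p))]
        with t ht using (hz p _ ht).1 (mem_range_self t)
    exact DFunLike.congr_fun h1 v
  -- A vector annihilated by `dh` has `dψ`-image in `ker T₀`, so it is the image of a tangent vector
  -- of the slice.
  · have hcsym := hcs' p
    have h1 := hι1.comp_of_eq (hcsym.hasMD (by simp)) ((c p).left_inv hcp)
    have h2 : HasMD 𝓘(ℝ, T₀.ker) I (fun z => ι ((c p).symm z)) (c p p)
        (mder 𝓘(ℝ, B) I (ψ p).symm (ψ p (ι p)) ∘L T₀.ker.subtypeL) := by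
      refine (hψ2.comp_of_eq (hasMD_iff_hasFDerivAt.2 T₀.ker.subtypeL.hasFDerivAt)
        (hcψ p p hcp)).congr ?_
      filter_upwards [(c p).open_target.mem_nhds ((c p).map_source hcp)] with z hz' using hcψ' p z hz'
    have hb' : T₀ (mder I 𝓘(ℝ, B) (ψ p) (ι p) b) = 0 := by
      have : mder I 𝓘(ℝ, D) (h p) (ι p) b = 0 := hb
      rwa [hh1] at this
    have h3 := DFunLike.congr_fun (h1.unique h2) ⟨_, hb'⟩
    exact ⟨_, h3.trans (hinv b)⟩

end Submanifolds

/-! ### Limits of operators of finite rank -/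

section Approximable

open scoped BoundedContinuousFunction

variable {X Y Z : Type*} [NormedAddCommGroup X] [NormedSpace ℝ X] [NormedAddCommGroup Y]
  [NormedSpace ℝ Y] [NormedAddCommGroup Z] [NormedSpace ℝ Z]

variable (X Y) in
/-- The limits of continuous linear operators of finite rank. -/
def approximableOperators : Submodule ℝ (X →L[ℝ] Y) :=
  ((LinearMap.finiteRange ℝ X Y).comap (ContinuousLinearMap.coeLM ℝ)).topologicalClosure

theorem mem_approximable_of_hasFiniteRange {T : X →L[ℝ] Y}
    (h : (T : X →ₗ[ℝ] Y).HasFiniteRange) : T ∈ approximableOperators X Y :=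
  Submodule.le_topologicalClosure _ (LinearMap.mem_finiteRange_iff_hasFiniteRange.2 h)

theorem mem_approximable_of_finiteDimensional_left [FiniteDimensional ℝ X] (T : X →L[ℝ] Y) :
    T ∈ approximableOperators X Y :=
  mem_approximable_of_hasFiniteRange LinearMap.HasFiniteRange.of_finite_dom

theorem comp_left_mem_approximable {T : X →L[ℝ] Y} (h : T ∈ approximableOperators X Y)
    (S : Y →L[ℝ] Z) : S ∘L T ∈ approximableOperators X Z := by
  have h1 : Continuous fun T : X →L[ℝ] Y => S ∘L T := by fun_prop
  refine map_mem_closure h1 h fun T hT => ?_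
  have hT' : (T : X →ₗ[ℝ] Y).HasNoetherianRange := hT
  exact hT'.comp_left (S : Y →ₗ[ℝ] Z)

theorem comp_right_mem_approximable {T : Y →L[ℝ] Z} (h : T ∈ approximableOperators Y Z)
    (S : X →L[ℝ] Y) : T ∘L S ∈ approximableOperators X Z := by
  have h1 : Continuous fun T : Y →L[ℝ] Z => T ∘L S := by fun_prop
  refine map_mem_closure (f := fun T : Y →L[ℝ] Z => T ∘L S) h1 h fun T hT => ?_
  have hT' : (T : Y →ₗ[ℝ] Z).HasNoetherianRange := hT
  exact hT'.comp_right (S : X →ₗ[ℝ] Y)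

theorem isCompactOperator_of_mem_approximable [CompleteSpace Y] {T : X →L[ℝ] Y}
    (h : T ∈ approximableOperators X Y) : IsCompactOperator T := by
  refine isClosed_setOfPred_isCompactOperator.closure_subset_iff.2 ?_ h
  intro S hS
  have hS' : (S : X →ₗ[ℝ] Y).HasNoetherianRange := hS
  have : FiniteDimensional ℝ (S : X →ₗ[ℝ] Y).range := by
    rw [LinearMap.HasNoetherianRange] at hS'
    infer_instance
  exact (isCompactOperator_of_locallyCompactSpace_dom S.rangeRestrict).clm_comp
    (S : X →ₗ[ℝ] Y).range.subtypeL

/-- The map `T = id + S` preserves the finite-dimensional space `F = range S`, its kernel lies in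
`F`, and `F` surjects onto the cokernel with kernel `T(F)`. So both dimensions are those of `T`
restricted to `F`, where rank-nullity applies. -/
theorem finrank_ker_eq_finrank_coker_of_id_add {U : Type*} [AddCommGroup U] [Module ℝ U]
    (S : U →ₗ[ℝ] U) (hS : S.HasFiniteRange) :
    Module.finrank ℝ (LinearMap.id + S).ker = Module.finrank ℝ (U ⧸ (LinearMap.id + S).range) := by
  set T := LinearMap.id + S with hT
  have hTa : ∀ v, T v = v + S v := fun v => rfl
  set F := S.range
  have : FiniteDimensional ℝ F := Module.Finite.iff_fg.2 hS
  have hmaps : ∀ v ∈ F, T v ∈ F := fun v hv => F.add_mem hv ⟨v, rfl⟩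
  set TF : F →ₗ[ℝ] F := T.restrict hmaps
  have h1 : Module.finrank ℝ T.ker = Module.finrank ℝ TF.ker := by
    symm
    have hk : T.ker ≤ F := fun v hv => by
      have : v + S v = 0 := hv
      rw [eq_neg_of_add_eq_zero_left this]
      exact F.neg_mem ⟨v, rfl⟩
    have h2 : TF.ker.map F.subtype = T.ker := by
      ext v
      constructor
      · rintro ⟨w, hw, rfl⟩
        exact congrArg Subtype.val (show TF w = 0 from hw)
      · intro hv
        exact ⟨⟨v, hk hv⟩, Subtype.ext hv, rfl⟩
    rw [← h2]
    exact (LinearEquiv.finrank_eq (Submodule.equivMapOfInjective _ F.subtype_injective _))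
  have h2 : Module.finrank ℝ (U ⧸ T.range) = Module.finrank ℝ (F ⧸ TF.range) := by
    symm
    set q : F →ₗ[ℝ] U ⧸ T.range := T.range.mkQ ∘ₗ F.subtype
    have hq : Function.Surjective q := fun y => by
      obtain ⟨v, rfl⟩ := T.range.mkQ_surjective y
      refine ⟨⟨-S v, F.neg_mem ⟨v, rfl⟩⟩, (Submodule.Quotient.eq _).2 ⟨-v, ?_⟩⟩
      rw [hTa]
      simp
      abel
    have hk : q.ker = TF.range := by
      ext w
      rw [LinearMap.mem_ker]
      constructor
      · intro hw
        obtain ⟨v, hv⟩ := (Submodule.Quotient.mk_eq_zero _).1 hw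
        have hvF : v ∈ F := by
          have : v = (w : U) - S v := eq_sub_of_add_eq hv
          rw [this]
          exact F.sub_mem w.2 ⟨v, rfl⟩
        exact ⟨⟨v, hvF⟩, Subtype.ext hv⟩
      · rintro ⟨v, rfl⟩
        exact (Submodule.Quotient.mk_eq_zero _).2 ⟨v, rfl⟩
    rw [← hk]
    exact (q.quotKerEquivOfSurjective hq).finrank_eq
  rw [h1, h2]
  have h3 := TF.finrank_range_add_finrank_ker
  have h4 := TF.range.finrank_quotient_add_finrank
  omega

/-- A perturbation of an isomorphism by a limit of operators of finite rank is a Fredholm operator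
of index zero. -/
theorem isFredholm_of_mem_approximable [CompleteSpace X] [CompleteSpace Y] (e : X ≃L[ℝ] Y)
    {S : X →L[ℝ] Y} (hS : S ∈ approximableOperators X Y) :
    ((e : X →L[ℝ] Y) + S).IsFredholm ∧ Module.finrank ℝ ((e : X →L[ℝ] Y) + S).ker =
      Module.finrank ℝ (Y ⧸ ((e : X →L[ℝ] Y) + S).range) := by
  -- Isomorphisms form an open set: for `S'` of finite rank close enough to `S`, the operator `e + S
  -- - S'` is still an isomorphism `e'`.
  obtain ⟨e', S', hS', hT⟩ : ∃ (e' : X ≃L[ℝ] Y) (S' : X →L[ℝ] Y),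
      (S' : X →ₗ[ℝ] Y).HasFiniteRange ∧ (e : X →L[ℝ] Y) + S = e' + S' := by
    have h1 : Continuous fun R : X →L[ℝ] Y => (e : X →L[ℝ] Y) + S - R := by fun_prop
    have h2 : IsOpen ((fun R : X →L[ℝ] Y => (e : X →L[ℝ] Y) + S - R) ⁻¹'
        range ((↑) : (X ≃L[ℝ] Y) → X →L[ℝ] Y)) := ContinuousLinearEquiv.isOpen.preimage h1
    obtain ⟨R, ⟨e', he'⟩, hR⟩ := mem_closure_iff.1 hS _ h2 ⟨e, by simp⟩
    refine ⟨e', R, LinearMap.mem_finiteRange_iff_hasFiniteRange.1 hR, ?_⟩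
    rw [he']
    exact (sub_add_cancel _ _).symm
  rw [hT]
  set T : X →L[ℝ] Y := (e' : X →L[ℝ] Y) + S'
  constructor
  · refine ContinuousLinearMap.IsFredholm.of_isQuasiInverse (v := (e'.symm : Y →L[ℝ] X)) ?_
    refine e'.toLinearEquiv.isQuasiInverse.congr (LinearMap.FiniteRangeSetoid.setoid.refl _) ?_
    rw [LinearMap.FiniteRangeSetoid.equiv_iff_hasFiniteRange]
    have : (T : X →ₗ[ℝ] Y) - (e'.toLinearEquiv : X →ₗ[ℝ] Y) = S' := by
      ext v; simp [T]
    rw [this]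
    exact hS'
  · set S'' : Y →ₗ[ℝ] Y := (S' : X →ₗ[ℝ] Y) ∘ₗ (e'.symm.toLinearEquiv : Y →ₗ[ℝ] X)
    have h1 := finrank_ker_eq_finrank_coker_of_id_add S'' (hS'.comp_right _)
    have h2 : LinearMap.id + S'' = (T : X →ₗ[ℝ] Y) ∘ₗ (e'.symm.toLinearEquiv : Y →ₗ[ℝ] X) := by
      ext v; simp [T, S'']
    rw [h2, LinearMap.range_comp, LinearEquiv.range, Submodule.map_top] at h1
    rw [← h1, LinearMap.ker_comp]
    exact (LinearEquiv.finrank_eq (Submodule.comap_equiv_self_of_inj_of_le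
      (f := (e'.symm.toLinearEquiv : Y →ₗ[ℝ] X)) e'.symm.injective
      (fun v _ => ⟨e' v, by simp⟩))).symm

/-- Multiplication of a fixed square integrable function by constant vectors. -/
def smulConstL (g : PathSpace ℝ) : Y →L[ℝ] PathSpace Y :=
  ((ContinuousLinearMap.lsmul ℝ ℝ : ℝ →L[ℝ] Y →L[ℝ] Y).holderL
    (volume.restrict (Icc (0 : ℝ) 1)) 2 ⊤ 2 g) ∘L
      Lp.constL ⊤ (volume.restrict (Icc (0 : ℝ) 1)) ℝ

theorem coeFn_smulConstL (g : PathSpace ℝ) (y : Y) :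
    smulConstL g y =ᵐ[volume.restrict (Icc (0 : ℝ) 1)] fun t => g t • y := by
  have h1 := (ContinuousLinearMap.lsmul ℝ ℝ : ℝ →L[ℝ] Y →L[ℝ] Y).coeFn_holder (r := 2) g
    (Lp.constL ⊤ (volume.restrict (Icc (0 : ℝ) 1)) ℝ y)
  have h2 : Lp.constL ⊤ (volume.restrict (Icc (0 : ℝ) 1)) ℝ y
    =ᵐ[volume.restrict (Icc (0 : ℝ) 1)] fun _ => y := Lp.coeFn_const _ _ _
  filter_upwards [h1, h2] with t ht1 ht2
  refine ht1.trans ?_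
  rw [ht2]
  rfl

/-- The embedding of the Sobolev space `H¹` into `L²` is a limit of operators of finite rank. -/
theorem comp_primitiveL_mem_approximable [FiniteDimensional ℝ X] [FiniteDimensional ℝ Y]
    (j : (ℝ →ᵇ X) →L[ℝ] PathSpace Y) (l : X →L[ℝ] Y)
    (hj : ∀ f, j f =ᵐ[volume.restrict (Icc (0 : ℝ) 1)] fun t => l (f t)) :
    j ∘L primitiveL ∈ approximableOperators (PathSpace X) (PathSpace Y) := by
  set μ := volume.restrict (Icc (0 : ℝ) 1)
  have hA : ∀ n k : ℕ, MeasurableSet {t : ℝ | ⌊(n + 1 : ℝ) * t⌋₊ = k} := fun n k => by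
    have : Measurable fun t : ℝ => ⌊(n + 1 : ℝ) * t⌋₊ := by fun_prop
    exact this (measurableSet_singleton k)
  set g : ℕ → ℕ → PathSpace ℝ := fun n k => indicatorConstLp 2 (hA n k) (measure_ne_top μ _) 1
  have hg : ∀ n k, g n k =ᵐ[μ] fun t => if ⌊(n + 1 : ℝ) * t⌋₊ = k then 1 else 0 := fun n k => by
    filter_upwards [indicatorConstLp_coeFn (p := 2) (hs := hA n k) (hμs := measure_ne_top μ _)
      (c := (1 : ℝ))] with t ht
    rw [ht]
    by_cases h : ⌊(n + 1 : ℝ) * t⌋₊ = k <;> simp [h]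
  -- The approximants replace the primitive by its step function with values at `k / (n + 1)`. The
  -- index runs up to `n + 1`, since the floor of `(n + 1) t` takes that value at `t = 1`.
  set S : ℕ → PathSpace X →L[ℝ] PathSpace Y := fun n => ∑ k ∈ Finset.range (n + 2),
    smulConstL (g n k) ∘L l ∘L
      (BoundedContinuousFunction.evalCLM ℝ ((k : ℝ) / (n + 1))) ∘L primitiveL
  have hS : ∀ n, S n ∈ approximableOperators (PathSpace X) (PathSpace Y) := fun n =>
    Submodule.sum_mem _ fun k _ => comp_right_mem_approximable
      (mem_approximable_of_finiteDimensional_left _) _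
  have hbound : ∀ n, ‖j ∘L primitiveL - S n‖ ≤ √(1 / ((n : ℝ) + 1)) * ‖l‖ := fun n => by
    refine ContinuousLinearMap.opNorm_le_bound _ (by positivity) fun v => ?_
    have hSv : S n v = ∑ k ∈ Finset.range (n + 2),
        smulConstL (g n k) (l (primitiveL v ((k : ℝ) / (n + 1)))) := by
      simp only [S, sum_apply]; rfl
    have h1 : ∀ᵐ t ∂μ, ‖(j (primitiveL v) - S n v) t‖ ≤ √(1 / ((n : ℝ) + 1)) * ‖l‖ * ‖v‖ := by
      have h2 : ∀ᵐ t ∂μ, ∀ k, (smulConstL (g n k) (l (primitiveL v ((k : ℝ) / (n + 1)))) :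
          PathSpace Y) t = if ⌊(n + 1 : ℝ) * t⌋₊ = k then
            l (primitiveL v ((k : ℝ) / (n + 1))) else 0 := by
        rw [ae_all_iff]
        intro k
        filter_upwards [hg n k, coeFn_smulConstL (g n k) (l (primitiveL v ((k : ℝ) / (n + 1))))]
          with t ht1 ht2
        rw [ht2, ht1]
        split_ifs <;> simp
      have h3 : S n v =ᵐ[μ] fun t => ∑ k ∈ Finset.range (n + 2),
          (smulConstL (g n k) (l (primitiveL v ((k : ℝ) / (n + 1)))) : PathSpace Y) t := by
        rw [hSv]
        refine (Lp.coeFn_finsetSum (Finset.range (n + 2)) fun k =>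
          (smulConstL (g n k) (l (primitiveL v ((k : ℝ) / (n + 1)))) : PathSpace Y)).trans ?_
        exact Filter.Eventually.of_forall fun t => by simp
      filter_upwards [Lp.coeFn_sub (j (primitiveL v)) (S n v), hj (primitiveL v), h2, h3,
        ae_restrict_mem measurableSet_Icc] with t ht1 ht2 ht3 ht4 ht
      rw [ht1, Pi.sub_apply, ht2, ht4]
      simp only [ht3]
      have hn : (0 : ℝ) < n + 1 := by positivity
      have hk : ⌊(n + 1 : ℝ) * t⌋₊ ∈ Finset.range (n + 2) := by
        rw [Finset.mem_range]
        refine Nat.lt_succ_of_le (Nat.floor_le_of_le ?_)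
        push_cast
        nlinarith [ht.2]
      rw [Finset.sum_ite_eq, if_pos hk, ← map_sub]
      set k := ⌊(n + 1 : ℝ) * t⌋₊
      have hk1 : (k : ℝ) ≤ (n + 1) * t := Nat.floor_le (by have := ht.1; positivity)
      have hk2 : (n + 1) * t < (k : ℝ) + 1 := Nat.lt_floor_add_one _
      -- The sampling point is within `1 / (n + 1)` of `t`, so Hölder continuity bounds the error by
      -- `√(1 / (n + 1)) ‖v‖`, uniformly in `t`.
      have h5 : |t - (k : ℝ) / (n + 1)| ≤ 1 / (n + 1) := by
        have h6 : t - (k : ℝ) / (n + 1) = ((n + 1) * t - k) / (n + 1) := by field_simp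
        rw [h6, abs_of_nonneg (div_nonneg (by linarith) hn.le)]
        gcongr
        linarith
      calc _ ≤ ‖l‖ * ‖primitiveL v t - primitiveL v ((k : ℝ) / (n + 1))‖ := l.le_opNorm _
        _ ≤ ‖l‖ * (√(1 / ((n : ℝ) + 1)) * ‖v‖) := by
            gcongr
            exact (norm_primitiveL_sub_le v _ t).trans (by gcongr)
        _ = _ := by ring
    have h4 := Lp.norm_le_of_ae_bound (by positivity) h1
    have h5 : measureUnivNNReal μ = 1 := by simp [measureUnivNNReal, μ]
    rw [h5] at h4
    simpa using h4
  refine (Submodule.isClosed_topologicalClosure _).mem_of_tendsto (f := S)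
    (b := Filter.atTop) ?_ (Filter.Eventually.of_forall hS)
  rw [tendsto_iff_norm_sub_tendsto_zero]
  have h6 : Filter.Tendsto (fun n : ℕ => √(1 / ((n : ℝ) + 1)) * ‖l‖) Filter.atTop (𝓝 0) := by
    have := (tendsto_one_div_add_atTop_nhds_zero_nat (𝕜 := ℝ)).sqrt.mul_const ‖l‖
    simpa using this
  exact squeeze_zero (fun n => norm_nonneg _)
    (fun n => by rw [norm_sub_rev]; exact hbound n) h6

end Approximable

/-! ### Immersions into a flat space with a transversal bundle -/

section VectorValued

variable {B H X V V' : Type*} [NormedAddCommGroup B] [NormedSpace ℝ B] [TopologicalSpace H]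
  {I : ModelWithCorners ℝ B H} [TopologicalSpace X] [ChartedSpace H X]
  [NormedAddCommGroup V] [NormedSpace ℝ V] [NormedAddCommGroup V'] [NormedSpace ℝ V']

theorem HasMD.add {f g : X → V} {x : X} {f' g' : B →L[ℝ] V} (hf : HasMD I 𝓘(ℝ, V) f x f')
    (hg : HasMD I 𝓘(ℝ, V) g x g') : HasMD I 𝓘(ℝ, V) (fun y => f y + g y) x (f' + g') :=
  HasMFDerivAt.add hf hg

theorem HasMD.finsetSum {κ : Type*} {t : Finset κ} {f : κ → X → V} {x : X} {f' : κ → B →L[ℝ] V}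
    (h : ∀ i ∈ t, HasMD I 𝓘(ℝ, V) (f i) x (f' i)) :
    HasMD I 𝓘(ℝ, V) (fun y => ∑ i ∈ t, f i y) x (∑ i ∈ t, f' i) := by
  classical
  induction t using Finset.induction_on with
  | empty => simpa using hasMD_const
  | insert i t hi ih =>
    simp only [Finset.sum_insert hi]
    exact (h i (Finset.mem_insert_self i t)).add
      (ih fun j hj => h j (Finset.mem_insert_of_mem hj))

theorem HasMD.clm_apply {L : X → V →L[ℝ] V'} {f : X → V} {x : X} {L' : B →L[ℝ] V →L[ℝ] V'}
    {f' : B →L[ℝ] V} (hL : HasMD I 𝓘(ℝ, V →L[ℝ] V') L x L') (hf : HasMD I 𝓘(ℝ, V) f x f') :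
    HasMD I 𝓘(ℝ, V') (fun y => L y (f y)) x (L x ∘L f' + L'.flip (f x)) := by
  have h1 : HasFDerivWithinAt (L ∘ (extChartAt I x).symm) L' (range I) (extChartAt I x x) := hL.2
  have h2 : HasFDerivWithinAt (f ∘ (extChartAt I x).symm) f' (range I) (extChartAt I x x) := hf.2
  have h3 := h1.clm_apply h2
  simp only [Function.comp_apply, extChartAt_to_inv] at h3
  exact ⟨hL.1.clm_apply hf.1, h3⟩

theorem HasMD.clm_comp_left {f : X → V} {x : X} {f' : B →L[ℝ] V} (hf : HasMD I 𝓘(ℝ, V) f x f')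
    (L : V →L[ℝ] V') : HasMD I 𝓘(ℝ, V') (fun y => L (f y)) x (L ∘L f') :=
  (hasMD_iff_hasFDerivAt.2 L.hasFDerivAt).comp hf

theorem contMDiffOn_tangentBundle_vectorSpace {f : X → V} {s : ∀ q, TangentSpace 𝓘(ℝ, V) (f q)}
    {U : Set X} : ContMDiffOn I 𝓘(ℝ, V).tangent ∞
      (fun q => (⟨f q, s q⟩ : TangentBundle 𝓘(ℝ, V) V)) U ↔
      ContMDiffOn I 𝓘(ℝ, V) ∞ f U ∧ ContMDiffOn I 𝓘(ℝ, V) ∞ (fun q => (s q : V)) U := by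
  refine Iff.trans (forall₂_congr fun x hx => Bundle.contMDiffWithinAt_totalSpace) ?_
  simp only [trivializationAt_model_space_apply]
  exact forall₂_and

end VectorValued

/-! ### Immersion, shape operators and end-point map from a transversal frame -/

section Transversal

variable {B X V : Type*} [NormedAddCommGroup B] [NormedSpace ℝ B] [TopologicalSpace X]
  [ChartedSpace B X] [NormedAddCommGroup V] [NormedSpace ℝ V]

/-- The sums of a tangent vector and a transversal vector. -/
theorem exists_equiv_of_isCompl [CompleteSpace B] [CompleteSpace V] {D : B →L[ℝ] V}
    (hD : Function.Injective D) {W : Submodule ℝ V} (hW : IsCompl D.range W) {r : ℕ}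
    {s : Fin r → V} (hs : LinearIndependent ℝ s) (hsW : Submodule.span ℝ (range s) = W) :
    ∃ e : (B × (Fin r → ℝ)) ≃L[ℝ] V, ∀ b c, e (b, c) = D b + ∑ i, c i • s i := by
  set L : (Fin r → ℝ) →L[ℝ] V := ∑ i, (ContinuousLinearMap.proj i).smulRight (s i)
  have hL : ∀ c, L c = ∑ i, c i • s i := fun c => by simp [L, sum_apply]
  have hLW : ∀ c, L c ∈ W := fun c => by
    rw [hL, ← hsW]
    exact Submodule.sum_mem _ fun i _ => Submodule.smul_mem _ _ (Submodule.subset_span ⟨i, rfl⟩)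
  have hker : (D.coprod L).ker = ⊥ := by
    rw [Submodule.eq_bot_iff]
    rintro ⟨b, c⟩ h
    have h0 : D b + L c = 0 := by simpa using h
    have h1 : D b ∈ W := by
      rw [eq_neg_of_add_eq_zero_left h0]
      exact W.neg_mem (hLW c)
    have h2 : D b = 0 := (Submodule.disjoint_def.1 hW.disjoint) _ ⟨b, rfl⟩ h1
    have h3 : L c = 0 := by rwa [h2, zero_add] at h0
    rw [hL] at h3
    have h4 : c = 0 := funext fun i => Fintype.linearIndependent_iff.1 hs c h3 i
    rw [h4, hD (h2.trans D.map_zero.symm)]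
    rfl
  have hrange : (D.coprod L).range = ⊤ := by
    rw [eq_top_iff, ← hW.sup_eq_top]
    refine sup_le ?_ ?_
    · rintro _ ⟨b, rfl⟩
      exact ⟨(b, 0), by simp⟩
    · rw [← hsW, Submodule.span_le]
      rintro _ ⟨i, rfl⟩
      refine ⟨(0, Pi.single i 1), ?_⟩
      simp [hL, Pi.single_apply]
  refine ⟨.ofBijective (D.coprod L) hker hrange, fun b c => ?_⟩
  rw [← hL]
  simp

/-- A section of a transversal bundle that vanishes at `p` has a derivative at `p` with values in
the bundle. -/
theorem mder_section_mem_of_eq_zero [CompleteSpace B] [CompleteSpace V] {f : X → V}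
    {W : X → Submodule ℝ V} {p : X} (hD : Function.Injective (mder 𝓘(ℝ, B) 𝓘(ℝ, V) f p))
    (hW : IsCompl (mder 𝓘(ℝ, B) 𝓘(ℝ, V) f p).range (W p)) {U : Set X} (hU : IsOpen U) (hp : p ∈ U)
    {r : ℕ} {s : Fin r → X → V} (hs : ∀ i, ContMDiffOn 𝓘(ℝ, B) 𝓘(ℝ, V) ∞ (s i) U)
    (hsl : LinearIndependent ℝ fun i => s i p)
    (hsW : ∀ q ∈ U, Submodule.span ℝ (range fun i => s i q) = W q)
    {τ : X → V} (hτ : ContMDiffAt 𝓘(ℝ, B) 𝓘(ℝ, V) ∞ τ p) (hτW : ∀ᶠ q in 𝓝 p, τ q ∈ W q)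
    (hτp : τ p = 0) (b : B) : mder 𝓘(ℝ, B) 𝓘(ℝ, V) τ p b ∈ W p := by
  obtain ⟨e, he⟩ := exists_equiv_of_isCompl hD hW hsl (hsW p hp)
  -- `l` reads off the frame coefficients at `p` but is defined on all of `V`. As `l ∘ S p` is the
  -- identity, `l ∘ S q` is invertible near `p`, so `τ = S g` with smooth coefficients `g q = (l ∘ S
  -- q)⁻¹ (l (τ q))`. Since `g p = 0`, the derivative of `τ` at `p` is `S p ∘ dg`, with values in `W
  -- p`.
  set l : V →L[ℝ] (Fin r → ℝ) := ContinuousLinearMap.snd ℝ B (Fin r → ℝ) ∘L (e.symm : V →L[ℝ] _)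
  set S : X → (Fin r → ℝ) →L[ℝ] V := fun q =>
    ∑ i, (ContinuousLinearMap.proj (R := ℝ) (φ := fun _ : Fin r => ℝ) i).smulRight (s i q)
  have hSa : ∀ q c, S q c = ∑ i, c i • s i q := fun q c => by simp [S, sum_apply]
  have hSW : ∀ q ∈ U, ∀ w ∈ W q, ∃ c, S q c = w := fun q hq w hw => by
    rw [← hsW q hq, Submodule.mem_span_range_iff_exists_fun] at hw
    obtain ⟨c, hc⟩ := hw
    exact ⟨c, (hSa q c).trans hc⟩
  have hlS : l ∘L S p = ContinuousLinearMap.id ℝ (Fin r → ℝ) := by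
    refine ContinuousLinearMap.ext fun c => ?_
    have h1 : S p c = e (0, c) := by rw [he, hSa]; simp
    change (e.symm (S p c)).2 = c
    rw [h1, e.symm_apply_apply]
  have hSs : ContMDiffAt 𝓘(ℝ, B) 𝓘(ℝ, (Fin r → ℝ) →L[ℝ] V) ∞ S p := by
    refine contMDiffAt_finsetSum fun i _ => ?_
    have h1 := (hs i).contMDiffAt (hU.mem_nhds hp)
    exact (((ContinuousLinearMap.smulRightL ℝ (Fin r → ℝ) V
      (ContinuousLinearMap.proj i)).contDiff (n := ∞)).contMDiff.contMDiffAt).comp p h1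
  have hls : ContMDiffAt 𝓘(ℝ, B) 𝓘(ℝ, (Fin r → ℝ) →L[ℝ] (Fin r → ℝ)) ∞ (fun q => l ∘L S q) p :=
    (((ContinuousLinearMap.compL ℝ (Fin r → ℝ) V (Fin r → ℝ) l).contDiff
      (n := ∞)).contMDiff.contMDiffAt).comp p hSs
  set Ri : X → (Fin r → ℝ) →L[ℝ] (Fin r → ℝ) := fun q => ContinuousLinearMap.inverse (l ∘L S q)
  have hRs : ContMDiffAt 𝓘(ℝ, B) 𝓘(ℝ, (Fin r → ℝ) →L[ℝ] (Fin r → ℝ)) ∞ Ri p := by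
    have h1 : ContDiffAt ℝ ∞ (ContinuousLinearMap.inverse :
        ((Fin r → ℝ) →L[ℝ] (Fin r → ℝ)) → _) (l ∘L S p) := by
      rw [hlS]
      exact contDiffAt_map_inverse (ContinuousLinearEquiv.refl ℝ (Fin r → ℝ))
    exact h1.contMDiffAt.comp p hls
  have hRp : Ri p = ContinuousLinearMap.id ℝ _ := by
    simp only [Ri, hlS]
    exact ContinuousLinearMap.inverse_equiv (ContinuousLinearEquiv.refl ℝ (Fin r → ℝ))
  set g : X → Fin r → ℝ := fun q => Ri q (l (τ q))
  have hτ1 := hτ.hasMD (by simp)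
  have hg1 : HasMD 𝓘(ℝ, B) 𝓘(ℝ, Fin r → ℝ) g p _ := (hRs.hasMD (by simp)).clm_apply (hτ1.clm_comp_left l)
  have hgp : g p = 0 := by simp [g, hτp]
  have hfin : HasMD 𝓘(ℝ, B) 𝓘(ℝ, V) (fun q => S q (g q)) p _ := (hSs.hasMD (by simp)).clm_apply hg1
  have hinv : ∀ᶠ q in 𝓝 p, τ q = S q (g q) := by
    have h1 : ∀ᶠ q in 𝓝 p, l ∘L S q ∈ range ((↑) : ((Fin r → ℝ) ≃L[ℝ] (Fin r → ℝ)) →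
        (Fin r → ℝ) →L[ℝ] (Fin r → ℝ)) :=
      hls.continuousAt.eventually (ContinuousLinearEquiv.isOpen.mem_nhds
        ⟨ContinuousLinearEquiv.refl ℝ _, hlS.symm⟩)
    filter_upwards [h1, hτW, hU.mem_nhds hp] with q ⟨e', he'⟩ hq hqU
    obtain ⟨c, hc⟩ := hSW q hqU _ hq
    have h2 : g q = c := by
      have h3 : l (τ q) = e' c := by rw [← hc]; exact (DFunLike.congr_fun he' c).symm
      simp only [g, Ri, h3, ← he', ContinuousLinearMap.inverse_equiv]
      exact e'.symm_apply_apply c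
    rw [h2, hc]
  rw [(hfin.congr hinv).mder_eq]
  simp only [hgp, map_zero, add_zero]
  rw [← hsW p hp]
  change S p _ ∈ _
  rw [hSa]
  exact Submodule.sum_mem _ fun i _ => Submodule.smul_mem _ _ (Submodule.subset_span ⟨i, rfl⟩)

theorem IsTransversalBundle.exists_frame_vectorSpace {f : X → V} {W : X → Submodule ℝ V}
    (hW : IsTransversalBundle B (E₂ := V) f W) (p : X) : ∃ (U : Set X) (r : ℕ) (s : Fin r → X → V),
      IsOpen U ∧ p ∈ U ∧ (∀ i, ContMDiffOn 𝓘(ℝ, B) 𝓘(ℝ, V) ∞ (s i) U) ∧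
      (∀ q ∈ U, LinearIndependent ℝ fun i => s i q) ∧
      ∀ q ∈ U, Submodule.span ℝ (range fun i => s i q) = W q := by
  obtain ⟨U, hpU, r, s, hs⟩ := hW.exists_frame p
  exact ⟨U, r, s, hs.isOpen, hpU,
    fun i => (contMDiffOn_tangentBundle_vectorSpace.1 (hs.contMDiffOn i)).2,
    hs.linearIndependent, hs.span_eq⟩

/-- A frame of `W p` completes `df` to an isomorphism. The rank `k` is the same at all points
because an immersion has one complement for the whole manifold. -/
theorem isImmersion_of_isTransversalBundle [CompleteSpace B] [CompleteSpace V]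
    [IsManifold 𝓘(ℝ, B) ∞ X] {f : X → V} {W : X → Submodule ℝ V}
    (hf : ContMDiff 𝓘(ℝ, B) 𝓘(ℝ, V) ∞ f)
    (hD : ∀ p, Function.Injective (mder 𝓘(ℝ, B) 𝓘(ℝ, V) f p))
    (hW : ∀ p, IsCompl (mder 𝓘(ℝ, B) 𝓘(ℝ, V) f p).range (W p)) (k : ℕ)
    (hk : ∀ p, ∃ s : Fin k → V, LinearIndependent ℝ s ∧ Submodule.span ℝ (range s) = W p) :
    IsImmersion 𝓘(ℝ, B) 𝓘(ℝ, V) ∞ f := by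
  have h : IsImmersionOfComplement (Fin k → ℝ) 𝓘(ℝ, B) 𝓘(ℝ, V) ∞ f := fun p => by
    obtain ⟨s, hs, hsW⟩ := hk p
    obtain ⟨e, he⟩ := exists_equiv_of_isCompl (hD p) (hW p) hs hsW
    exact isImmersionAtOfComplement_of_equiv hf e fun b => by rw [he]; simp
  exact h.isImmersion

/-- If the derivatives of the sections of the transversal bundle are limits of operators of finite
rank, then so are the shape operators. -/
theorem hasCompactShapeOperators_of_approximable [CompleteSpace B] [CompleteSpace V]
    {f : X → V} {W : X → Submodule ℝ V}
    (hD : ∀ p, Function.Injective (mder 𝓘(ℝ, B) 𝓘(ℝ, V) f p))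
    (hW : IsTransversalBundle B (E₂ := V) f W)
    (happ : ∀ (U : Set X) (s : X → V), IsOpen U → ContMDiffOn 𝓘(ℝ, B) 𝓘(ℝ, V) ∞ s U →
      (∀ q ∈ U, s q ∈ W q) → ∀ p ∈ U, mder 𝓘(ℝ, B) 𝓘(ℝ, V) s p ∈ approximableOperators B V) :
    HasCompactShapeOperators B f W := by
  intro p ξ hξ
  obtain ⟨U, r, s, hUo, hpU, hsU, hslin, hspan⟩ := hW.exists_frame_vectorSpace p
  have hcompl : IsCompl (mder 𝓘(ℝ, B) 𝓘(ℝ, V) f p).range (W p) := hW.isCompl p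
  have hlin := hslin p hpU
  obtain ⟨e, he⟩ := exists_equiv_of_isCompl (hD p) hcompl hlin (hspan p hpU)
  obtain ⟨c, hc⟩ : ∃ c : Fin r → ℝ, ∑ i, c i • s i p = ξ := by
    rw [← hspan p hpU] at hξ
    exact (Submodule.mem_span_range_iff_exists_fun ℝ).1 hξ
  -- An extension of `ξ` to a section, with constant coefficients in the frame; minus the tangential
  -- part of its derivative is the shape operator.
  set σ : X → V := fun q => ∑ i, c i • s i q
  have hσ : ContMDiffOn 𝓘(ℝ, B) 𝓘(ℝ, V) ∞ σ U :=
    contMDiffOn_finsetSum fun i _ =>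
      ((c i • ContinuousLinearMap.id ℝ V).contDiff (n := ∞)).contMDiff.comp_contMDiffOn (hsU i)
  have hσW : ∀ q ∈ U, σ q ∈ W q := fun q hq => by
    rw [← hspan q hq]
    exact Submodule.sum_mem _ fun i _ => Submodule.smul_mem _ _ (Submodule.subset_span ⟨i, rfl⟩)
  set A : B →L[ℝ] B := -((ContinuousLinearMap.fst ℝ B (Fin r → ℝ) ∘L (e.symm : V →L[ℝ] _)) ∘L
    mder 𝓘(ℝ, B) 𝓘(ℝ, V) σ p)
  have hA : A ∈ approximableOperators B B := Submodule.neg_mem _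
    (comp_left_mem_approximable (happ U σ hUo hσ hσW p hpU) _)
  have hAc : IsCompactOperator A := isCompactOperator_of_mem_approximable hA
  refine ⟨A, ?_, hAc⟩
  refine fun U' s' hU' hpU' hs' hs'W hs'p (b : B) => ?_
  change mder 𝓘(ℝ, B) 𝓘(ℝ, V) s' p b + mder 𝓘(ℝ, B) 𝓘(ℝ, V) f p (A b) ∈ W p
  have hs'p1 := hs'.contMDiffAt (hU'.mem_nhds hpU')
  have hσp1 := hσ.contMDiffAt (hUo.mem_nhds hpU)
  -- Independence of the extension: the difference of two sections through `ξ` vanishes at `p`, so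
  -- its derivative has no tangential part.
  have h1 : mder 𝓘(ℝ, B) 𝓘(ℝ, V) (fun q => s' q - σ q) p b ∈ W p := by
    refine mder_section_mem_of_eq_zero (hD p) hcompl hUo hpU hsU hlin hspan
      (hs'p1.sub hσp1) ?_ (by rw [hs'p]; exact sub_eq_zero.2 hc.symm) b
    filter_upwards [hU'.mem_nhds hpU', hUo.mem_nhds hpU] with q hq hq'
    exact Submodule.sub_mem _ (hs'W q hq) (hσW q hq')
  have h2 : mder 𝓘(ℝ, B) 𝓘(ℝ, V) (fun q => s' q - σ q) p b =
      mder 𝓘(ℝ, B) 𝓘(ℝ, V) s' p b - mder 𝓘(ℝ, B) 𝓘(ℝ, V) σ p b := by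
    have h3 : HasMD 𝓘(ℝ, B) 𝓘(ℝ, V) (fun q => s' q - σ q) p _ :=
      HasMFDerivAt.sub (hs'p1.hasMD (by simp)) (hσp1.hasMD (by simp))
    rw [h3.mder_eq]
    rfl
  have h4 : mder 𝓘(ℝ, B) 𝓘(ℝ, V) σ p b + mder 𝓘(ℝ, B) 𝓘(ℝ, V) f p (A b) ∈ W p := by
    set y := e.symm (mder 𝓘(ℝ, B) 𝓘(ℝ, V) σ p b)
    have h5 : mder 𝓘(ℝ, B) 𝓘(ℝ, V) σ p b = mder 𝓘(ℝ, B) 𝓘(ℝ, V) f p y.1 + ∑ i, y.2 i • s i p := by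
      rw [← he, Prod.mk.eta, e.apply_symm_apply]
    have h6 : A b = -y.1 := rfl
    rw [h6, map_neg, h5, add_right_comm, add_neg_cancel, zero_add, ← hspan p hpU]
    exact Submodule.sum_mem _ fun i _ => Submodule.smul_mem _ _ (Submodule.subset_span ⟨i, rfl⟩)
  have h7 := (W p).add_mem h1 h4
  rw [h2] at h7
  convert h7 using 1
  abel

/-- If the derivatives of the sections of the transversal bundle are limits of operators of finite
rank, then the end-point map is a Fredholm map of index zero. -/
theorem hasFredholmEndPointMap_of_approximable [CompleteSpace B] [CompleteSpace V]
    {f : X → V} {W : X → Submodule ℝ V} (hf : ContMDiff 𝓘(ℝ, B) 𝓘(ℝ, V) ∞ f)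
    (hD : ∀ p, Function.Injective (mder 𝓘(ℝ, B) 𝓘(ℝ, V) f p))
    (hW : ∀ p, IsCompl (mder 𝓘(ℝ, B) 𝓘(ℝ, V) f p).range (W p))
    (happ : ∀ (U : Set X) (s : X → V), IsOpen U → ContMDiffOn 𝓘(ℝ, B) 𝓘(ℝ, V) ∞ s U →
      (∀ q ∈ U, s q ∈ W q) → ∀ p ∈ U, mder 𝓘(ℝ, B) 𝓘(ℝ, V) s p ∈ approximableOperators B V) :
    HasFredholmEndPointMap B f W := by
  intro U r s hs p hpU c
  have hsU : ∀ i, ContMDiffOn 𝓘(ℝ, B) 𝓘(ℝ, V) ∞ (s i) U := fun i =>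
    (contMDiffOn_tangentBundle_vectorSpace.1 (hs.contMDiffOn i)).2
  have hspan : ∀ q ∈ U, Submodule.span ℝ (range fun i => s i q) = W q := hs.span_eq
  obtain ⟨e, he⟩ := exists_equiv_of_isCompl (hD p) (hW p) (hs.linearIndependent p hpU) (hspan p hpU)
  have hsd : ∀ i, HasMD 𝓘(ℝ, B) 𝓘(ℝ, V) (s i) p (mder 𝓘(ℝ, B) 𝓘(ℝ, V) (s i) p) := fun i =>
    ((hsU i).contMDiffAt (hs.isOpen.mem_nhds hpU)).hasMD (by simp)
  -- The product rule leaves two parts: the isomorphism `e` from tangent and fibre directions, and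
  -- `S` from moving the frame at fixed coefficients `c`.
  set S : B × (Fin r → ℝ) →L[ℝ] V :=
    (∑ i, c i • mder 𝓘(ℝ, B) 𝓘(ℝ, V) (s i) p) ∘L ContinuousLinearMap.fst ℝ B (Fin r → ℝ)
  have hS : S ∈ approximableOperators (B × (Fin r → ℝ)) V := by
    refine comp_right_mem_approximable (Submodule.sum_mem _ fun i _ => Submodule.smul_mem _ _ ?_) _
    refine happ U (s i) hs.isOpen (hsU i) (fun q hq => ?_) p hpU
    rw [← hspan q hq]
    exact Submodule.subset_span ⟨i, rfl⟩
  have hT : mder (𝓘(ℝ, B).prod 𝓘(ℝ, Fin r → ℝ)) 𝓘(ℝ, V) (endPointMap f s) (p, c) =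
      (e : B × (Fin r → ℝ) →L[ℝ] V) + S := by
    have h1 : HasMD (𝓘(ℝ, B).prod 𝓘(ℝ, Fin r → ℝ)) 𝓘(ℝ, V)
        (fun x : X × (Fin r → ℝ) => f x.1) (p, c) _ :=
      HasMD.comp (I₂ := 𝓘(ℝ, B)) (f := Prod.fst) (x := (p, c))
        (hf.contMDiffAt.hasMD (by simp)) hasMD_fst
    have h2 : ∀ i, HasMD (𝓘(ℝ, B).prod 𝓘(ℝ, Fin r → ℝ)) 𝓘(ℝ, V)
        (fun x : X × (Fin r → ℝ) => x.2 i • s i x.1) (p, c)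
        (c i • (mder 𝓘(ℝ, B) 𝓘(ℝ, V) (s i) p ∘L ContinuousLinearMap.fst ℝ B (Fin r → ℝ)) +
          ((ContinuousLinearMap.proj (R := ℝ) (φ := fun _ : Fin r => ℝ) i) ∘L
            ContinuousLinearMap.snd ℝ B (Fin r → ℝ)).smulRight (s i p)) := fun i => by
      have h3 : HasMD (𝓘(ℝ, B).prod 𝓘(ℝ, Fin r → ℝ)) 𝓘(ℝ, V)
          (fun x : X × (Fin r → ℝ) => s i x.1) (p, c) _ :=
        HasMD.comp (I₂ := 𝓘(ℝ, B)) (f := Prod.fst) (x := (p, c)) (hsd i) hasMD_fst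
      have h4 : HasMD (𝓘(ℝ, B).prod 𝓘(ℝ, Fin r → ℝ)) 𝓘(ℝ, V →L[ℝ] V)
          (fun x : X × (Fin r → ℝ) => x.2 i • ContinuousLinearMap.id ℝ V) (p, c) _ :=
        (HasMD.comp (I₂ := 𝓘(ℝ, Fin r → ℝ)) (f := Prod.snd) (x := (p, c))
          (hasMD_iff_hasFDerivAt.2 ((ContinuousLinearMap.proj (R := ℝ)
            (φ := fun _ : Fin r => ℝ) i).hasFDerivAt)) hasMD_snd).clm_comp_left
          (ContinuousLinearMap.smulRight (1 : ℝ →L[ℝ] ℝ) (ContinuousLinearMap.id ℝ V))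
      refine (h4.clm_apply h3).congr_deriv (ContinuousLinearMap.ext fun v => ?_)
      simp
    have h5 : HasMD (𝓘(ℝ, B).prod 𝓘(ℝ, Fin r → ℝ)) 𝓘(ℝ, V)
        (fun x : X × (Fin r → ℝ) => ∑ i, x.2 i • s i x.1) (p, c) _ :=
      HasMD.finsetSum fun i _ => h2 i
    refine (h1.add h5).mder_eq.trans (ContinuousLinearMap.ext fun v => ?_)
    have h6 : e v = mder 𝓘(ℝ, B) 𝓘(ℝ, V) f p v.1 + ∑ i, v.2 i • s i p := he v.1 v.2
    simp only [add_apply, ContinuousLinearEquiv.coe_coe, h6, S]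
    simp [sum_apply, Finset.sum_add_distrib]
    abel
  change (mder (𝓘(ℝ, B).prod 𝓘(ℝ, Fin r → ℝ)) 𝓘(ℝ, V) (endPointMap f s) (p, c)).IsFredholm ∧
    Module.finrank ℝ (mder (𝓘(ℝ, B).prod 𝓘(ℝ, Fin r → ℝ)) 𝓘(ℝ, V) (endPointMap f s) (p, c)).ker =
    Module.finrank ℝ
      (V ⧸ (mder (𝓘(ℝ, B).prod 𝓘(ℝ, Fin r → ℝ)) 𝓘(ℝ, V) (endPointMap f s) (p, c)).range)
  rw [hT]
  exact isFredholm_of_mem_approximable e hS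

end Transversal

/-! ### Sections of the horizontal distribution -/

section HorizontalSections

open scoped BoundedContinuousFunction

variable {E : Type*} [NormedAddCommGroup E] [NormedSpace ℝ E] [FiniteDimensional ℝ E]
  {G : Type*} [TopologicalSpace G] [ChartedSpace E G] [Group G] [LieGroup 𝓘(ℝ, E) ∞ G] [T2Space G]

/-- The derivative in the direction `v` is `-Ad(g_u)⁻¹ ∫ ad(Ad(g_u) v) Z`: bounded operators on
either side of the passage from `L²` to its primitives in `L²`. -/
theorem approximable_fderiv_horizontalR (u : PathSpace E) (Z : E) :
    (fderiv ℝ (horizontalR G : PathSpace E → _) u).flip Z ∈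
      approximableOperators (PathSpace E) (PathSpace E) := by
  set D : PathSpace E →L[ℝ] (ℝ →ᵇ (E →L[ℝ] E)) :=
    -((ContinuousLinearMap.mul ℝ (ℝ →ᵇ (E →L[ℝ] E))) (adTransportInv G u)).comp
        (((volterraAd G).flip 1).comp (mulOp (adTransport G u)))
  have h1 : HasFDerivAt (fun u : PathSpace E => mulOp (adTransportInv G u)) (mulOp ∘L D) u :=
    (mulOp (X := E) (Y := E)).hasFDerivAt.comp u (hasFDerivAt_adTransportInv u)
  have h2 : HasFDerivAt (horizontalR G : PathSpace E → _)
      (((ContinuousLinearMap.compL ℝ E (PathSpace E) (PathSpace E)).flip (constPath E)) ∘L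
        (mulOp ∘L D)) u :=
    ((ContinuousLinearMap.compL ℝ E (PathSpace E) (PathSpace E)).flip
      (constPath E)).hasFDerivAt.comp u h1
  set j : (ℝ →ᵇ (E →L[ℝ] E)) →L[ℝ] PathSpace E := mulOp.flip (constPath E Z)
  have hj : j ∘L primitiveL ∈ approximableOperators (PathSpace (E →L[ℝ] E)) (PathSpace E) := by
    refine comp_primitiveL_mem_approximable j (ContinuousLinearMap.apply ℝ E Z) fun f => ?_
    filter_upwards [coeFn_mulOp f (constPath E Z), coeFn_constPath Z] with t ht1 ht2
    refine ht1.trans ?_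
    rw [ht2]
    rfl
  have h3 : (fderiv ℝ (horizontalR G : PathSpace E → _) u).flip Z =
      -((mulOp (adTransportInv G u)) ∘L ((j ∘L primitiveL) ∘L
        (pairAd G 1 ∘L mulOp (adTransport G u)))) := by
    rw [h2.fderiv]
    refine ContinuousLinearMap.ext fun v => ?_
    change mulOp (-(adTransportInv G u * primitiveL (pairAd G 1 (mulOp (adTransport G u) v))))
      (constPath E Z) = -(mulOp (adTransportInv G u) (mulOp
        (primitiveL (pairAd G 1 (mulOp (adTransport G u) v))) (constPath E Z)))
    rw [map_neg, ← mulOp_mul]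
    rfl
  rw [h3]
  exact Submodule.neg_mem _ (comp_left_mem_approximable (comp_right_mem_approximable hj _) _)

/-- The derivatives of horizontal vector fields along a map are limits of operators of finite
rank. -/
theorem approximable_mder_of_horizontal {B X : Type*} [NormedAddCommGroup B] [NormedSpace ℝ B]
    [TopologicalSpace X] [ChartedSpace B X] {f s : X → PathSpace E} {U : Set X} (hU : IsOpen U)
    (hf : ContMDiffOn 𝓘(ℝ, B) 𝓘(ℝ, PathSpace E) ∞ f U)
    (hs : ContMDiffOn 𝓘(ℝ, B) 𝓘(ℝ, PathSpace E) ∞ s U)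
    (hsf : ∀ q ∈ U, s q ∈ (horizontalR G (f q)).range) {p : X} (hp : p ∈ U) :
    mder 𝓘(ℝ, B) 𝓘(ℝ, PathSpace E) s p ∈ approximableOperators B (PathSpace E) := by
  have hfp := hf.contMDiffAt (hU.mem_nhds hp)
  have hsp := hs.contMDiffAt (hU.mem_nhds hp)
  -- `transportForm` recovers the coefficient of a horizontal vector, so `z` is smooth and `s =
  -- horizontalR z` on `U`.
  set z : X → E := fun q => transportForm G (f q) (s q)
  have hz : ContMDiffAt 𝓘(ℝ, B) 𝓘(ℝ, E) ∞ z p :=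
    ((contDiff_transportForm (G := G) (E := E)).contMDiff.contMDiffAt.comp p hfp).clm_apply hsp
  have h1 : HasMD 𝓘(ℝ, B) 𝓘(ℝ, E →L[ℝ] PathSpace E) (fun q => horizontalR G (f q)) p _ :=
    (hasMD_iff_hasFDerivAt.2 ((contDiff_horizontalR (G := G) (E := E)).differentiable
      (by simp)).differentiableAt.hasFDerivAt).comp (hfp.hasMD (by simp))
  have h2 := h1.clm_apply (hz.hasMD (by simp))
  have h3 : ∀ᶠ q in 𝓝 p, s q = horizontalR G (f q) (z q) := by
    filter_upwards [hU.mem_nhds hp] with q hq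
    obtain ⟨Z, hZ⟩ := hsf q hq
    have hZ' : horizontalR G (f q) Z = s q := hZ
    simp only [z, ← hZ', transportForm_horizontalR]
  rw [(h2.congr h3).mder_eq]
  -- The derivative of `z` passes through the finite-dimensional `𝔤`; the derivative of
  -- `horizontalR` with `z p` held fixed is approximable by the previous lemma.
  refine Submodule.add_mem _ ?_ ?_
  · exact comp_right_mem_approximable
      (mem_approximable_of_finiteDimensional_left (horizontalR G (f p))) _
  · exact comp_right_mem_approximable (approximable_fderiv_horizontalR (G := G) (f p) (z p))
      (mder 𝓘(ℝ, B) 𝓘(ℝ, PathSpace E) f p)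

end HorizontalSections

/-! ### Horizontal lifts -/

section HorizontalLift

variable {E : Type*} [NormedAddCommGroup E] [NormedSpace ℝ E] [FiniteDimensional ℝ E]
  {G : Type*} [TopologicalSpace G] [ChartedSpace E G] [Group G] [LieGroup 𝓘(ℝ, E) ∞ G] [T2Space G]
  {K : Subgroup G} {E' : Type*} [NormedAddCommGroup E'] [NormedSpace ℝ E'] [FiniteDimensional ℝ E']
  [ChartedSpace E' (G ⧸ K)] [IsManifold 𝓘(ℝ, E') ∞ (G ⧸ K)]

variable (K E') in
/-- The inverse of the isomorphism `𝔭 → T (G/K)` at `a`. -/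
def liftP (𝔭 : Submodule ℝ E) (a : G) : E' →L[ℝ] E :=
  𝔭.subtypeL ∘L (projL E K E' a ∘L 𝔭.subtypeL).inverse

variable (K E') in
/-- The horizontal lift of tangent vectors of `G/K` to the path space. -/
def horizontalLift (𝔭 : Submodule ℝ E) (u : PathSpace E) : E' →L[ℝ] PathSpace E :=
  horizontalL G u ∘L liftP K E' 𝔭 (parallelTransport G u)

theorem liftP_mem (𝔭 : Submodule ℝ E) (a : G) (w : E') : liftP K E' 𝔭 a w ∈ 𝔭 := Subtype.property _

variable (hπ : IsSubmersion 𝓘(ℝ, E) 𝓘(ℝ, E') ∞ (fun a : G => (a : G ⧸ K)))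

include hπ

theorem hasMD_parallelTransportQuotient (u : PathSpace E) :
    HasMD 𝓘(ℝ, PathSpace E) 𝓘(ℝ, E') (parallelTransportQuotient K) u
      (projL E K E' (parallelTransport G u) ∘L transportFormLeft G u) :=
  (hasMD_proj hπ (parallelTransport G u)).comp (hasMD_parallelTransport u)

theorem contMDiff_parallelTransportQuotient :
    ContMDiff 𝓘(ℝ, PathSpace E) 𝓘(ℝ, E') ∞ (parallelTransportQuotient (G := G) (E := E) K) :=
  hπ.contMDiff.comp contMDiff_parallelTransport

variable {𝔭 : Submodule ℝ E} (h𝔭 : IsCompl (projL E K E' (1 : G)).ker 𝔭)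

include h𝔭

theorem exists_projL_equiv (a : G) :
    ∃ e : 𝔭 ≃L[ℝ] E', (e : 𝔭 →L[ℝ] E') = projL E K E' a ∘L 𝔭.subtypeL := by
  rw [← ker_projL hπ a] at h𝔭
  set L := projL E K E' a ∘L 𝔭.subtypeL
  have hinj : Function.Injective (L : 𝔭 →ₗ[ℝ] E') := by
    rw [← LinearMap.ker_eq_bot, Submodule.eq_bot_iff]
    intro Y hY
    have h1 : projL E K E' a Y = 0 := hY
    exact Subtype.ext (Submodule.disjoint_def.1 h𝔭.disjoint _ h1 Y.2)
  have hsurj : Function.Surjective (L : 𝔭 →ₗ[ℝ] E') := fun w => by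
    obtain ⟨Z, rfl⟩ := projL_surjective hπ a w
    obtain ⟨X, hX, Y, hY, rfl⟩ := Submodule.mem_sup.1
      (h𝔭.sup_eq_top.symm ▸ Submodule.mem_top : Z ∈ (projL E K E' a).ker ⊔ 𝔭)
    refine ⟨⟨Y, hY⟩, ?_⟩
    change projL E K E' a Y = projL E K E' a (X + Y)
    rw [map_add, show projL E K E' a X = 0 from hX, zero_add]
  exact ⟨(LinearEquiv.ofBijective (L : 𝔭 →ₗ[ℝ] E') ⟨hinj, hsurj⟩).toContinuousLinearEquiv,
    ContinuousLinearMap.ext fun _ => rfl⟩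

theorem projL_liftP (a : G) (w : E') : projL E K E' a (liftP K E' 𝔭 a w) = w := by
  obtain ⟨e, he⟩ := exists_projL_equiv hπ h𝔭 a
  rw [liftP, ← he, ContinuousLinearMap.inverse_equiv]
  have h1 : projL E K E' a (e.symm w : 𝔭) = e (e.symm w) := (DFunLike.congr_fun he (e.symm w)).symm
  exact h1.trans (e.apply_symm_apply w)

theorem liftP_projL (a : G) {Y : E} (hY : Y ∈ 𝔭) : liftP K E' 𝔭 a (projL E K E' a Y) = Y := by
  obtain ⟨e, he⟩ := exists_projL_equiv hπ h𝔭 a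
  rw [liftP, ← he, ContinuousLinearMap.inverse_equiv]
  have h1 : projL E K E' a Y = e ⟨Y, hY⟩ := (DFunLike.congr_fun he (⟨Y, hY⟩ : 𝔭)).symm
  rw [h1]
  exact congrArg Subtype.val (e.symm_apply_apply ⟨Y, hY⟩)

theorem mder_horizontalLift (u : PathSpace E) (w : E') :
    mder 𝓘(ℝ, PathSpace E) 𝓘(ℝ, E') (parallelTransportQuotient K) u
      (horizontalLift (G := G) K E' 𝔭 u w) = w := by
  rw [(hasMD_parallelTransportQuotient hπ u).mder_eq]
  change projL E K E' _ (transportFormLeft G u (horizontalL G u (liftP K E' 𝔭 _ w))) = w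
  rw [transportFormLeft_horizontalL, projL_liftP hπ h𝔭]

/-- On the horizontal space `dΦ_N` is an isomorphism onto the tangent space of `G/K`, and
`horizontalLift` is its inverse. -/
theorem horizontal_inf_comap_eq (hAd : ∀ k ∈ K, ∀ X ∈ 𝔭, Ad (E := E) k X ∈ 𝔭) (u : PathSpace E)
    (W : Submodule ℝ E') :
    horizontal K (𝔭 : Submodule ℝ (GroupLieAlgebra 𝓘(ℝ, E) G)) u ⊓
      W.comap (mder 𝓘(ℝ, PathSpace E) 𝓘(ℝ, E') (parallelTransportQuotient (G := G) K) u).toLinearMap =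
      W.map (horizontalLift (G := G) K E' 𝔭 u).toLinearMap := by
  rw [horizontal_eq_map K 𝔭 hAd u]
  ext v
  constructor
  · rintro ⟨⟨Y, hY, rfl⟩, hv⟩
    refine ⟨_, hv, ?_⟩
    change horizontalL G u (liftP K E' 𝔭 _ (mder 𝓘(ℝ, PathSpace E) 𝓘(ℝ, E')
      (parallelTransportQuotient (G := G) K) u (horizontalL G u Y))) = horizontalL G u Y
    rw [(hasMD_parallelTransportQuotient hπ u).mder_eq]
    change horizontalL G u (liftP K E' 𝔭 _ (projL E K E' _
      (transportFormLeft G u (horizontalL G u Y)))) = horizontalL G u Y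
    rw [transportFormLeft_horizontalL, liftP_projL hπ h𝔭 _ hY]
  · rintro ⟨w, hw, rfl⟩
    refine ⟨⟨_, liftP_mem 𝔭 _ w, rfl⟩, ?_⟩
    change mder 𝓘(ℝ, PathSpace E) 𝓘(ℝ, E') (parallelTransportQuotient (G := G) K) u
      (horizontalLift (G := G) K E' 𝔭 u w) ∈ W
    rw [mder_horizontalLift hπ h𝔭]
    exact hw

/-- The horizontal lift is smooth, in a chart of `G/K`. -/
theorem exists_contDiffOn_horizontalLift (n₀ : G ⧸ K) :
    ∃ L : PathSpace E → E' →L[ℝ] PathSpace E,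
      ContDiffOn ℝ ∞ L (parallelTransportQuotient K ⁻¹' (chartAt E' n₀).source) ∧
      ∀ u ∈ parallelTransportQuotient K ⁻¹' (chartAt E' n₀).source, ∀ w : E',
        horizontalLift (G := G) K E' 𝔭 u w = L u (mder 𝓘(ℝ, E') 𝓘(ℝ, E') (extChartAt 𝓘(ℝ, E') n₀)
          (parallelTransportQuotient K u) w) := by
  have : CompleteSpace E := FiniteDimensional.complete ℝ E
  have : IsManifold 𝓘(ℝ, E') 1 (G ⧸ K) := .of_le (n := ∞) (by simp)
  let χ : G ⧸ K → E' := fun x => extChartAt 𝓘(ℝ, E') n₀ x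
  have hχ : ∀ n ∈ (chartAt E' n₀).source, ContMDiffAt 𝓘(ℝ, E') 𝓘(ℝ, E') ∞ χ n := fun n hn =>
    contMDiffAt_extChartAt' hn
  -- The differentials of the projection take values in varying tangent spaces; a fixed chart `χ`
  -- makes them a smooth operator-valued map `Q`. Inverting `Q` on `𝔭` instead of `projL` is why
  -- `dχ` appears in the argument of `L`.
  set Q : G → E →L[ℝ] E' := fun a =>
    mder 𝓘(ℝ, E) 𝓘(ℝ, E') (fun x : G => χ (x : G ⧸ K)) a ∘L leftTriv a
  have hQ : ∀ a : G, (a : G ⧸ K) ∈ (chartAt E' n₀).source →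
      ContMDiffAt 𝓘(ℝ, E) 𝓘(ℝ, E →L[ℝ] E') ∞ Q a := fun a ha =>
    contMDiffAt_mder_comp_leftTriv ((hχ a ha).comp _ hπ.contMDiff.contMDiffAt)
  have hequiv : ∀ a : G, (a : G ⧸ K) ∈ (chartAt E' n₀).source →
      ∃ (e' : E' ≃L[ℝ] E') (e : 𝔭 ≃L[ℝ] E'),
        (e' : E' →L[ℝ] E') = mder 𝓘(ℝ, E') 𝓘(ℝ, E') χ (a : G ⧸ K) ∧
        (e : 𝔭 →L[ℝ] E') = projL E K E' a ∘L 𝔭.subtypeL ∧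
        ((e.trans e' : 𝔭 ≃L[ℝ] E') : 𝔭 →L[ℝ] E') = Q a ∘L 𝔭.subtypeL := by
    intro a ha
    obtain ⟨e', he'⟩ : ∃ e : E' ≃L[ℝ] E',
        (e : E' →L[ℝ] E') = mder 𝓘(ℝ, E') 𝓘(ℝ, E') χ (a : G ⧸ K) :=
      isInvertible_mfderiv_extChartAt (by rwa [extChartAt_source])
    obtain ⟨e, he⟩ := exists_projL_equiv hπ h𝔭 a
    refine ⟨e', e, he', he, ?_⟩
    have h1 := ((hχ _ ha).hasMD (by simp)).comp_of_eq (hasMD_proj hπ a) rfl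
    have h2 : Q a = (e' : E' →L[ℝ] E') ∘L projL E K E' a := by
      simp only [Q]
      rw [h1.mder_eq, he']
      rfl
    rw [h2, ContinuousLinearMap.comp_assoc, ← he]
    rfl
  refine ⟨fun u => horizontalL G u ∘L 𝔭.subtypeL ∘L
    (Q (parallelTransport G u) ∘L 𝔭.subtypeL).inverse, fun u hu => ?_, fun u hu w => ?_⟩
  · have h1 : ContDiffAt ℝ ∞ (fun u : PathSpace E => Q (parallelTransport G u)) u :=
      ((hQ _ hu).comp u contMDiff_parallelTransport.contMDiffAt).contDiffAt
    have h2 : ContDiffAt ℝ ∞ (fun u : PathSpace E => Q (parallelTransport G u) ∘L 𝔭.subtypeL) u :=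
      h1.clm_comp contDiffAt_const
    obtain ⟨e', e, -, -, he⟩ := hequiv _ hu
    have h3 : ContDiffAt ℝ ∞ (ContinuousLinearMap.inverse : (𝔭 →L[ℝ] E') → E' →L[ℝ] 𝔭)
        (Q (parallelTransport G u) ∘L 𝔭.subtypeL) := by
      rw [← he]
      exact contDiffAt_map_inverse _
    have h4 : ContDiffAt ℝ ∞ (fun u : PathSpace E =>
        (Q (parallelTransport G u) ∘L 𝔭.subtypeL).inverse) u :=
      ContDiffAt.comp (g := (ContinuousLinearMap.inverse : (𝔭 →L[ℝ] E') → E' →L[ℝ] 𝔭))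
        (f := fun u : PathSpace E => Q (parallelTransport G u) ∘L 𝔭.subtypeL) u h3 h2
    exact ((contDiff_horizontalL (G := G) (E := E)).contDiffAt.clm_comp
      (contDiffAt_const.clm_comp h4)).contDiffWithinAt
  · obtain ⟨e', e, he', he, hee⟩ := hequiv _ hu
    change horizontalL G u (𝔭.subtypeL ((projL E K E' (parallelTransport G u) ∘L
        𝔭.subtypeL).inverse w)) =
      horizontalL G u (𝔭.subtypeL ((Q (parallelTransport G u) ∘L 𝔭.subtypeL).inverse _))
    rw [← hee, ContinuousLinearMap.inverse_equiv, ← he, ContinuousLinearMap.inverse_equiv]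
    have h1 : mder 𝓘(ℝ, E') 𝓘(ℝ, E') (extChartAt 𝓘(ℝ, E') n₀) (parallelTransportQuotient K u) w =
      e' w := (DFunLike.congr_fun he' w).symm
    rw [h1]
    change horizontalL G u (e.symm w : 𝔭) = horizontalL G u (e.symm (e'.symm (e' w)) : 𝔭)
    rw [e'.symm_apply_apply]

end HorizontalLift

/-! ### The lifted submanifold -/

section Lifted

open scoped BoundedContinuousFunction

variable {E : Type*} [NormedAddCommGroup E] [NormedSpace ℝ E] [FiniteDimensional ℝ E]
  {G : Type*} [TopologicalSpace G] [ChartedSpace E G] [Group G] [LieGroup 𝓘(ℝ, E) ∞ G] [T2Space G]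

theorem integralL_mulOp_const (C : E →L[ℝ] E) (v : PathSpace E) :
    integralL E (mulOp (BoundedContinuousFunction.const ℝ C) v) = C (integralL E v) := by
  have : CompleteSpace E := FiniteDimensional.complete ℝ E
  rw [integralL_apply, integralL_apply, primitiveL_apply, primitiveL_apply,
    ← C.intervalIntegral_comp_comm (intervalIntegrable_pathSpace v 0 1)]
  refine intervalIntegral.integral_congr_ae_restrict ?_
  exact ae_restrict_of_ae ((coeFn_mulOp (BoundedContinuousFunction.const ℝ C) v).mono
    fun t ht => ht)

/-- The form is `∫ Ad(Φ u)⁻¹ Ad(g_u) v`, and pointwise multiplication by these invertible operators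
is an automorphism of `L²`. So the logarithmic derivatives of `Φ` at all points are equivalent to
the integral. -/
theorem exists_equiv_transportFormLeft (u : PathSpace E) :
    ∃ N : PathSpace E ≃L[ℝ] PathSpace E, ∀ v, integralL E (N v) = transportFormLeft G u v := by
  set a := parallelTransport G u
  set c : G → ℝ →ᵇ (E →L[ℝ] E) := fun b => BoundedContinuousFunction.const ℝ (Ad b)
  have hc : c a⁻¹ * c a = 1 := by ext1 t; exact Ad_inv_comp a
  have hc' : c a * c a⁻¹ = 1 := by ext1 t; exact Ad_comp_inv a
  have h1 : (adTransportInv G u * c a) * (c a⁻¹ * adTransport G u) = 1 := by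
    rw [mul_assoc, ← mul_assoc (c a), hc', one_mul, adTransportInv_mul]
  have h2 : (c a⁻¹ * adTransport G u) * (adTransportInv G u * c a) = 1 := by
    rw [mul_assoc, ← mul_assoc (adTransport G u), adTransport_mul_inv, one_mul, hc]
  refine ⟨.equivOfInverse (mulOp (c a⁻¹ * adTransport G u)) (mulOp (adTransportInv G u * c a))
    (fun v => by rw [← mulOp_mul, h1, mulOp_one]) (fun v => by rw [← mulOp_mul, h2, mulOp_one]),
    fun v => ?_⟩
  change integralL E (mulOp (c a⁻¹ * adTransport G u) v) = _
  rw [mulOp_mul, integralL_mulOp_const]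
  rfl

variable {K : Subgroup G} {E' : Type*} [NormedAddCommGroup E'] [NormedSpace ℝ E']
  [FiniteDimensional ℝ E'] [ChartedSpace E' (G ⧸ K)] [IsManifold 𝓘(ℝ, E') ∞ (G ⧸ K)]
  (hπ : IsSubmersion 𝓘(ℝ, E) 𝓘(ℝ, E') ∞ (fun a : G => (a : G ⧸ K)))
  {EM : Type*} [NormedAddCommGroup EM] [NormedSpace ℝ EM] [FiniteDimensional ℝ EM]
  {M : Type*} [TopologicalSpace M] [ChartedSpace EM M] [IsManifold 𝓘(ℝ, EM) ∞ M]

include hπ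

theorem exists_equiv_projL (a : G) :
    ∃ e : E' ≃L[ℝ] E', (e : E' →L[ℝ] E') ∘L projL E K E' 1 = projL E K E' a := by
  have h1 := (contMDiff_smul_quotient hπ a).contMDiffAt.hasMD (x := ((1 : G) : G ⧸ K)) (by simp)
  have h2 := (contMDiff_smul_quotient hπ a⁻¹).contMDiffAt.hasMD (x := a • ((1 : G) : G ⧸ K)) (by simp)
  have h3 := (h2.comp h1).unique (hasMD_id.congr (Filter.Eventually.of_forall fun x =>
    inv_smul_smul a x))
  have h4 := (h1.comp_of_eq h2 (inv_smul_smul a _)).unique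
    (hasMD_id.congr (Filter.Eventually.of_forall fun x => smul_inv_smul a x))
  exact ⟨.equivOfInverse _ _ (fun v => DFunLike.congr_fun h3 v) (fun v => DFunLike.congr_fun h4 v),
    (projL_eq hπ a).symm⟩

/-- The lifted submanifold is an embedded submanifold, with the expected tangent spaces. -/
theorem exists_isSmoothEmbedding_liftedInclusion {φ : M → G ⧸ K}
    (hφ : ContMDiff 𝓘(ℝ, EM) 𝓘(ℝ, E') ∞ φ) :
    ∃ (F : Submodule ℝ (EM × PathSpace E)) (_ : IsClosed (F : Set (EM × PathSpace E)))
      (_ : ChartedSpace F (LiftedSubmanifold E φ))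
      (_ : IsManifold 𝓘(ℝ, F) ∞ (LiftedSubmanifold E φ)),
      IsSmoothEmbedding 𝓘(ℝ, F) (𝓘(ℝ, EM).prod 𝓘(ℝ, PathSpace E)) ∞ (liftedInclusion E φ) ∧
      (∀ p, Function.Injective (mder 𝓘(ℝ, F) (𝓘(ℝ, EM).prod 𝓘(ℝ, PathSpace E))
        (liftedInclusion E φ) p)) ∧
      ∀ p x, x ∈ (mder 𝓘(ℝ, F) (𝓘(ℝ, EM).prod 𝓘(ℝ, PathSpace E)) (liftedInclusion E φ) p).range ↔
        mder 𝓘(ℝ, EM) 𝓘(ℝ, E') φ p.1.1 x.1 =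
          mder 𝓘(ℝ, PathSpace E) 𝓘(ℝ, E') (parallelTransportQuotient (G := G) K) p.1.2 x.2 := by
  have : CompleteSpace E := FiniteDimensional.complete ℝ E
  have : CompleteSpace EM := FiniteDimensional.complete ℝ EM
  have : IsManifold 𝓘(ℝ, E') 1 (G ⧸ K) := .of_le (n := ∞) (by simp)
  obtain ⟨σ, hσ⟩ : ∃ σ : E' →L[ℝ] E, ∀ w, projL E K E' 1 (σ w) = w := by
    obtain ⟨σ, hσ⟩ := (projL E K E' (1 : G) : E →ₗ[ℝ] E').exists_rightInverse_of_surjective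
      (LinearMap.range_eq_top.2 (projL_surjective hπ 1))
    exact ⟨σ.toContinuousLinearMap, fun w => DFunLike.congr_fun hσ w⟩
  -- The common model of the differentials of all local defining functions: `dπ ∘ ∫` on the second
  -- factor, with a right inverse built from constant paths.
  set T₀ : EM × PathSpace E →L[ℝ] E' :=
    projL E K E' 1 ∘L integralL E ∘L ContinuousLinearMap.snd ℝ EM (PathSpace E)
  set R : E' →L[ℝ] EM × PathSpace E :=
    ContinuousLinearMap.inr ℝ EM (PathSpace E) ∘L constPath E ∘L σ
  have hR : ∀ w, T₀ (R w) = w := fun w => by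
    change projL E K E' 1 (integralL E (constPath E (σ w))) = w
    rw [integralL_constPath, hσ]
  set χ : G ⧸ K → G ⧸ K → E' := fun n x => extChartAt 𝓘(ℝ, E') n x
  have hχ : ∀ n, ContMDiffOn 𝓘(ℝ, E') 𝓘(ℝ, E') ∞ (χ n) (chartAt E' n).source := fun n =>
    contMDiffOn_extChartAt
  have hχinj : ∀ n, InjOn (χ n) (chartAt E' n).source := fun n x hx y hy hxy =>
    (extChartAt 𝓘(ℝ, E') n).injOn (by rwa [extChartAt_source]) (by rwa [extChartAt_source]) hxy
  have hχe : ∀ n, ∃ e : E' ≃L[ℝ] E', (e : E' →L[ℝ] E') = mder 𝓘(ℝ, E') 𝓘(ℝ, E') (χ n) n := fun n =>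
    isInvertible_mfderiv_extChartAt (mem_extChartAt_source (I := 𝓘(ℝ, E')) n)
  choose eχ heχ using hχe
  choose eπ heπ using exists_equiv_projL (E' := E') hπ
  choose N hN using exists_equiv_transportFormLeft (E := E) (G := G)
  -- `Λ p` collects the dependence of `dπ` and of the chart on the point; applying its inverse to
  -- the local equation normalizes the differential to `T₀ ∘ J p`.
  set Λ : LiftedSubmanifold E φ → E' ≃L[ℝ] E' := fun p =>
    (eπ (parallelTransport G p.1.2)).trans (eχ (φ p.1.1))
  set h : LiftedSubmanifold E φ → M × PathSpace E → E' := fun p x =>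
    (Λ p).symm (χ (φ p.1.1) (parallelTransportQuotient K x.2)) - (Λ p).symm (χ (φ p.1.1) (φ x.1))
  set O : LiftedSubmanifold E φ → Set (M × PathSpace E) := fun p =>
    {x | parallelTransportQuotient K x.2 ∈ (chartAt E' (φ p.1.1)).source ∧
      φ x.1 ∈ (chartAt E' (φ p.1.1)).source}
  have hΦ : ContMDiff (𝓘(ℝ, EM).prod 𝓘(ℝ, PathSpace E)) 𝓘(ℝ, E') ∞
      fun x : M × PathSpace E => parallelTransportQuotient (G := G) K x.2 :=
    (contMDiff_parallelTransportQuotient hπ).comp contMDiff_snd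
  have hφ' : ContMDiff (𝓘(ℝ, EM).prod 𝓘(ℝ, PathSpace E)) 𝓘(ℝ, E') ∞
      fun x : M × PathSpace E => φ x.1 := hφ.comp contMDiff_fst
  have hO : ∀ p, IsOpen (O p) := fun p =>
    ((chartAt E' (φ p.1.1)).open_source.preimage hΦ.continuous).inter
      ((chartAt E' (φ p.1.1)).open_source.preimage hφ'.continuous)
  have hpO : ∀ p, liftedInclusion E φ p ∈ O p := fun p =>
    ⟨by
      have h1 : φ p.1.1 = parallelTransportQuotient K p.1.2 := p.2
      change parallelTransportQuotient K p.1.2 ∈ _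
      rw [← h1]
      exact mem_chart_source E' _, mem_chart_source E' _⟩
  have hh : ∀ p, ContMDiffOn (𝓘(ℝ, EM).prod 𝓘(ℝ, PathSpace E)) 𝓘(ℝ, E') ∞ (h p) (O p) := fun p =>
    (((Λ p).symm.contDiff (n := ∞)).contMDiff.comp_contMDiffOn
      ((hχ _).comp hΦ.contMDiffOn fun x hx => hx.1)).sub
    (((Λ p).symm.contDiff (n := ∞)).contMDiff.comp_contMDiffOn
      ((hχ _).comp hφ'.contMDiffOn fun x hx => hx.2))
  have hz : ∀ p, ∀ x ∈ O p, x ∈ range (liftedInclusion E φ) ↔ h p x = 0 := fun p x hx => by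
    simp only [h, sub_eq_zero, (Λ p).symm.injective.eq_iff, (hχinj _).eq_iff hx.1 hx.2]
    constructor
    · rintro ⟨y, rfl⟩
      exact y.2.symm
    · intro hxy
      exact ⟨⟨x, hxy.symm⟩, rfl⟩
  set c : LiftedSubmanifold E φ → EM →L[ℝ] E' := fun p =>
    ((Λ p).symm : E' →L[ℝ] E') ∘L (eχ (φ p.1.1) : E' →L[ℝ] E') ∘L mder 𝓘(ℝ, EM) 𝓘(ℝ, E') φ p.1.1
  set b : LiftedSubmanifold E φ → EM →L[ℝ] PathSpace E := fun p => constPath E ∘L σ ∘L c p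
  -- The automorphism `N` of the path space combined with a shear along `M`; the shear `b p`, built
  -- with the constant paths above, absorbs the `dφ` term.
  set J : LiftedSubmanifold E φ → (EM × PathSpace E) ≃L[ℝ] (EM × PathSpace E) := fun p =>
    .equivOfInverse
      ((ContinuousLinearMap.fst ℝ EM (PathSpace E)).prod
        ((N p.1.2 : PathSpace E →L[ℝ] PathSpace E) ∘L ContinuousLinearMap.snd ℝ EM (PathSpace E) -
          b p ∘L ContinuousLinearMap.fst ℝ EM (PathSpace E)))
      ((ContinuousLinearMap.fst ℝ EM (PathSpace E)).prod
        (((N p.1.2).symm : PathSpace E →L[ℝ] PathSpace E) ∘L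
          (ContinuousLinearMap.snd ℝ EM (PathSpace E) +
          b p ∘L ContinuousLinearMap.fst ℝ EM (PathSpace E))))
      (fun x => by simp) (fun x => by simp)
  have hJT : ∀ p x, (T₀ ∘L (J p : EM × PathSpace E →L[ℝ] EM × PathSpace E)) x =
      projL E K E' 1 (transportFormLeft G p.1.2 x.2) - c p x.1 := fun p x => by
    change projL E K E' 1 (integralL E (N p.1.2 x.2 - constPath E (σ (c p x.1)))) = _
    rw [map_sub, hN, integralL_constPath, map_sub, hσ]
  have hΛ : ∀ p v, Λ p (projL E K E' 1 v) = eχ (φ p.1.1)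
      (projL E K E' (parallelTransport G p.1.2) v) := fun p v => by
    rw [← heπ (parallelTransport G p.1.2)]
    rfl
  have hd : ∀ p, mder (𝓘(ℝ, EM).prod 𝓘(ℝ, PathSpace E)) 𝓘(ℝ, E') (h p) (liftedInclusion E φ p) =
      T₀ ∘L (J p : EM × PathSpace E →L[ℝ] EM × PathSpace E) := fun p => by
    have h1 : φ p.1.1 = parallelTransportQuotient K p.1.2 := p.2
    have hχ1 : HasMD 𝓘(ℝ, E') 𝓘(ℝ, E') (χ (φ p.1.1)) (φ p.1.1) (eχ (φ p.1.1) : E' →L[ℝ] E') := by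
      rw [heχ]
      exact ((hχ _).contMDiffAt ((chartAt E' (φ p.1.1)).open_source.mem_nhds
        (mem_chart_source E' _))).hasMD (by simp)
    have h2 : HasMD (𝓘(ℝ, EM).prod 𝓘(ℝ, PathSpace E)) 𝓘(ℝ, E')
        (fun x : M × PathSpace E => parallelTransportQuotient (G := G) K x.2)
        (liftedInclusion E φ p) _ :=
      HasMD.comp (I₂ := 𝓘(ℝ, PathSpace E)) (f := Prod.snd) (x := liftedInclusion E φ p)
        (hasMD_parallelTransportQuotient hπ p.1.2) hasMD_snd
    have h3 : HasMD (𝓘(ℝ, EM).prod 𝓘(ℝ, PathSpace E)) 𝓘(ℝ, E')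
        (fun x : M × PathSpace E => φ x.1) (liftedInclusion E φ p) _ :=
      HasMD.comp (I₂ := 𝓘(ℝ, EM)) (f := Prod.fst) (x := liftedInclusion E φ p)
        (hφ.contMDiffAt.hasMD (x := p.1.1) (by simp)) hasMD_fst
    have h4 := (hχ1.comp_of_eq h2 h1.symm).clm_comp_left ((Λ p).symm : E' →L[ℝ] E')
    have h5 := (hχ1.comp_of_eq h3 rfl).clm_comp_left ((Λ p).symm : E' →L[ℝ] E')
    have h6 : HasMD (𝓘(ℝ, EM).prod 𝓘(ℝ, PathSpace E)) 𝓘(ℝ, E') (h p) (liftedInclusion E φ p) _ :=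
      HasMFDerivAt.sub h4 h5
    refine h6.mder_eq.trans (ContinuousLinearMap.ext fun x => ?_)
    refine Eq.trans ?_ (hJT p x).symm
    change (Λ p).symm (eχ (φ p.1.1) (projL E K E' (parallelTransport G p.1.2)
      (transportFormLeft G p.1.2 x.2))) - c p x.1 = _
    rw [← hΛ, (Λ p).symm_apply_apply]
  obtain ⟨cs, hm, hemb, hinj, hrange⟩ := exists_isSmoothEmbedding_of_zeroSet
    (I := 𝓘(ℝ, EM).prod 𝓘(ℝ, PathSpace E)) (ι := liftedInclusion E φ)
    IsEmbedding.subtypeVal T₀ R hR h O hO hpO hh hz J hd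
  refine ⟨T₀.ker, T₀.isClosed_ker, cs, hm, hemb, hinj, fun p x => ?_⟩
  rw [hrange, hd, LinearMap.mem_ker]
  change (T₀ ∘L (J p : EM × PathSpace E →L[ℝ] EM × PathSpace E)) x = 0 ↔ _
  rw [hJT, sub_eq_zero, (hasMD_parallelTransportQuotient hπ p.1.2).mder_eq]
  have h7 : c p x.1 = (Λ p).symm (eχ (φ p.1.1) (mder 𝓘(ℝ, EM) 𝓘(ℝ, E') φ p.1.1 x.1)) := rfl
  rw [h7, ← (Λ p).injective.eq_iff, hΛ, (Λ p).apply_symm_apply, (eχ _).injective.eq_iff]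
  exact eq_comm

end Lifted

/-! ### The lifted transversal bundle -/

section LiftedBundle

/-- The rank is the difference of dimensions, hence independent of the point, as the immersion
criterion requires. -/
theorem exists_linearIndependent_span_eq_map {E₁ E₂ V : Type*} [NormedAddCommGroup E₁]
    [NormedSpace ℝ E₁] [NormedAddCommGroup E₂] [NormedSpace ℝ E₂] [FiniteDimensional ℝ E₂]
    [NormedAddCommGroup V] [NormedSpace ℝ V] {A : E₁ →L[ℝ] E₂} (hA : Function.Injective A)
    {W : Submodule ℝ E₂} (hW : IsCompl A.range W) {L : E₂ →L[ℝ] V} (hL : Function.Injective L) :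
    ∃ s : Fin (Module.finrank ℝ E₂ - Module.finrank ℝ E₁) → V,
      LinearIndependent ℝ s ∧ Submodule.span ℝ (range s) = W.map L.toLinearMap := by
  have h1 := Submodule.finrank_add_eq_of_isCompl hW
  have h2 : Module.finrank ℝ A.range = Module.finrank ℝ E₁ := LinearMap.finrank_range_of_inj hA
  let b := Module.finBasisOfFinrankEq ℝ W
    (show Module.finrank ℝ W = Module.finrank ℝ E₂ - Module.finrank ℝ E₁ by omega)
  let T := L.toLinearMap ∘ₗ W.subtype
  refine ⟨fun i => T (b i), b.linearIndependent.map' T (LinearMap.ker_eq_bot.2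
    (hL.comp Subtype.val_injective)), ?_⟩
  have h4 := Submodule.map_span T (range b)
  rw [b.span_eq, ← range_comp, Submodule.map_top, LinearMap.range_comp, Submodule.range_subtype]
    at h4
  exact h4.symm

/-- The trivialization of the tangent bundle at `n₀` acts on fibres as the differential of the chart
at `n₀`. -/
theorem contMDiffOn_extChartAt_tangent {EM M E' N : Type*} [NormedAddCommGroup EM]
    [NormedSpace ℝ EM] [TopologicalSpace M] [ChartedSpace EM M] [NormedAddCommGroup E']
    [NormedSpace ℝ E'] [TopologicalSpace N] [ChartedSpace E' N] [IsManifold 𝓘(ℝ, E') 1 N]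
    [IsManifold 𝓘(ℝ, E') ∞ N]
    {φ : M → N} {s : ∀ q, TangentSpace 𝓘(ℝ, E') (φ q)} {U : Set M}
    (hs : ContMDiffOn 𝓘(ℝ, EM) 𝓘(ℝ, E').tangent ∞
      (fun q => (⟨φ q, s q⟩ : TangentBundle 𝓘(ℝ, E') N)) U) (n₀ : N) :
    ContMDiffOn 𝓘(ℝ, EM) 𝓘(ℝ, E') ∞
      (fun q => mder 𝓘(ℝ, E') 𝓘(ℝ, E') (extChartAt 𝓘(ℝ, E') n₀) (φ q) (s q))
      (U ∩ φ ⁻¹' (chartAt E' n₀).source) := by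
  have hmaps : MapsTo (fun q => (⟨φ q, s q⟩ : TangentBundle 𝓘(ℝ, E') N))
      (U ∩ φ ⁻¹' (chartAt E' n₀).source)
      (trivializationAt E' (TangentSpace 𝓘(ℝ, E')) n₀).source := by
    intro q hq
    rw [TangentBundle.trivializationAt_source]
    exact hq.2
  have h := (((trivializationAt E' (TangentSpace 𝓘(ℝ, E')) n₀).contMDiffOn_iff
    (IB := 𝓘(ℝ, E')) (IM := 𝓘(ℝ, EM)) (n := ∞) hmaps).1 (hs.mono inter_subset_left)).2
  refine h.congr fun q hq => ?_
  have hb : φ q ∈ (trivializationAt E' (TangentSpace 𝓘(ℝ, E')) n₀).baseSet := by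
    rw [TangentBundle.trivializationAt_baseSet]; exact hq.2
  have h1 := TangentBundle.continuousLinearMapAt_trivializationAt (I := 𝓘(ℝ, E')) (x₀ := n₀)
    (x := φ q) hq.2
  have h2 := DFunLike.congr_fun h1 (s q)
  refine h2.symm.trans ?_
  exact congrFun ((trivializationAt E' (TangentSpace 𝓘(ℝ, E')) n₀).coe_linearMapAt_of_mem
    (R := ℝ) hb) (s q)

variable {E : Type*} [NormedAddCommGroup E] [NormedSpace ℝ E] [FiniteDimensional ℝ E]
  {G : Type*} [TopologicalSpace G] [ChartedSpace E G] [Group G] [LieGroup 𝓘(ℝ, E) ∞ G] [T2Space G]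
  {K : Subgroup G} {E' : Type*} [NormedAddCommGroup E'] [NormedSpace ℝ E']
  [FiniteDimensional ℝ E'] [ChartedSpace E' (G ⧸ K)] [IsManifold 𝓘(ℝ, E') ∞ (G ⧸ K)]
  (hπ : IsSubmersion 𝓘(ℝ, E) 𝓘(ℝ, E') ∞ (fun a : G => (a : G ⧸ K)))
  {𝔭 : Submodule ℝ E} (h𝔭 : IsCompl (projL E K E' (1 : G)).ker 𝔭)
  {EM : Type*} [NormedAddCommGroup EM] [NormedSpace ℝ EM]
  {M : Type*} [TopologicalSpace M] [ChartedSpace EM M]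

include hπ h𝔭

theorem horizontalLift_injective (u : PathSpace E) :
    Function.Injective (horizontalLift (G := G) K E' 𝔭 u) := fun v w h => by
  rw [← mder_horizontalLift hπ h𝔭 u v, h, mder_horizontalLift hπ h𝔭]

/-- Lift a frame of `W`. Over a chart domain the lift is a smooth operator applied to the chart
components of the frame; injectivity of the lift preserves independence. -/
theorem exists_isSmoothFrame_horizontalLift {φ : M → G ⧸ K} {W : M → Submodule ℝ E'}
    [IsManifold 𝓘(ℝ, E') 1 (G ⧸ K)]
    (hφ : Continuous φ) (hW : IsTransversalBundle EM (E₂ := E') φ W)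
    {B X : Type*} [NormedAddCommGroup B] [NormedSpace ℝ B] [TopologicalSpace X] [ChartedSpace B X]
    {g : X → M} {f : X → PathSpace E} (hg : ContMDiff 𝓘(ℝ, B) 𝓘(ℝ, EM) ∞ g)
    (hf : ContMDiff 𝓘(ℝ, B) 𝓘(ℝ, PathSpace E) ∞ f)
    (hgf : ∀ x, φ (g x) = parallelTransportQuotient K (f x)) (x₀ : X) :
    ∃ U : Set X, x₀ ∈ U ∧ ∃ (r : ℕ) (s : Fin r → X → PathSpace E),
      IsSmoothFrame B (E₂ := PathSpace E) f
        (fun x => (W (g x)).map (horizontalLift (G := G) K E' 𝔭 (f x)).toLinearMap) U s := by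
  obtain ⟨U, hU, r, s, hs⟩ := hW.exists_frame (g x₀)
  obtain ⟨L, hL, hLs⟩ := exists_contDiffOn_horizontalLift hπ h𝔭 (φ (g x₀))
  set S := (chartAt E' (φ (g x₀))).source
  have hmem : ∀ x ∈ g ⁻¹' (U ∩ φ ⁻¹' S), f x ∈ parallelTransportQuotient K ⁻¹' S := fun x hx => by
    have := hx.2
    rwa [mem_preimage, hgf] at this
  refine ⟨g ⁻¹' (U ∩ φ ⁻¹' S), ⟨hU, mem_chart_source E' _⟩, r,
    fun i x => horizontalLift (G := G) K E' 𝔭 (f x) (s i (g x)), ?_, fun i => ?_, fun x hx => ?_,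
    fun x hx => ?_⟩
  · exact (hs.isOpen.inter ((chartAt E' _).open_source.preimage hφ)).preimage hg.continuous
  · refine contMDiffOn_tangentBundle_vectorSpace.2 ⟨hf.contMDiffOn, ?_⟩
    have h1 := (contMDiffOn_extChartAt_tangent (hs.contMDiffOn i) (φ (g x₀))).comp
      hg.contMDiffOn (s := g ⁻¹' (U ∩ φ ⁻¹' S)) fun x hx => hx
    have h2 : ContMDiffOn 𝓘(ℝ, B) 𝓘(ℝ, E' →L[ℝ] PathSpace E) ∞ (fun x => L (f x))
        (g ⁻¹' (U ∩ φ ⁻¹' S)) := hL.contMDiffOn.comp hf.contMDiffOn hmem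
    refine (h2.clm_apply h1).congr fun x hx => ?_
    have h3 := hLs (f x) (hmem x hx) (s i (g x))
    rw [← hgf] at h3
    exact h3
  · exact (hs.linearIndependent (g x) hx.1).map' _
      (LinearMap.ker_eq_bot.2 (horizontalLift_injective (G := G) hπ h𝔭 (f x)))
  · let σ : Fin r → E' := fun i => s i (g x)
    have h1 : Submodule.span ℝ (range σ) = W (g x) := hs.span_eq (g x) hx.1
    have h2 := Submodule.map_span (horizontalLift (G := G) K E' 𝔭 (f x)).toLinearMap (range σ)
    rw [h1, ← range_comp] at h2
    exact h2.symm

/-- If the lift of `w ∈ W` is tangent, then `w = dΦ_N(lift w)` is also in the range of `A`, so `w =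
0`. For any `v`, split `dΦ_N v = A x + w`; then `(x, v - lift w)` satisfies the tangency equation.
-/
theorem isCompl_map_horizontalLift {B : Type*} [NormedAddCommGroup B] [NormedSpace ℝ B]
    {u : PathSpace E} {A : EM →L[ℝ] E'} {D : B →L[ℝ] EM × PathSpace E} {W : Submodule ℝ E'}
    (hW : IsCompl A.range W)
    (hD : ∀ x, x ∈ D.range ↔ A x.1 =
      mder 𝓘(ℝ, PathSpace E) 𝓘(ℝ, E') (parallelTransportQuotient (G := G) K) u x.2) :
    IsCompl (ContinuousLinearMap.snd ℝ EM (PathSpace E) ∘L D).range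
      (W.map (horizontalLift (G := G) K E' 𝔭 u).toLinearMap) := by
  constructor
  · rw [Submodule.disjoint_def]
    rintro _ ⟨X, rfl⟩ ⟨w, hw, hwX⟩
    have h1 : A (D X).1 = mder 𝓘(ℝ, PathSpace E) 𝓘(ℝ, E')
      (parallelTransportQuotient (G := G) K) u (D X).2 := (hD (D X)).1 ⟨X, rfl⟩
    have h2 : horizontalLift (G := G) K E' 𝔭 u w = (D X).2 := hwX
    rw [← h2, mder_horizontalLift hπ h𝔭] at h1
    have h3 : w = 0 := Submodule.disjoint_def.1 hW.disjoint w ⟨_, h1⟩ hw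
    change (D X).2 = 0
    rw [← h2, h3, map_zero]
  · rw [codisjoint_iff, eq_top_iff]
    intro v _
    obtain ⟨_, ⟨x, rfl⟩, w, hw, hv⟩ := Submodule.mem_sup.1 (hW.sup_eq_top.symm ▸ Submodule.mem_top :
      mder 𝓘(ℝ, PathSpace E) 𝓘(ℝ, E') (parallelTransportQuotient (G := G) K) u v ∈ A.range ⊔ W)
    obtain ⟨X, hX⟩ := (hD (x, v - horizontalLift (G := G) K E' 𝔭 u w)).2 (by
      change A x = mder 𝓘(ℝ, PathSpace E) 𝓘(ℝ, E') (parallelTransportQuotient (G := G) K) u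
        (v - horizontalLift (G := G) K E' 𝔭 u w)
      rw [map_sub, mder_horizontalLift hπ h𝔭, ← hv]
      exact (add_sub_cancel_right (A x) w).symm)
    exact Submodule.mem_sup.2 ⟨v - horizontalLift (G := G) K E' 𝔭 u w, ⟨X, congrArg Prod.snd hX⟩, _,
      ⟨w, hw, rfl⟩, sub_add_cancel _ _⟩

end LiftedBundle

end

theorem theorem1p2
    -- a connected Lie group `G`
    {E : Type*} [NormedAddCommGroup E] [NormedSpace ℝ E] [FiniteDimensional ℝ E]
    {G : Type*} [TopologicalSpace G] [ChartedSpace E G] [Group G] [LieGroup 𝓘(ℝ, E) ∞ G]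
    [T2Space G] [ConnectedSpace G]
    -- a closed subgroup `K`, and the coset manifold `N = G/K`, with the unique smooth structure
    -- for which the projection is a submersion
    (K : Subgroup G) (hK : IsClosed (K : Set G))
    {E' : Type*} [NormedAddCommGroup E'] [NormedSpace ℝ E'] [FiniteDimensional ℝ E']
    [ChartedSpace E' (G ⧸ K)] [IsManifold 𝓘(ℝ, E') ∞ (G ⧸ K)]
    (hπ : IsSubmersion 𝓘(ℝ, E) 𝓘(ℝ, E') ∞ (fun a : G => (a : G ⧸ K)))
    -- a reductive decomposition
    (𝔭 : Submodule ℝ (GroupLieAlgebra 𝓘(ℝ, E) G)) (h𝔭 : IsReductiveDecomposition K 𝔭)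
    -- an immersed submanifold `φ : M → N` with transversal bundle `W`
    {EM : Type*} [NormedAddCommGroup EM] [NormedSpace ℝ EM] [FiniteDimensional ℝ EM]
    {M : Type*} [TopologicalSpace M] [ChartedSpace EM M] [IsManifold 𝓘(ℝ, EM) ∞ M]
    (φ : M → G ⧸ K) (hφ : IsImmersion 𝓘(ℝ, EM) 𝓘(ℝ, E') ∞ φ)
    (W : ∀ p, Submodule ℝ (TangentSpace 𝓘(ℝ, E') (φ p)))
    (hW : IsTransversalBundle EM φ W) :
    -- `M̂` is an embedded submanifold of `M × V_𝔤`, modelled on a closed subspace `F` of the model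
    -- space `EM × V_𝔤`
    ∃ (F : Submodule ℝ (EM × PathSpace E)) (_ : IsClosed (F : Set (EM × PathSpace E)))
      (_ : ChartedSpace F (LiftedSubmanifold E φ))
      (_ : IsManifold 𝓘(ℝ, F) ∞ (LiftedSubmanifold E φ)),
      IsSmoothEmbedding 𝓘(ℝ, F) (𝓘(ℝ, EM).prod 𝓘(ℝ, PathSpace E)) ∞ (liftedInclusion E φ) ∧
      -- `φ̂ : M̂ → V_𝔤` is an immersion of finite codimension with transversal bundle `Ŵ`
      IsImmersion 𝓘(ℝ, F) 𝓘(ℝ, PathSpace E) ∞ (liftedMap E φ) ∧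
      IsTransversalBundle F (E₂ := PathSpace E) (liftedMap E φ) (liftedBundle 𝔭 φ W) ∧
      -- (B) and (A)
      HasCompactShapeOperators F (liftedMap E φ) (liftedBundle 𝔭 φ W) ∧
      HasFredholmEndPointMap F (liftedMap E φ) (liftedBundle 𝔭 φ W) := by
  have : CompleteSpace E := FiniteDimensional.complete ℝ E
  have : CompleteSpace EM := FiniteDimensional.complete ℝ EM
  have hφs : ContMDiff 𝓘(ℝ, EM) 𝓘(ℝ, E') ∞ φ := hφ.contMDiff
  have hc : IsCompl (projL E K E' (1 : G)).ker (𝔭 : Submodule ℝ E) := by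
    rw [ker_projL_one hπ]
    exact h𝔭.isCompl
  obtain ⟨F, hF, hch, hman, hemb, hinj, hrange⟩ :=
    exists_isSmoothEmbedding_liftedInclusion (E := E) (K := K) hπ hφs
  have : CompleteSpace F := hF.completeSpace_coe
  have hι : ContMDiff 𝓘(ℝ, F) (𝓘(ℝ, EM).prod 𝓘(ℝ, PathSpace E)) ∞ (liftedInclusion E φ) :=
    hemb.contMDiff
  have hf : ContMDiff 𝓘(ℝ, F) 𝓘(ℝ, PathSpace E) ∞ (liftedMap E φ) := contMDiff_snd.comp hι
  have hg : ContMDiff 𝓘(ℝ, F) 𝓘(ℝ, EM) ∞ (fun x : LiftedSubmanifold E φ => x.1.1) :=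
    contMDiff_fst.comp hι
  have hder : ∀ p, mder 𝓘(ℝ, F) 𝓘(ℝ, PathSpace E) (liftedMap E φ) p =
      ContinuousLinearMap.snd ℝ EM (PathSpace E) ∘L
        mder 𝓘(ℝ, F) (𝓘(ℝ, EM).prod 𝓘(ℝ, PathSpace E)) (liftedInclusion E φ) p := fun p =>
    (hasMD_snd.comp ((hι p).hasMD (by simp))).mder_eq
  -- A tangent vector `(x, v)` with `v = 0` satisfies `dφ x = dΦ_N v = 0`, and `φ` is an immersion.
  have hD : ∀ p, Function.Injective (mder 𝓘(ℝ, F) 𝓘(ℝ, PathSpace E) (liftedMap E φ) p) := by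
    intro p
    rw [hder]
    refine (injective_iff_map_eq_zero _).2 fun X hX => hinj p ?_
    rw [map_zero]
    have h2 : (mder 𝓘(ℝ, F) (𝓘(ℝ, EM).prod 𝓘(ℝ, PathSpace E)) (liftedInclusion E φ) p X).2 = 0 := hX
    have h1 := (hrange p _).1 ⟨X, rfl⟩
    refine Prod.ext (hφ.mder_injective p.1.1 ?_) h2
    refine h1.trans ?_
    rw [show (mder 𝓘(ℝ, F) (𝓘(ℝ, EM).prod 𝓘(ℝ, PathSpace E)) (liftedInclusion E φ) p).toLinearMap X
      = mder 𝓘(ℝ, F) (𝓘(ℝ, EM).prod 𝓘(ℝ, PathSpace E)) (liftedInclusion E φ) p X from rfl, h2]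
    exact (map_zero _).trans (map_zero _).symm
  have hbundle : ∀ x, liftedBundle 𝔭 φ W x =
      Submodule.map (horizontalLift (E := E) (G := G) K E' 𝔭 x.1.2).toLinearMap (W x.1.1 : Submodule ℝ E') :=
    fun x => horizontal_inf_comap_eq hπ hc h𝔭.ad_mem x.1.2 (W x.1.1)
  have hcompl : ∀ p, IsCompl (mder 𝓘(ℝ, F) 𝓘(ℝ, PathSpace E) (liftedMap E φ) p).range
      (liftedBundle 𝔭 φ W p) := fun p => by
    rw [hder, hbundle]
    exact isCompl_map_horizontalLift hπ hc (A := mder 𝓘(ℝ, EM) 𝓘(ℝ, E') φ p.1.1)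
      (hW.isCompl p.1.1) (hrange p)
  have hT : IsTransversalBundle F (E₂ := PathSpace E) (liftedMap E φ) (liftedBundle 𝔭 φ W) := by
    refine ⟨hcompl, fun p => ?_⟩
    rw [show liftedBundle 𝔭 φ W = _ from funext hbundle]
    exact exists_isSmoothFrame_horizontalLift hπ hc hφs.continuous hW hg hf (fun x => x.2) p
  have happ : ∀ (U : Set (LiftedSubmanifold E φ)) (s : LiftedSubmanifold E φ → PathSpace E),
      IsOpen U → ContMDiffOn 𝓘(ℝ, F) 𝓘(ℝ, PathSpace E) ∞ s U →
      (∀ q ∈ U, s q ∈ liftedBundle 𝔭 φ W q) → ∀ p ∈ U,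
        mder 𝓘(ℝ, F) 𝓘(ℝ, PathSpace E) s p ∈ approximableOperators F (PathSpace E) := by
    intro U s hU hs hsW p hp
    refine approximable_mder_of_horizontal (G := G) hU hf.contMDiffOn hs (fun q hq => ?_) hp
    -- The horizontal lift factors through `horizontalR`, so every section of `Ŵ` is horizontal.
    obtain ⟨w, -, hw⟩ := (hbundle q ▸ hsW q hq :)
    exact ⟨_, hw⟩
  refine ⟨F, hF, hch, hman, hemb, ?_, hT, hasCompactShapeOperators_of_approximable hD hT happ,
    hasFredholmEndPointMap_of_approximable hf hD hcompl happ⟩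
  -- The codimension of `φ̂` is that of `φ`.
  refine isImmersion_of_isTransversalBundle hf hD hcompl
    (Module.finrank ℝ E' - Module.finrank ℝ EM) fun p => ?_
  rw [hbundle]
  exact exists_linearIndependent_span_eq_map (A := mder 𝓘(ℝ, EM) 𝓘(ℝ, E') φ p.1.1)
    (hφ.mder_injective p.1.1) (hW.isCompl p.1.1) (horizontalLift_injective (G := G) hπ hc p.1.2)
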